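/- **Notation.** Let $m,k\in\mathbb C$ and $Q\in L^1_{\mathrm{loc}}]0,\infty[$ (complex-valued). Put $L^0_{m^2}=-\partial_x^2+(m^2-\tfrac14)x^{-2}$ and $L_{m^2}=L^0_{m^2}+Q(x)$. Let $AC^1]0,\infty[$ be the set of $C^1$ functions $f:]0,\infty[\to\mathbb C$ whose derivative is locally absolutely continuous, and let $\mathcal N(L^0_{m^2}+k^2)$ be the space of all $g^0\in AC^1]0,\infty[$ with $L^0_{m^2}g^0=-k^2g^0$. For $\varepsilon,\beta\ge 0$ write $Q\in\mathscr L^{(0)}_{\varepsilon}$ if $\int_0^1x^{1-\varepsilon}|Q(x)|\,dx<\infty$, and $Q\in\mathscr L^{(0)}_{\varepsilon,\ln^\beta}$ if $\int_0^1x^{1-\varepsilon}(1+|\ln x|^\beta)|Q(x)|\,dx<\infty$. Let $G^0_\to$ be the forward Green's operator of $L^0_{m^2}+k^2$, with kernel $$G^0_\to(x,y)=\theta(x-y)\,\frac{h_1(x)h_2(y)-h_2(x)h_1(y)}{h_1h_2'-h_1'h_2},$$ where $h_1,h_2$ is any basis of $\mathcal N(L^0_{m^2}+k^2)$ (the kernel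 does not depend on the basis) and $\theta$ is the Heaviside function; thus $(G^0_\to Qf)(x)=\int_0^xG^0_\to(x,y)Q(y)f(y)\,dy$. For a positive function $\phi$ let $L^\infty(]0,a[,\phi)$ be the space of (classes of) measurable $f$ on $]0,a[$ with $\operatorname{ess\,sup}_{0<x<a}|f(x)|/\phi(x)<\infty$. By $g=(1+G^0_\to Q)^{-1}g^0$, relative to a weight $\phi$ on $]0,\infty[$, we mean: for every $a>0$, $G^0_\to Q$ is given on $L^\infty(]0,a[,\phi)$ by absolutely convergent integrals and is bounded there, $1+G^0_\to Q$ has a bounded inverse on $L^\infty(]0,a[,\phi)$, the restrictions of $g^0$ and $g$ to $]0,a[$ belong to this space, and $g+G^0_\to Qg=g^0$ on $]0,\infty[$. **Theorem.** Let $\operatorname{Re}(k)\ge0$. 1. Suppose $\operatorname{Re}(m)\ge0$, $m\ne0$, $\varepsilon\ge0$ and $Q\in\mathscr L^{(0)}_\varepsilon$. Let $g^0\in\mathcal N(L^0_{m^2}+k^2)$ with $g^0=\mathcal O(x^{\frac12+\operatorname{Re}(m)})$ as $x\to0$. Then $g:=(1+G^0_\to Q)^{-1}g^0$ (with $\phi=x^{\frac12+\operatorname{Re}(m)}$)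 exists and is the unique solution in $AC^1]0,\infty[$ of $L_{m^2}g=-k^2g$ such that, as $x\to0$, $$g-g^0=o(x^{\frac12+\operatorname{Re}(m)+\varepsilon}),\qquad \partial_xg-\partial_xg^0=o(x^{-\frac12+\operatorname{Re}(m)+\varepsilon}).$$ 2. Suppose $m=0$, $\varepsilon\ge0$ and $Q\in\mathscr L^{(0)}_{\varepsilon,\ln}$. Let $g^0\in\mathcal N(L^0_{0}+k^2)$ with $g^0=\mathcal O(x^{\frac12})$ as $x\to0$. Then $g:=(1+G^0_\to Q)^{-1}g^0$ (with $\phi=x^{\frac12}$) exists and is the unique solution in $AC^1]0,\infty[$ of $L_{0}g=-k^2g$ such that, as $x\to0$, $$g-g^0=o(x^{\frac12+\varepsilon}),\qquad \partial_xg-\partial_xg^0=o(x^{-\frac12+\varepsilon}).$$ 3. Suppose $\operatorname{Re}(m)\ge0$, $m\ne0$, $\varepsilon\ge2\operatorname{Re}(m)$ and $Q\in\mathscr L^{(0)}_\varepsilon$. Let $g^0\in\mathcal N(L^0_{m^2}+k^2)$ be arbitrary. Then $g:=(1+G^0_\to Q)^{-1}g^0$ (with $\phi=x^{\frac12-\operatorname{Re}(m)}$)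 exists and is the unique solution in $AC^1]0,\infty[$ of $L_{m^2}g=-k^2g$ such that, as $x\to0$, $$g-g^0=o(x^{\frac12-\operatorname{Re}(m)+\varepsilon}),\qquad \partial_xg-\partial_xg^0=o(x^{-\frac12-\operatorname{Re}(m)+\varepsilon}).$$ 4. Suppose $m=0$, $\varepsilon\ge0$ and $Q\in\mathscr L^{(0)}_{\varepsilon,\ln^2}$. Let $g^0\in\mathcal N(L^0_{0}+k^2)$ be arbitrary. Then $g:=(1+G^0_\to Q)^{-1}g^0$ (with $\phi=x^{\frac12}(1+|\ln x|)$) exists and is the unique solution in $AC^1]0,\infty[$ of $L_{0}g=-k^2g$ such that, as $x\to0$, $$g-g^0=o(x^{\frac12+\varepsilon}),\qquad \partial_xg-\partial_xg^0=o(x^{-\frac12+\varepsilon}).$$ -/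

import Mathlib

open MeasureTheory Set Filter Topology Asymptotics
open scoped ENNReal

noncomputable section

namespace PerturbedBessel

/-! All functions live on the half-line `]0,∞[`, represented as functions `ℝ → ℂ` whose values on
`]-∞,0]` play no role. -/

/-- `AC]0,∞[`: functions that are absolutely continuous on every compact interval in `]0,∞[`. -/
def IsAC (f : ℝ → ℂ) : Prop :=
  ∀ a b : ℝ, 0 < a → 0 < b → AbsolutelyContinuousOnInterval f a b

/-- `AC¹]0,∞[`: differentiable functions on `]0,∞[` whose derivative belongs to `AC]0,∞[`. -/
def IsAC1 (f : ℝ → ℂ) : Prop :=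
  (∀ x : ℝ, 0 < x → DifferentiableAt ℝ f x) ∧ IsAC (deriv f)

/-- The expression `L_{m²} f = -f'' + (m² - 1/4) x⁻² f + Q f`; the unperturbed expression
`L⁰_{m²}` is the case `Q = 0`. -/
def besselExpr (m : ℂ) (Q : ℝ → ℂ) (f : ℝ → ℂ) (x : ℝ) : ℂ :=
  -deriv (deriv f) x + (m ^ 2 - 1 / 4) * (1 / (x : ℂ) ^ 2) * f x + Q x * f x

/-- `f ∈ AC¹]0,∞[` and `L_{m²} f = -k² f` (an identity in `L¹_loc]0,∞[`, i.e. almost everywhere).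
For `Q = 0` this is membership of `f` in the null space of `L⁰_{m²} + k²`. -/
def IsSolution (m k : ℂ) (Q : ℝ → ℂ) (f : ℝ → ℂ) : Prop :=
  IsAC1 f ∧ ∀ᵐ x ∂(volume.restrict (Ioi (0 : ℝ))), besselExpr m Q f x = -k ^ 2 * f x

/-- The Wronskian `W(f, g; x)`. -/
def wronskian (f g : ℝ → ℂ) (x : ℝ) : ℂ :=
  f x * deriv g x - deriv f x * g x

/-- A pair of solutions of the unperturbed equation `L⁰_{m²} h = -k² h` with non-zero Wronskian.
(The Wronskian of two solutions is constant on `]0,∞[`; it is evaluated at `1`.) -/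
def IsFundamentalPair (m k : ℂ) (h : (ℝ → ℂ) × (ℝ → ℂ)) : Prop :=
  IsSolution m k 0 h.1 ∧ IsSolution m k 0 h.2 ∧ wronskian h.1 h.2 1 ≠ 0

/-- A chosen fundamental pair of the unperturbed equation. -/
def fundamentalPair (m k : ℂ) : (ℝ → ℂ) × (ℝ → ℂ) :=
  Classical.epsilon (IsFundamentalPair m k)

/-- The kernel `G⁰_↔(x,y)` of the canonical bisolution of `L⁰_{m²} + k²`. It does not depend on
the choice of the fundamental pair. -/
def canonicalBisolution (m k : ℂ) (x y : ℝ) : ℂ :=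
  ((fundamentalPair m k).1 x * (fundamentalPair m k).2 y
    - (fundamentalPair m k).2 x * (fundamentalPair m k).1 y)
    / wronskian (fundamentalPair m k).1 (fundamentalPair m k).2 1

/-- The kernel `G⁰_→(x,y) = θ(x - y) G⁰_↔(x,y)` of the forward Green's operator. -/
def forwardGreen (m k : ℂ) (x y : ℝ) : ℂ :=
  if y ≤ x then canonicalBisolution m k x y else 0

/-- The operator `G⁰_→ Q`, that is `(G⁰_→ Q f)(x) = ∫₀^∞ G⁰_→(x,y) Q(y) f(y) dy`. -/
def greenQ (m k : ℂ) (Q : ℝ → ℂ) (f : ℝ → ℂ) (x : ℝ) : ℂ :=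
  ∫ y in Ioi (0 : ℝ), forwardGreen m k x y * (Q y * f y)

/-- The class `ℒ⁽⁰⁾_ε`: `Q ∈ L¹_loc]0,∞[` and `∫₀¹ x^{1-ε} |Q(x)| dx < ∞`. -/
def potentialClass (ε : ℝ) : Set (ℝ → ℂ) :=
  {Q | LocallyIntegrableOn Q (Ioi (0 : ℝ)) volume ∧
    IntegrableOn (fun x : ℝ => x ^ (1 - ε) * ‖Q x‖) (Ioo (0 : ℝ) 1) volume}

/-- The class `ℒ⁽⁰⁾_{ε,ln^β}`: `Q ∈ L¹_loc]0,∞[` and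
`∫₀¹ x^{1-ε} (1 + |ln x|^β) |Q(x)| dx < ∞`. -/
def logPotentialClass (ε β : ℝ) : Set (ℝ → ℂ) :=
  {Q | LocallyIntegrableOn Q (Ioi (0 : ℝ)) volume ∧
    IntegrableOn (fun x : ℝ => x ^ (1 - ε) * (1 + |Real.log x| ^ β) * ‖Q x‖)
      (Ioo (0 : ℝ) 1) volume}

/-- The norm `‖f / φ‖_∞` on `]0,a[` (a value in `[0,∞]`). -/
def weightedNorm (a : ℝ) (φ : ℝ → ℝ) (f : ℝ → ℂ) : ℝ≥0∞ :=
  eLpNorm (fun x => f x / (φ x : ℂ)) ∞ (volume.restrict (Ioo (0 : ℝ) a))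

/-- The functions representing elements of the weighted space `L^∞(]0,a[, φ)`: measurable with
`‖f / φ‖_∞ < ∞`. Two functions represent the same element iff they agree a.e. on `]0,a[`. -/
def weightedLinfty (a : ℝ) (φ : ℝ → ℝ) : Set (ℝ → ℂ) :=
  {f | MemLp (fun x => f x / (φ x : ℂ)) ∞ (volume.restrict (Ioo (0 : ℝ) a))}

/-- `1 + G⁰_→ Q` is a well-defined bounded operator on `L^∞(]0,a[, φ)` with a bounded inverse. -/
structure OneAddGreenInvertible (m k : ℂ) (Q : ℝ → ℂ) (a : ℝ) (φ : ℝ → ℝ) : Prop where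
  /-- the integrals defining `G⁰_→ Q f` on `]0,a[` converge absolutely -/
  integrable : ∀ f ∈ weightedLinfty a φ, ∀ x ∈ Ioo (0 : ℝ) a,
    IntegrableOn (fun y => forwardGreen m k x y * (Q y * f y)) (Ioi (0 : ℝ)) volume
  /-- `G⁰_→ Q` maps the space to itself -/
  mapsTo : ∀ f ∈ weightedLinfty a φ, greenQ m k Q f ∈ weightedLinfty a φ
  /-- `G⁰_→ Q` is bounded -/
  bounded : ∃ C : ℝ≥0∞, C ≠ ∞ ∧ ∀ f ∈ weightedLinfty a φ,
    weightedNorm a φ (greenQ m k Q f) ≤ C * weightedNorm a φ f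
  /-- `1 + G⁰_→ Q` is onto -/
  surjective : ∀ f ∈ weightedLinfty a φ, ∃ h ∈ weightedLinfty a φ,
    ∀ᵐ x ∂(volume.restrict (Ioo (0 : ℝ) a)), h x + greenQ m k Q h x = f x
  /-- `1 + G⁰_→ Q` is one-to-one with bounded inverse -/
  bounded_inverse : ∃ C : ℝ≥0∞, C ≠ ∞ ∧ ∀ h ∈ weightedLinfty a φ,
    weightedNorm a φ h ≤ C * weightedNorm a φ (fun x => h x + greenQ m k Q h x)

/-- `g = (1 + G⁰_→ Q)⁻¹ g⁰` on the whole of `]0,∞[`: for every `a > 0` the operator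
`1 + G⁰_→ Q` is invertible on `L^∞(]0,a[, φ)`, the restrictions of `g⁰` and `g` to `]0,a[` belong
to this space, and the inverse sends the first to the second. The last identity is required at
every point of `]0,∞[`, so that `g` itself, not only its class, is determined on `]0,∞[`. -/
structure IsInverseImage (m k : ℂ) (Q : ℝ → ℂ) (φ : ℝ → ℝ) (g₀ g : ℝ → ℂ) : Prop where
  invertible : ∀ a : ℝ, 0 < a → OneAddGreenInvertible m k Q a φ
  mem₀ : ∀ a : ℝ, 0 < a → g₀ ∈ weightedLinfty a φ
  mem : ∀ a : ℝ, 0 < a → g ∈ weightedLinfty a φ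
  eq : ∀ x : ℝ, 0 < x → g x + greenQ m k Q g x = g₀ x

/-- `g - g⁰ = o(x^σ)` and `g' - g⁰' = o(x^{σ-1})` as `x → 0`. -/
def MatchesNearZero (g₀ : ℝ → ℂ) (σ : ℝ) (g : ℝ → ℂ) : Prop :=
  (fun x => g x - g₀ x) =o[𝓝[>] (0 : ℝ)] (fun x => x ^ σ) ∧
  (fun x => deriv g x - deriv g₀ x) =o[𝓝[>] (0 : ℝ)] (fun x => x ^ (σ - 1))

/-- `g` is the unique solution in `AC¹]0,∞[` of `L_{m²} g = -k² g` such that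
`g - g⁰ = o(x^σ)` and `g' - g⁰' = o(x^{σ-1})` as `x → 0`. -/
def IsUniqueMatchingSolution (m k : ℂ) (Q : ℝ → ℂ) (g₀ : ℝ → ℂ) (σ : ℝ) (g : ℝ → ℂ) : Prop :=
  IsSolution m k Q g ∧ MatchesNearZero g₀ σ g ∧
    ∀ f : ℝ → ℂ, IsSolution m k Q f → MatchesNearZero g₀ σ f → EqOn f g (Ioi (0 : ℝ))

end PerturbedBessel

end

namespace PerturbedBessel

/-! ### Absolutely continuous functions -/

/-! Everything rests on one estimate of the unperturbed bisolution. With `η = x^(1/2 + Re m)` and `ω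
= x^(1/2 - Re m)` (for `m = 0`, `ω = x^(1/2) (1 + |log x|)`), the kernel is of size `ω(y) η(x)` for
`y ≤ x < a`, and its `x`-derivative of size `ω(y) η(x) / x`; this is `TamePair`. For `k = 0` it is
read off from the explicit solutions `x^(1/2 ± m)`, respectively `x^(1/2)` and `x^(1/2) log x`. No
Bessel functions are needed for `k ≠ 0`: the term `k²` is a constant perturbation, and a Gronwall
argument running backwards from `x` to `y` transfers the estimate to every fundamental pair
(`TamePair.backward_bound`, `TamePair.add_const`).

Let `φ` be a weight with `η ≤ C φ` on bounded intervals and `∫ ω φ |Q| < ∞` near `0`. Then the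
kernel of `G Q`, tested against `φ`, is at most `φ(x) ρ(y)` with `ρ` integrable and proportional to
`ω φ |Q|`. In the equivalent weight `φ exp(2 ∫₀ˣ ρ)` the operator has norm at most `1/2`
(`TamePair.volterraWeight`), so the Neumann series inverts `1 + G Q`. The resulting `g` satisfies `g
- g₀ = -G Q g`, and variation of constants shows that it solves the perturbed equation. The same
formula bounds `g - g₀` by `η(x) ∫₀ˣ ω φ |Q|` and the derivative by `1/x` times this. If `y^(-ε) ω φ
|Q|` is integrable near `0`, a factor `x^ε` can be extracted and what remains tends to `0`, which is
the required `o(x^(1/2 + Re m + ε))`.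

For uniqueness, the difference `d` of two matching solutions is `o(x^(1/2 + Re m))`, with the
corresponding bound on `d'`. The term `k²` is moved into the potential, so that `d` is compared with
the explicit pair for `k = 0`. The Wronskians of `d` with this pair vanish at `0`, hence `d` lies in
the kernel of `1 + G (Q + k²)` and is zero by the contraction estimate (`TamePair.eq_zero`). Only
the logarithmic solution for `m = 0` requires an additional argument (`eq_zero_of_isLittleO_log`).

The four cases differ only in the choice of `ω` and `φ`: principal `g₀` goes with `φ = η`, arbitrary
`g₀` with `φ = ω`. -/

theorem absolutelyContinuousOnInterval_congr {X : Type*} [PseudoMetricSpace X] {f g : ℝ → X}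
    {a b : ℝ} (hf : AbsolutelyContinuousOnInterval f a b) (h : EqOn f g (uIcc a b)) :
    AbsolutelyContinuousOnInterval g a b := by
  rw [absolutelyContinuousOnInterval_iff] at hf ⊢
  intro ε hε
  obtain ⟨δ, hδ, H⟩ := hf ε hε
  refine ⟨δ, hδ, fun E hE hlen => ?_⟩
  refine lt_of_eq_of_lt (Finset.sum_congr rfl fun i hi => ?_) (H E hE hlen)
  rw [h (hE.1 i hi).1, h (hE.1 i hi).2]

theorem lipschitzOnWith_comp_absolutelyContinuousOnInterval {X Y : Type*} [PseudoMetricSpace X]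
    [PseudoMetricSpace Y] {f : ℝ → X} {φ : X → Y} {s : Set X} {K : NNReal} {a b : ℝ}
    (hφ : LipschitzOnWith K φ s) (hf : AbsolutelyContinuousOnInterval f a b)
    (hs : MapsTo f (uIcc a b) s) :
    AbsolutelyContinuousOnInterval (fun x => φ (f x)) a b := by
  rw [absolutelyContinuousOnInterval_iff] at hf ⊢
  intro ε hε
  obtain ⟨δ, hδ, H⟩ := hf (ε / (K + 1)) (by positivity)
  refine ⟨δ, hδ, fun E hE hlen => ?_⟩
  have h1 := H E hE hlen
  calc _ ≤ ∑ i ∈ Finset.range E.1, (K : ℝ) * dist (f (E.2 i).1) (f (E.2 i).2) :=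
        Finset.sum_le_sum fun i hi =>
          hφ.dist_le_mul _ (hs (hE.1 i hi).1) _ (hs (hE.1 i hi).2)
    _ = K * ∑ i ∈ Finset.range E.1, dist (f (E.2 i).1) (f (E.2 i).2) := by rw [Finset.mul_sum]
    _ ≤ K * (ε / (K + 1)) := by gcongr
    _ < (K + 1) * (ε / (K + 1)) := by gcongr; linarith
    _ = ε := by field

/-- Real and imaginary parts are treated separately and recombined through the isometric embedding
of the reals. -/
theorem absolutelyContinuousOnInterval_integral {f : ℝ → ℂ} {a b c : ℝ}
    (h : IntervalIntegrable f volume a b) (hc : c ∈ uIcc a b) :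
    AbsolutelyContinuousOnInterval (fun x => ∫ t in c..x, f t) a b := by
  have hre : IntervalIntegrable (fun x => (f x).re) volume a b :=
    ⟨h.1.re, h.2.re⟩
  have him : IntervalIntegrable (fun x => (f x).im) volume a b :=
    ⟨h.1.im, h.2.im⟩
  have h1 := hre.absolutelyContinuousOnInterval_intervalIntegral hc
  have h2 := him.absolutelyContinuousOnInterval_intervalIntegral hc
  have l1 : LipschitzOnWith 1 (fun x : ℝ => (x : ℂ)) univ :=
    (Complex.isometry_ofReal.lipschitz).lipschitzOnWith
  have h3 := lipschitzOnWith_comp_absolutelyContinuousOnInterval l1 h1 (mapsTo_univ _ _)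
  have h4 := (lipschitzOnWith_comp_absolutelyContinuousOnInterval l1 h2
    (mapsTo_univ _ _)).const_smul Complex.I
  refine absolutelyContinuousOnInterval_congr (h3.add h4) fun x hx => ?_
  have hfx : IntervalIntegrable f volume c x :=
    h.mono_set (uIcc_subset_uIcc hc hx)
  have e : (∫ t in c..x, f t) = (∫ t in c..x, (((f t).re : ℂ) + Complex.I * ((f t).im : ℂ))) := by
    congr 1; ext t; rw [mul_comm, Complex.re_add_im]
  rw [e, intervalIntegral.integral_add, intervalIntegral.integral_const_mul,
    intervalIntegral.integral_ofReal, intervalIntegral.integral_ofReal]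
  · simp
  · exact ⟨hfx.1.re.ofReal, hfx.2.re.ofReal⟩
  · exact IntervalIntegrable.const_mul ⟨hfx.1.im.ofReal, hfx.2.im.ofReal⟩ _

/-- Subtracting the primitive of `f` leaves an absolutely continuous function with almost everywhere
zero derivative, hence a constant. -/
theorem absolutelyContinuousOnInterval_sub_eq_integral {F : ℝ → ℂ} {f : ℝ → ℂ} {a b : ℝ}
    (hF : AbsolutelyContinuousOnInterval F a b) (hf : IntervalIntegrable f volume a b)
    (hd : ∀ᵐ x, x ∈ uIcc a b → HasDerivAt F (f x) x) :
    F b - F a = ∫ t in a..b, f t := by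
  have h1 := hF.sub (absolutelyContinuousOnInterval_integral hf (c := a) left_mem_uIcc)
  obtain ⟨C, hC⟩ := h1.const_of_ae_hasDerivAt_zero (by
    filter_upwards [hd, hf.ae_hasDerivAt_integral] with x hx hx' hxm
    simpa using (hx hxm).sub (hx' hxm a left_mem_uIcc))
  have ha := hC a left_mem_uIcc
  have hb := hC b right_mem_uIcc
  simp only [Pi.sub_apply, intervalIntegral.integral_same, sub_zero] at ha hb
  rw [ha, ← hb]; ring

/-- The half-line is exhausted by the countably many intervals `[1/(n+1), n+1]`. -/
theorem ae_restrict_Ioi_of_forall_Icc {p : ℝ → Prop}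
    (h : ∀ a b : ℝ, 0 < a → a ≤ b → ∀ᵐ x, x ∈ Icc a b → p x) :
    ∀ᵐ x ∂(volume.restrict (Ioi (0 : ℝ))), p x := by
  rw [ae_restrict_iff' measurableSet_Ioi]
  have h2 : ∀ᵐ x, ∀ n : ℕ, x ∈ Icc (1 / ((n : ℝ) + 1)) ((n : ℝ) + 1) → p x := by
    rw [ae_all_iff]
    intro n
    refine h _ _ (by positivity) ?_
    rw [div_le_iff₀ (by positivity)]
    nlinarith [(Nat.cast_nonneg n : (0 : ℝ) ≤ n)]
  filter_upwards [h2] with x hx hx0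
  have hx0 : 0 < x := hx0
  obtain ⟨n, hn⟩ := exists_nat_ge (max x (1 / x))
  refine hx n ⟨?_, ?_⟩
  · rw [div_le_iff₀ (by positivity)]
    have := (le_max_right _ _).trans hn
    rw [div_le_iff₀ hx0] at this
    nlinarith
  · linarith [(le_max_left _ _).trans hn]

theorem uIcc_subset_Ioi_zero {a b : ℝ} (ha : 0 < a) (hb : 0 < b) : uIcc a b ⊆ Ioi (0 : ℝ) :=
  fun _ hx => lt_of_lt_of_le (lt_min ha hb) hx.1

theorem IsAC.congr {f g : ℝ → ℂ} (hf : IsAC f) (h : EqOn f g (Ioi 0)) : IsAC g :=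
  fun a b ha hb => absolutelyContinuousOnInterval_congr (hf a b ha hb)
    (h.mono (uIcc_subset_Ioi_zero ha hb))

theorem IsAC.add {f g : ℝ → ℂ} (hf : IsAC f) (hg : IsAC g) : IsAC (fun x => f x + g x) :=
  fun a b ha hb => (hf a b ha hb).add (hg a b ha hb)

theorem IsAC.sub {f g : ℝ → ℂ} (hf : IsAC f) (hg : IsAC g) : IsAC (fun x => f x - g x) :=
  fun a b ha hb => (hf a b ha hb).sub (hg a b ha hb)

theorem IsAC.mul {f g : ℝ → ℂ} (hf : IsAC f) (hg : IsAC g) : IsAC (fun x => f x * g x) :=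
  fun a b ha hb => (hf a b ha hb).smul (hg a b ha hb)

theorem IsAC.const_mul {f : ℝ → ℂ} (hf : IsAC f) (c : ℂ) : IsAC (fun x => c * f x) :=
  fun a b ha hb => (hf a b ha hb).const_smul c

theorem IsAC.continuousOn {f : ℝ → ℂ} (hf : IsAC f) : ContinuousOn f (Ioi 0) := by
  intro x hx
  have hx : 0 < x := hx
  have h := (hf (x / 2) (x + 1) (by positivity) (by positivity)).continuousOn
  rw [uIcc_of_le (by linarith)] at h
  exact (h.continuousAt (Icc_mem_nhds (by linarith) (by linarith))).continuousWithinAt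

theorem IsAC.ae_differentiableAt {f : ℝ → ℂ} (hf : IsAC f) :
    ∀ᵐ x ∂(volume.restrict (Ioi (0 : ℝ))), DifferentiableAt ℝ f x := by
  refine ae_restrict_Ioi_of_forall_Icc fun a b ha hab => ?_
  have := (hf a b ha (ha.trans_le hab)).boundedVariationOn.ae_differentiableAt_of_mem_uIcc
  rwa [uIcc_of_le hab] at this

theorem IsAC.sub_eq_integral {F f : ℝ → ℂ} (hF : IsAC F)
    (hd : ∀ᵐ x ∂(volume.restrict (Ioi (0 : ℝ))), HasDerivAt F (f x) x) {a b : ℝ} (ha : 0 < a)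
    (hb : 0 < b) (hf : IntervalIntegrable f volume a b) :
    F b - F a = ∫ t in a..b, f t := by
  refine absolutelyContinuousOnInterval_sub_eq_integral (hF a b ha hb) hf ?_
  rw [ae_restrict_iff' measurableSet_Ioi] at hd
  filter_upwards [hd] with x hx hxm using hx (uIcc_subset_Ioi_zero ha hb hxm)

theorem isAC_of_hasDerivAt {f f' : ℝ → ℂ} (h : ∀ x, 0 < x → HasDerivAt f (f' x) x)
    (hf' : ContinuousOn f' (Ioi 0)) : IsAC f := by
  intro a b ha hb
  obtain ⟨C, hC⟩ := isCompact_uIcc.exists_bound_of_continuousOn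
    (hf'.mono (uIcc_subset_Ioi_zero ha hb))
  have : LipschitzOnWith (Real.toNNReal C) f (uIcc a b) := by
    refine (convex_uIcc a b).lipschitzOnWith_of_nnnorm_hasDerivWithin_le (f' := f')
      (fun x hx => (h x (uIcc_subset_Ioi_zero ha hb hx)).hasDerivWithinAt) fun x hx => ?_
    rw [← NNReal.coe_le_coe, coe_nnnorm]
    exact (hC x hx).trans (Real.le_coe_toNNReal C)
  exact this.absolutelyContinuousOnInterval

/-- An absolutely continuous function whose almost everywhere derivative is continuous is
continuously differentiable. -/
theorem IsAC.hasDerivAt_of_continuousOn {F f : ℝ → ℂ} (hF : IsAC F)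
    (hd : ∀ᵐ x ∂(volume.restrict (Ioi (0 : ℝ))), HasDerivAt F (f x) x)
    (hf : ContinuousOn f (Ioi 0)) {x : ℝ} (hx : 0 < x) : HasDerivAt F (f x) x := by
  have hint : ∀ b, 0 < b → IntervalIntegrable f volume x b := fun b hb =>
    (hf.mono (uIcc_subset_Ioi_zero hx hb)).intervalIntegrable
  have h1 : HasDerivAt (fun u => ∫ t in x..u, f t) (f x) x := by
    refine intervalIntegral.integral_hasDerivAt_right (hint x hx) ?_
      (hf.continuousAt (Ioi_mem_nhds hx))
    exact hf.stronglyMeasurableAtFilter isOpen_Ioi x hx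
  refine (h1.const_add (F x)).congr_of_eventuallyEq ?_
  filter_upwards [Ioi_mem_nhds hx] with b hb
  rw [← hF.sub_eq_integral hd hx hb (hint b hb)]; ring

/-- With `R x = ∫₀ˣ ρ`, the exponential weight `exp (2 R)` satisfies
`∫₀ˣ ρ exp (2 R) ≤ exp (2 R x) / 2`. -/
theorem integral_mul_exp_primitive_le {ρ : ℝ → ℝ} {a x : ℝ} (hρ : IntegrableOn ρ (Ioo 0 a))
    (h0 : ∀ y, 0 ≤ ρ y) (hx : x ∈ Ioo 0 a) :
    IntegrableOn (fun y => ρ y * Real.exp (2 * ∫ t in (0 : ℝ)..y, ρ t)) (Ioc 0 x) ∧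
    ∫ y in Ioc 0 x, ρ y * Real.exp (2 * ∫ t in (0 : ℝ)..y, ρ t) ≤
      Real.exp (2 * ∫ t in (0 : ℝ)..x, ρ t) / 2 := by
  have hi : IntervalIntegrable ρ volume 0 x := by
    rw [intervalIntegrable_iff_integrableOn_Ioc_of_le hx.1.le]
    exact hρ.mono_set fun y hy => ⟨hy.1, hy.2.trans_lt hx.2⟩
  have hAC := hi.absolutelyContinuousOnInterval_intervalIntegral (c := 0) left_mem_uIcc
  have hcont := hAC.continuousOn
  -- The primitive of `ρ` is only absolutely continuous. Since it takes values in a compact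
  -- interval, where the exponential is Lipschitz, `exp (2 R)` is absolutely continuous as well and
  -- the fundamental theorem of calculus applies: the integral is `(exp (2 R x) - 1) / 2`.
  obtain ⟨K, hK⟩ : ∃ K, LipschitzOnWith K (fun r : ℝ => Real.exp (2 * r))
      (Icc 0 (∫ t in (0 : ℝ)..x, ρ t)) := by
    have : ContDiffOn ℝ 1 (fun r : ℝ => Real.exp (2 * r)) (Icc 0 (∫ t in (0 : ℝ)..x, ρ t)) := by
      fun_prop
    exact this.exists_lipschitzOnWith (by decide) (convex_Icc _ _) isCompact_Icc
  have hmaps : MapsTo (fun y => ∫ t in (0 : ℝ)..y, ρ t) (uIcc 0 x)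
      (Icc 0 (∫ t in (0 : ℝ)..x, ρ t)) := by
    intro y hy
    rw [uIcc_of_le hx.1.le] at hy
    refine ⟨intervalIntegral.integral_nonneg hy.1 fun t _ => h0 t, ?_⟩
    exact intervalIntegral.integral_mono_interval le_rfl hy.1 hy.2
      (Eventually.of_forall h0) hi
  have hE := lipschitzOnWith_comp_absolutelyContinuousOnInterval hK hAC hmaps
  have hder := hE.integral_deriv_eq_sub
  have hii : IntervalIntegrable (fun y => ρ y * Real.exp (2 * ∫ t in (0 : ℝ)..y, ρ t)) volume 0 x :=
    hi.mul_continuousOn (Real.continuous_exp.comp_continuousOn (hcont.const_smul (2 : ℝ)))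
  have heq : ∫ y in (0 : ℝ)..x, deriv (fun y => Real.exp (2 * ∫ t in (0 : ℝ)..y, ρ t)) y =
      ∫ y in (0 : ℝ)..x, 2 * (ρ y * Real.exp (2 * ∫ t in (0 : ℝ)..y, ρ t)) := by
    refine intervalIntegral.integral_congr_ae ?_
    filter_upwards [hi.ae_hasDerivAt_integral] with y hy hym
    have := ((hy (uIoc_subset_uIcc hym) 0 left_mem_uIcc).const_mul 2).exp
    rw [this.deriv]; ring
  rw [heq, intervalIntegral.integral_const_mul] at hder
  refine ⟨(intervalIntegrable_iff_integrableOn_Ioc_of_le hx.1.le).1 hii, ?_⟩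
  rw [← intervalIntegral.integral_of_le hx.1.le]
  simp only [intervalIntegral.integral_same, mul_zero, Real.exp_zero] at hder
  linarith

/-! ### Volterra operators and their Neumann series -/

/-- The integral operator on `]0,∞[` with kernel `K`. -/
noncomputable def kernelOp (K : ℝ → ℝ → ℂ) (u : ℝ → ℂ) (x : ℝ) : ℂ :=
  ∫ y in Ioi (0 : ℝ), K x y * u y

/-- The kernel `K` leaves the functions on `E` invariant and has norm at most `1/2` in the sup norm
with weight `Ψ`. -/
structure VolterraWeight (K : ℝ → ℝ → ℂ) (E : Set ℝ) (Ψ : ℝ → ℝ) : Prop where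
  measurableSet : MeasurableSet E
  subset : E ⊆ Ioi 0
  pos : ∀ x ∈ E, 0 < Ψ x
  support : ∀ x ∈ E, ∀ y ∈ Ioi (0 : ℝ), y ∉ E → K x y = 0
  kernel_measurable : ∀ x ∈ E, AEStronglyMeasurable (K x) (volume.restrict E)
  integrable : ∀ x ∈ E, IntegrableOn (fun y => ‖K x y‖ * Ψ y) E
  contraction : ∀ x ∈ E, ∫ y in E, ‖K x y‖ * Ψ y ≤ Ψ x / 2
  op_measurable : ∀ u : ℝ → ℂ, AEStronglyMeasurable u (volume.restrict E) →
    (∃ M, ∀ᵐ y ∂(volume.restrict E), ‖u y‖ ≤ M * Ψ y) →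
    AEStronglyMeasurable (kernelOp K u) (volume.restrict E)

/-- The terms of the Neumann series of `(1 + K)⁻¹ f`. -/
noncomputable def neumannTerm (K : ℝ → ℝ → ℂ) (f : ℝ → ℂ) : ℕ → ℝ → ℂ
  | 0 => f
  | n + 1 => fun x => -kernelOp K (neumannTerm K f n) x

/-- The Neumann series of `(1 + K)⁻¹ f`. -/
noncomputable def neumannSum (K : ℝ → ℝ → ℂ) (f : ℝ → ℂ) (x : ℝ) : ℂ :=
  ∑' n, neumannTerm K f n x

namespace VolterraWeight

variable {K : ℝ → ℝ → ℂ} {E : Set ℝ} {Ψ : ℝ → ℝ}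

theorem kernelOp_eq (V : VolterraWeight K E Ψ) (u : ℝ → ℂ) {x : ℝ} (hx : x ∈ E) :
    kernelOp K u x = ∫ y in E, K x y * u y := by
  refine setIntegral_eq_of_subset_of_forall_sdiff_eq_zero measurableSet_Ioi V.subset ?_
  intro y hy
  rw [V.support x hx y hy.1 hy.2, zero_mul]

theorem integrableOn_mul (V : VolterraWeight K E Ψ) {u : ℝ → ℂ} {M : ℝ}
    (hu : AEStronglyMeasurable u (volume.restrict E))
    (hM : ∀ᵐ y ∂(volume.restrict E), ‖u y‖ ≤ M * Ψ y) {x : ℝ} (hx : x ∈ E) :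
    IntegrableOn (fun y => K x y * u y) E := by
  refine ((V.integrable x hx).const_mul M).mono' ((V.kernel_measurable x hx).mul hu) ?_
  filter_upwards [hM] with y hy
  rw [norm_mul]
  calc ‖K x y‖ * ‖u y‖ ≤ ‖K x y‖ * (M * Ψ y) := by gcongr
    _ = M * (‖K x y‖ * Ψ y) := by ring

theorem integrableOn_Ioi (V : VolterraWeight K E Ψ) {u : ℝ → ℂ} {M : ℝ}
    (hu : AEStronglyMeasurable u (volume.restrict E))
    (hM : ∀ᵐ y ∂(volume.restrict E), ‖u y‖ ≤ M * Ψ y) {x : ℝ} (hx : x ∈ E) :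
    IntegrableOn (fun y => K x y * u y) (Ioi 0) := by
  refine (V.integrableOn_mul hu hM hx).of_forall_sdiff_eq_zero measurableSet_Ioi ?_
  intro y hy
  rw [V.support x hx y hy.1 hy.2, zero_mul]

theorem norm_kernelOp_le (V : VolterraWeight K E Ψ) {u : ℝ → ℂ} {M : ℝ} (hM0 : 0 ≤ M)
    (hM : ∀ᵐ y ∂(volume.restrict E), ‖u y‖ ≤ M * Ψ y) {x : ℝ} (hx : x ∈ E) :
    ‖kernelOp K u x‖ ≤ M / 2 * Ψ x := by
  rw [V.kernelOp_eq u hx]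
  calc _ ≤ ∫ y in E, M * (‖K x y‖ * Ψ y) := by
        refine norm_integral_le_of_norm_le ((V.integrable x hx).const_mul M) ?_
        filter_upwards [hM] with y hy
        rw [norm_mul]
        calc ‖K x y‖ * ‖u y‖ ≤ ‖K x y‖ * (M * Ψ y) := by gcongr
          _ = M * (‖K x y‖ * Ψ y) := by ring
    _ = M * ∫ y in E, ‖K x y‖ * Ψ y := integral_const_mul _ _
    _ ≤ M * (Ψ x / 2) := by gcongr; exact V.contraction x hx
    _ = _ := by ring

/-- Each application of the operator halves the constant. The bound is pointwise on `E`, so the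
series later converges at every point rather than almost everywhere. -/
theorem neumannTerm_bound (V : VolterraWeight K E Ψ) {f : ℝ → ℂ} {M : ℝ} (hM0 : 0 ≤ M)
    (hf : AEStronglyMeasurable f (volume.restrict E)) (hM : ∀ x ∈ E, ‖f x‖ ≤ M * Ψ x) (n : ℕ) :
    AEStronglyMeasurable (neumannTerm K f n) (volume.restrict E) ∧
    ∀ x ∈ E, ‖neumannTerm K f n x‖ ≤ M * (1 / 2) ^ n * Ψ x := by
  induction n with
  | zero => exact ⟨hf, by simpa [neumannTerm] using hM⟩
  | succ n ih =>
    have hae : ∀ᵐ y ∂(volume.restrict E), ‖neumannTerm K f n y‖ ≤ M * (1 / 2) ^ n * Ψ y :=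
      (ae_restrict_iff' V.measurableSet).2 (Eventually.of_forall ih.2)
    refine ⟨(V.op_measurable _ ih.1 ⟨_, hae⟩).neg, fun x hx => ?_⟩
    have := V.norm_kernelOp_le (by positivity) hae hx
    simp only [neumannTerm, norm_neg]
    refine this.trans (le_of_eq ?_)
    ring

theorem summable_neumannTerm (V : VolterraWeight K E Ψ) {f : ℝ → ℂ} {M : ℝ} (hM0 : 0 ≤ M)
    (hf : AEStronglyMeasurable f (volume.restrict E)) (hM : ∀ x ∈ E, ‖f x‖ ≤ M * Ψ x)
    {x : ℝ} (hx : x ∈ E) :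
    HasSum (fun n => neumannTerm K f n x) (neumannSum K f x) ∧
      ‖neumannSum K f x‖ ≤ 2 * M * Ψ x := by
  have hs : HasSum (fun n : ℕ => M * (1 / 2) ^ n * Ψ x) (2 * M * Ψ x) := by
    convert! (hasSum_geometric_two.mul_left M).mul_right (Ψ x) using 1
    ring
  have hb := fun n => (V.neumannTerm_bound hM0 hf hM n).2 x hx
  have hsum : Summable (fun n => neumannTerm K f n x) :=
    Summable.of_norm_bounded hs.summable hb
  exact ⟨hsum.hasSum, tsum_of_norm_bounded hs hb⟩

theorem aestronglyMeasurable_neumannSum (V : VolterraWeight K E Ψ) {f : ℝ → ℂ} {M : ℝ}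
    (hM0 : 0 ≤ M) (hf : AEStronglyMeasurable f (volume.restrict E))
    (hM : ∀ x ∈ E, ‖f x‖ ≤ M * Ψ x) :
    AEStronglyMeasurable (neumannSum K f) (volume.restrict E) := by
  refine aestronglyMeasurable_of_tendsto_ae atTop
    (f := fun n x => ∑ i ∈ Finset.range n, neumannTerm K f i x) (fun n => ?_) ?_
  · exact Finset.aestronglyMeasurable_fun_sum _ fun i _ => (V.neumannTerm_bound hM0 hf hM i).1
  · exact (ae_restrict_iff' V.measurableSet).2 (Eventually.of_forall fun x hx =>
      (V.summable_neumannTerm hM0 hf hM hx).1.tendsto_sum_nat)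

/-- The geometric majorant permits integration term by term; applying `-K` to the series shifts it
by one, so only the zeroth term `f` survives. -/
theorem neumannSum_add_kernelOp (V : VolterraWeight K E Ψ) {f : ℝ → ℂ} {M : ℝ} (hM0 : 0 ≤ M)
    (hf : AEStronglyMeasurable f (volume.restrict E)) (hM : ∀ x ∈ E, ‖f x‖ ≤ M * Ψ x)
    {x : ℝ} (hx : x ∈ E) : neumannSum K f x + kernelOp K (neumannSum K f) x = f x := by
  have h1 : HasSum (fun n => ∫ y in E, K x y * neumannTerm K f n y)
      (∫ y in E, K x y * neumannSum K f y) := by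
    have hs : ∀ y, HasSum (fun n : ℕ => M * (1 / 2) ^ n * (‖K x y‖ * Ψ y))
        (2 * M * (‖K x y‖ * Ψ y)) := by
      intro y
      convert! (hasSum_geometric_two.mul_left M).mul_right (‖K x y‖ * Ψ y) using 1
      ring
    refine hasSum_integral_of_dominated_convergence
      (fun n y => M * (1 / 2) ^ n * (‖K x y‖ * Ψ y)) (fun n => ?_) (fun n => ?_) ?_ ?_ ?_
    · exact (V.kernel_measurable x hx).mul (V.neumannTerm_bound hM0 hf hM n).1
    · refine (ae_restrict_iff' V.measurableSet).2 (Eventually.of_forall fun y hy => ?_)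
      rw [norm_mul]
      calc _ ≤ ‖K x y‖ * (M * (1 / 2) ^ n * Ψ y) := by
            gcongr; exact (V.neumannTerm_bound hM0 hf hM n).2 y hy
        _ = _ := by ring
    · exact Eventually.of_forall fun y => (hs y).summable
    · simp_rw [fun y => (hs y).tsum_eq]
      exact (V.integrable x hx).const_mul _
    · refine (ae_restrict_iff' V.measurableSet).2 (Eventually.of_forall fun y hy => ?_)
      exact (V.summable_neumannTerm hM0 hf hM hy).1.mul_left _
  have h2 : HasSum (fun n => neumannTerm K f (n + 1) x) (-kernelOp K (neumannSum K f) x) := by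
    rw [V.kernelOp_eq _ hx]
    convert! h1.neg using 2 with n
    simp only [neumannTerm]
    rw [V.kernelOp_eq _ hx]
  have h3 := (hasSum_nat_add_iff' 1).2 (V.summable_neumannTerm hM0 hf hM hx).1
  have h4 := h2.unique h3
  simp only [Finset.range_one, Finset.sum_singleton, neumannTerm] at h4
  linear_combination -h4

/-- A function bounded by a multiple of the weight is controlled by its image under `1 + K`. -/
theorem ae_bound_of_add_kernelOp (V : VolterraWeight K E Ψ) {h : ℝ → ℂ} {A B : ℝ} (hA : 0 ≤ A)
    (hB : 0 ≤ B) (hhA : ∀ᵐ y ∂(volume.restrict E), ‖h y‖ ≤ A * Ψ y)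
    (hhB : ∀ᵐ y ∂(volume.restrict E), ‖h y + kernelOp K h y‖ ≤ B * Ψ y) :
    ∀ᵐ y ∂(volume.restrict E), ‖h y‖ ≤ 2 * B * Ψ y := by
  -- A bound with constant `c` improves to one with constant `B + c / 2`. The fixed point of this
  -- map is `2 * B`, and the excess over it halves at each step.
  have key : ∀ n : ℕ, ∀ᵐ y ∂(volume.restrict E), ‖h y‖ ≤ (2 * B + A * (1 / 2) ^ n) * Ψ y := by
    intro n
    induction n with
    | zero =>
      filter_upwards [hhA, ae_restrict_mem V.measurableSet] with y hy hyE
      refine hy.trans ?_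
      have := (V.pos y hyE).le
      gcongr
      simpa using hB
    | succ n ih =>
      filter_upwards [hhB, ae_restrict_mem V.measurableSet] with y hy hyE
      have h1 := V.norm_kernelOp_le (by positivity) ih hyE
      have h2 : ‖h y‖ ≤ ‖h y + kernelOp K h y‖ + ‖kernelOp K h y‖ := by
        simpa using norm_sub_le (h y + kernelOp K h y) (kernelOp K h y)
      calc _ ≤ _ := h2
        _ ≤ B * Ψ y + (2 * B + A * (1 / 2) ^ n) / 2 * Ψ y := add_le_add hy h1
        _ = _ := by rw [pow_succ]; ring
  filter_upwards [ae_all_iff.2 key] with y hy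
  have hlim : Tendsto (fun n : ℕ => (2 * B + A * (1 / 2 : ℝ) ^ n) * Ψ y) atTop
      (𝓝 ((2 * B + A * 0) * Ψ y)) :=
    ((tendsto_pow_atTop_nhds_zero_of_lt_one (by norm_num) (by norm_num)).const_mul A
      |>.const_add _).mul_const _
  simpa using ge_of_tendsto' hlim hy

end VolterraWeight

/-! ### Second order linear equations `f'' = v f` on the half-line -/

/-- `f ∈ AC¹]0,∞[` and `f'' = v f` almost everywhere. -/
structure SolvesODE (v : ℝ → ℂ) (f : ℝ → ℂ) : Prop where
  differentiableAt : ∀ x, 0 < x → DifferentiableAt ℝ f x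
  isAC_deriv : IsAC (deriv f)
  eq : ∀ᵐ x ∂(volume.restrict (Ioi (0 : ℝ))), HasDerivAt (deriv f) (v x * f x) x

/-- The function `v` for which `L_{m²} f = -k² f` reads `f'' = v f`. -/
noncomputable def besselPotential (m k : ℂ) (Q : ℝ → ℂ) (x : ℝ) : ℂ :=
  (m ^ 2 - 1 / 4) * (1 / (x : ℂ) ^ 2) + k ^ 2 + Q x

theorem isSolution_iff_solvesODE {m k : ℂ} {Q f : ℝ → ℂ} :
    IsSolution m k Q f ↔ SolvesODE (besselPotential m k Q) f := by
  constructor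
  · rintro ⟨⟨h1, h2⟩, h3⟩
    refine ⟨h1, h2, ?_⟩
    filter_upwards [h3, h2.ae_differentiableAt] with x hx hd
    convert! hd.hasDerivAt using 1
    rw [besselExpr] at hx
    rw [besselPotential]
    linear_combination hx
  · rintro ⟨h1, h2, h3⟩
    refine ⟨⟨h1, h2⟩, ?_⟩
    filter_upwards [h3] with x hx
    rw [besselExpr, hx.deriv, besselPotential]
    ring

theorem solvesODE_of_hasDerivAt {v f f' : ℝ → ℂ} (h : ∀ x, 0 < x → HasDerivAt f (f' x) x)
    (hf' : IsAC f') (he : ∀ᵐ x ∂(volume.restrict (Ioi (0 : ℝ))), HasDerivAt f' (v x * f x) x) :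
    SolvesODE v f := by
  have hd : EqOn f' (deriv f) (Ioi 0) := fun x hx => (h x hx).deriv.symm
  refine ⟨fun x hx => (h x hx).differentiableAt, hf'.congr hd, ?_⟩
  filter_upwards [he, ae_restrict_mem measurableSet_Ioi] with x hx hx0
  exact hx.congr_of_eventuallyEq (hd.symm.eventuallyEq_of_mem (Ioi_mem_nhds hx0))

namespace SolvesODE

variable {v v₁ v₂ f g : ℝ → ℂ}

theorem hasDerivAt (hf : SolvesODE v f) {x : ℝ} (hx : 0 < x) : HasDerivAt f (deriv f x) x :=
  (hf.differentiableAt x hx).hasDerivAt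

theorem isAC (hf : SolvesODE v f) : IsAC f :=
  isAC_of_hasDerivAt (fun _ hx => hf.hasDerivAt hx) hf.isAC_deriv.continuousOn

theorem continuousOn (hf : SolvesODE v f) : ContinuousOn f (Ioi 0) := hf.isAC.continuousOn

theorem linear_combination (hf : SolvesODE v f) (hg : SolvesODE v g) (a b : ℂ) :
    SolvesODE v (fun x => a * f x + b * g x) := by
  refine solvesODE_of_hasDerivAt (f' := fun x => a * deriv f x + b * deriv g x)
    (fun x hx => ((hf.hasDerivAt hx).const_mul a).add ((hg.hasDerivAt hx).const_mul b))
    ((hf.isAC_deriv.const_mul a).add (hg.isAC_deriv.const_mul b)) ?_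
  filter_upwards [hf.eq, hg.eq] with x h1 h2
  convert! (h1.const_mul a).add (h2.const_mul b) using 1
  ring

theorem sub (hf : SolvesODE v f) (hg : SolvesODE v g) : SolvesODE v (fun x => f x - g x) := by
  simpa [sub_eq_add_neg] using hf.linear_combination hg 1 (-1)

theorem isAC_wronskian (hf : SolvesODE v₁ f) (hg : SolvesODE v₂ g) : IsAC (wronskian f g) :=
  (hf.isAC.mul hg.isAC_deriv).sub (hf.isAC_deriv.mul hg.isAC)

/-- The products of first derivatives cancel, so the derivative sees only the difference of the
potentials. This gives constancy of the Wronskian for equal potentials and, for different ones, the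
integral formulas behind the Gronwall estimate and uniqueness. -/
theorem hasDerivAt_wronskian (hf : SolvesODE v₁ f) (hg : SolvesODE v₂ g) :
    ∀ᵐ x ∂(volume.restrict (Ioi (0 : ℝ))),
      HasDerivAt (wronskian f g) ((v₂ x - v₁ x) * (f x * g x)) x := by
  filter_upwards [hf.eq, hg.eq, ae_restrict_mem measurableSet_Ioi] with x h1 h2 hx
  have := ((hf.hasDerivAt hx).mul h2).sub (h1.mul (hg.hasDerivAt hx))
  convert! this using 1
  ring

theorem wronskian_sub_eq_integral (hf : SolvesODE v₁ f) (hg : SolvesODE v₂ g) {a b : ℝ}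
    (ha : 0 < a) (hb : 0 < b)
    (hi : IntervalIntegrable (fun x => (v₂ x - v₁ x) * (f x * g x)) volume a b) :
    wronskian f g b - wronskian f g a = ∫ x in a..b, (v₂ x - v₁ x) * (f x * g x) :=
  (hf.isAC_wronskian hg).sub_eq_integral (hf.hasDerivAt_wronskian hg) ha hb hi

theorem wronskian_eq (hf : SolvesODE v f) (hg : SolvesODE v g) {a b : ℝ} (ha : 0 < a)
    (hb : 0 < b) : wronskian f g b = wronskian f g a := by
  have := hf.wronskian_sub_eq_integral hg ha hb (by simp)
  simpa [sub_eq_zero] using this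

end SolvesODE

/-! ### Variation of constants -/

section VariationOfConstants

variable {v q h₁ h₂ : ℝ → ℂ}

/-- The particular solution `x ↦ ∫₀ˣ G(x,y) q(y) dy` of `f'' = v f - q`. -/
noncomputable def particular (h₁ h₂ q : ℝ → ℂ) (x : ℝ) : ℂ :=
  (h₁ x * (∫ y in (0 : ℝ)..x, h₂ y * q y) - h₂ x * (∫ y in (0 : ℝ)..x, h₁ y * q y))
    / wronskian h₁ h₂ 1

/-- The derivative of `particular`. -/
noncomputable def particularDeriv (h₁ h₂ q : ℝ → ℂ) (x : ℝ) : ℂ :=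
  (deriv h₁ x * (∫ y in (0 : ℝ)..x, h₂ y * q y) - deriv h₂ x * (∫ y in (0 : ℝ)..x, h₁ y * q y))
    / wronskian h₁ h₂ 1

theorem intervalIntegrable_zero_of_forall {u : ℝ → ℂ}
    (hu : ∀ a : ℝ, 0 < a → IntegrableOn u (Ioo 0 a)) {b : ℝ} (hb : 0 < b) :
    IntervalIntegrable u volume 0 b := by
  rw [intervalIntegrable_iff_integrableOn_Ioc_of_le hb.le]
  exact (hu (b + 1) (by positivity)).mono_set fun y hy => ⟨hy.1, by linarith [hy.2]⟩

theorem isAC_integral_zero {u : ℝ → ℂ} (hu : ∀ a : ℝ, 0 < a → IntegrableOn u (Ioo 0 a)) :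
    IsAC (fun x => ∫ y in (0 : ℝ)..x, u y) := by
  intro a b ha hb
  have h1 : 0 < max a b := lt_max_of_lt_left ha
  refine (absolutelyContinuousOnInterval_integral (intervalIntegrable_zero_of_forall hu h1)
    left_mem_uIcc).mono ?_
  rw [uIcc_of_le h1.le]
  exact fun x hx => ⟨(lt_min ha hb).le.trans hx.1, hx.2⟩

theorem ae_hasDerivAt_integral_zero {u : ℝ → ℂ}
    (hu : ∀ a : ℝ, 0 < a → IntegrableOn u (Ioo 0 a)) :
    ∀ᵐ x ∂(volume.restrict (Ioi (0 : ℝ))), HasDerivAt (fun x => ∫ y in (0 : ℝ)..x, u y) (u x) x := by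
  refine ae_restrict_Ioi_of_forall_Icc fun a b ha hab => ?_
  have hb := ha.trans_le hab
  filter_upwards [(intervalIntegrable_zero_of_forall hu hb).ae_hasDerivAt_integral] with x hx hxm
  refine hx ?_ 0 left_mem_uIcc
  rw [uIcc_of_le hb.le]
  exact ⟨ha.le.trans hxm.1, hxm.2⟩

theorem isAC_particularDeriv
    (s₁ : SolvesODE v h₁) (s₂ : SolvesODE v h₂)
    (i₁ : ∀ a : ℝ, 0 < a → IntegrableOn (fun y => h₁ y * q y) (Ioo 0 a))
    (i₂ : ∀ a : ℝ, 0 < a → IntegrableOn (fun y => h₂ y * q y) (Ioo 0 a)) : IsAC (particularDeriv h₁ h₂ q) := by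
  have := ((s₁.isAC_deriv.mul (isAC_integral_zero i₂)).sub
    (s₂.isAC_deriv.mul (isAC_integral_zero i₁))).const_mul (wronskian h₁ h₂ 1)⁻¹
  refine this.congr fun x _ => ?_
  simp only [particularDeriv]
  rw [div_eq_inv_mul]

theorem hasDerivAt_particular
    (s₁ : SolvesODE v h₁) (s₂ : SolvesODE v h₂)
    (i₁ : ∀ a : ℝ, 0 < a → IntegrableOn (fun y => h₁ y * q y) (Ioo 0 a))
    (i₂ : ∀ a : ℝ, 0 < a → IntegrableOn (fun y => h₂ y * q y) (Ioo 0 a))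
    {x : ℝ} (hx : 0 < x) :
    HasDerivAt (particular h₁ h₂ q) (particularDeriv h₁ h₂ q x) x := by
  have hac : IsAC (particular h₁ h₂ q) := by
    have := ((s₁.isAC.mul (isAC_integral_zero i₂)).sub
      (s₂.isAC.mul (isAC_integral_zero i₁))).const_mul (wronskian h₁ h₂ 1)⁻¹
    refine this.congr fun x _ => ?_
    simp only [particular]
    rw [div_eq_inv_mul]
  -- Almost everywhere the product rule holds and the contributions `h₁ h₂ q` from differentiating
  -- the two integrals cancel. What remains is continuous, so the derivative exists at every point.
  refine hac.hasDerivAt_of_continuousOn ?_ (isAC_particularDeriv s₁ s₂ i₁ i₂).continuousOn hx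
  filter_upwards [ae_hasDerivAt_integral_zero i₁, ae_hasDerivAt_integral_zero i₂,
    ae_restrict_mem measurableSet_Ioi] with x e1 e2 hx
  have := (((s₁.hasDerivAt hx).mul e2).sub ((s₂.hasDerivAt hx).mul e1)).div_const
    (wronskian h₁ h₂ 1)
  convert! this using 1
  rw [particularDeriv]; ring

theorem hasDerivAt_particularDeriv
    (s₁ : SolvesODE v h₁) (s₂ : SolvesODE v h₂)
    (i₁ : ∀ a : ℝ, 0 < a → IntegrableOn (fun y => h₁ y * q y) (Ioo 0 a))
    (i₂ : ∀ a : ℝ, 0 < a → IntegrableOn (fun y => h₂ y * q y) (Ioo 0 a))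
    (hw : wronskian h₁ h₂ 1 ≠ 0) :
    ∀ᵐ x ∂(volume.restrict (Ioi (0 : ℝ))),
      HasDerivAt (particularDeriv h₁ h₂ q) (v x * particular h₁ h₂ q x - q x) x := by
  filter_upwards [ae_hasDerivAt_integral_zero i₁, ae_hasDerivAt_integral_zero i₂,
    ae_restrict_mem measurableSet_Ioi, s₁.eq, s₂.eq] with x e1 e2 hx d1 d2
  have := ((d1.mul e2).sub (d2.mul e1)).div_const (wronskian h₁ h₂ 1)
  convert! this using 1
  -- Here the terms containing `q` do not cancel; they add up to `-q` times the Wronskian at `x`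
  -- divided by the Wronskian at `1`, and this quotient is `1`.
  have hc := s₁.wronskian_eq s₂ one_pos hx
  rw [wronskian] at hc
  rw [particular]
  field_simp
  linear_combination (q x) * hc

end VariationOfConstants

/-! ### Existence of solutions for continuous coefficients -/

/-- The kernel of `u ↦ -∫₁ˣ (x - y) v(y) u(y) dy`. -/
noncomputable def picardKernel (v : ℝ → ℂ) (x y : ℝ) : ℂ :=
  (Ioc x 1).indicator (fun y : ℝ => (x - y : ℂ) * v y) y
    - (Ioc 1 x).indicator (fun y : ℝ => (x - y : ℂ) * v y) y

theorem picardKernel_of_one_le (v : ℝ → ℂ) {x : ℝ} (hx : 1 ≤ x) (y : ℝ) :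
    picardKernel v x y = (Ioc 1 x).indicator (fun y : ℝ => -((x - y : ℂ) * v y)) y := by
  rw [picardKernel, Ioc_eq_empty_of_le hx, indicator_empty, zero_sub, indicator_neg]

theorem picardKernel_of_le_one (v : ℝ → ℂ) {x : ℝ} (hx : x ≤ 1) (y : ℝ) :
    picardKernel v x y = (Ioc x 1).indicator (fun y : ℝ => (x - y : ℂ) * v y) y := by
  rw [picardKernel, Ioc_eq_empty_of_le hx, indicator_empty, sub_zero]

theorem setIntegral_Ioi_indicator_mul {s : Set ℝ} (hs : MeasurableSet s) (hs0 : s ⊆ Ioi 0)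
    (F u : ℝ → ℂ) : ∫ y in Ioi (0 : ℝ), s.indicator F y * u y = ∫ y in s, F y * u y := by
  have : ∀ y, s.indicator F y * u y = s.indicator (fun y => F y * u y) y := fun y => by
    by_cases hy : y ∈ s <;> simp [hy]
  simp_rw [this]
  rw [setIntegral_indicator hs, inter_eq_right.2 hs0]

theorem kernelOp_picardKernel (v u : ℝ → ℂ) {x : ℝ} (hx : 0 < x) :
    kernelOp (picardKernel v) u x = -∫ y in (1 : ℝ)..x, (x - y : ℂ) * (v y * u y) := by
  rw [kernelOp]
  rcases le_total 1 x with h | h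
  · simp_rw [picardKernel_of_one_le v h]
    rw [intervalIntegral.integral_of_le h, ← integral_neg,
      setIntegral_Ioi_indicator_mul measurableSet_Ioc fun y hy => zero_lt_one.trans hy.1]
    congr 1; ext y; ring
  · simp_rw [picardKernel_of_le_one v h]
    rw [intervalIntegral.integral_of_ge h, neg_neg,
      setIntegral_Ioi_indicator_mul measurableSet_Ioc fun y hy => hx.trans hy.1]
    congr 1; ext y; ring

/-- This separates the variable `x` from the integrand, so that continuity and differentiability in
`x` reduce to those of primitives. -/
theorem integral_sub_mul {w : ℝ → ℂ} {x : ℝ} (hw : IntervalIntegrable w volume 1 x) :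
    ∫ y in (1 : ℝ)..x, (x - y : ℂ) * w y =
      x * (∫ y in (1 : ℝ)..x, w y) - ∫ y in (1 : ℝ)..x, (y : ℂ) * w y := by
  have h2 : IntervalIntegrable (fun y : ℝ => (y : ℂ) * w y) volume 1 x :=
    hw.continuousOn_mul (by fun_prop)
  rw [← intervalIntegral.integral_const_mul, ← intervalIntegral.integral_sub (hw.const_mul _) h2]
  congr 1; ext y; ring

theorem integral_uIoc_exp_le {l x : ℝ} (hl : 0 < l) :
    ∫ y in uIoc 1 x, Real.exp (l * |y - 1|) ≤ Real.exp (l * |x - 1|) / l := by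
  rcases le_total 1 x with h | h
  · rw [uIoc_of_le h, ← intervalIntegral.integral_of_le h]
    have e : ∫ y in (1 : ℝ)..x, Real.exp (l * |y - 1|) = ∫ y in (1 : ℝ)..x, Real.exp (l * (y - 1)) := by
      refine intervalIntegral.integral_congr fun y hy => ?_
      rw [uIcc_of_le h] at hy
      simp only [abs_of_nonneg (sub_nonneg.2 hy.1)]
    rw [e, intervalIntegral.integral_eq_sub_of_hasDerivAt
      (f := fun y => Real.exp (l * (y - 1)) / l) (fun y _ => ?_) (by
        apply Continuous.intervalIntegrable; fun_prop), abs_of_nonneg (sub_nonneg.2 h)]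
    · have : 0 < Real.exp (l * (1 - 1)) / l := by positivity
      linarith
    · have := ((((hasDerivAt_id y).sub_const 1).const_mul l).exp).div_const l
      convert! this using 1
      simp; field_simp
  · rw [uIoc_of_ge h, ← intervalIntegral.integral_of_le h]
    have e : ∫ y in x..1, Real.exp (l * |y - 1|) = ∫ y in x..1, Real.exp (l * (1 - y)) := by
      refine intervalIntegral.integral_congr fun y hy => ?_
      rw [uIcc_of_le h] at hy
      simp only [abs_of_nonpos (sub_nonpos.2 hy.2), neg_sub]
    rw [e, intervalIntegral.integral_eq_sub_of_hasDerivAt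
      (f := fun y => -(Real.exp (l * (1 - y)) / l)) (fun y _ => ?_) (by
        apply Continuous.intervalIntegrable; fun_prop), abs_of_nonpos (sub_nonpos.2 h)]
    · have : 0 < Real.exp (l * (1 - 1)) / l := by positivity
      rw [neg_sub]
      linarith
    · have := (((((hasDerivAt_id y).const_sub 1).const_mul l).exp).div_const l).neg
      convert! this using 1
      simp; field_simp

theorem intervalIntegrable_Ioo_of_ae_bound {v u : ℝ → ℂ} (hv : ContinuousOn v (Ioi 0)) {a b M : ℝ}
    (ha : 0 < a) (hab : a ≤ b) (hu : AEStronglyMeasurable u (volume.restrict (Ioo a b)))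
    (hM : ∀ᵐ y ∂(volume.restrict (Ioo a b)), ‖u y‖ ≤ M) :
    IntervalIntegrable (fun y => v y * u y) volume a b := by
  have h1 : IntegrableOn u (Ioo a b) :=
    ⟨hu, HasFiniteIntegral.of_bounded hM⟩
  have h2 : IntervalIntegrable u volume a b := by
    rw [intervalIntegrable_iff_integrableOn_Ioo_of_le hab]
    exact h1
  exact h2.continuousOn_mul (hv.mono (uIcc_subset_Ioi_zero ha (ha.trans_le hab)))

/-- On `]1/n, n[` the kernel is bounded by a constant and supported between `1` and `x`. A weight
growing exponentially away from the base point `1`, with a large rate, therefore makes the operator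
a contraction. -/
theorem volterraWeight_picardKernel {v : ℝ → ℂ} (hv : ContinuousOn v (Ioi 0)) {n : ℝ} (hn : 1 < n) :
    ∃ l : ℝ, 0 < l ∧
      VolterraWeight (picardKernel v) (Ioo (1 / n) n) (fun x => Real.exp (l * |x - 1|)) := by
  have hn0 : 0 < n := zero_lt_one.trans hn
  have hn1 : 1 / n < 1 := by rw [div_lt_one hn0]; exact hn
  have hn2 : 0 < 1 / n := by positivity
  obtain ⟨C, hC⟩ := isCompact_Icc.exists_bound_of_continuousOn
    (hv.mono (Icc_subset_Ioi_iff (hn1.trans hn).le |>.2 hn2))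
  have hC0 : 0 ≤ C := (norm_nonneg _).trans (hC 1 ⟨hn1.le, hn.le⟩)
  have hE0 : Ioo (1 / n) n ⊆ Ioi 0 := fun y hy => hn2.trans hy.1
  have hsub : ∀ x ∈ Ioo (1 / n) n, uIoc 1 x ⊆ Ioo (1 / n) n := fun x hx y hy =>
    ⟨(lt_min hn1 hx.1).trans hy.1, hy.2.trans_lt (max_lt hn hx.2)⟩
  have hker : ∀ x ∈ Ioo (1 / n) n, ∀ y,
      ‖picardKernel v x y‖ ≤ (uIoc 1 x).indicator (fun _ => n * C) y := by
    intro x hx y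
    have key : y ∈ uIoc 1 x → ‖(x - y : ℂ) * v y‖ ≤ n * C := by
      intro hy
      have hyE := hsub x hx hy
      rw [norm_mul]
      have : ‖(x - y : ℂ)‖ ≤ n := by
        rw [← Complex.ofReal_sub, Complex.norm_real, Real.norm_eq_abs, abs_le]
        constructor <;> linarith [hx.1, hx.2, hyE.1, hyE.2]
      exact mul_le_mul this (hC y ⟨hyE.1.le, hyE.2.le⟩) (norm_nonneg _) hn0.le
    rcases le_total 1 x with h | h
    · rw [picardKernel_of_one_le v h, uIoc_of_le h] at *
      by_cases hy : y ∈ Ioc 1 x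
      · simpa [hy] using key hy
      · simp [hy]
    · rw [picardKernel_of_le_one v h, uIoc_of_ge h] at *
      by_cases hy : y ∈ Ioc x 1
      · simpa [hy] using key hy
      · simp [hy]
  have hkm : ∀ x ∈ Ioo (1 / n) n,
      AEStronglyMeasurable (picardKernel v x) (volume.restrict (Ioo (1 / n) n)) := by
    intro x hx
    have hc : AEStronglyMeasurable (fun y : ℝ => (x - y : ℂ) * v y)
        (volume.restrict (Ioo (1 / n) n)) := by
      refine ContinuousOn.aestronglyMeasurable ?_ measurableSet_Ioo
      exact ContinuousOn.mul (by fun_prop) (hv.mono hE0)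
    exact (hc.indicator measurableSet_Ioc).sub (hc.indicator measurableSet_Ioc)
  -- The kernel is at most `n * C`, and integrating the weight gains a factor `1 / l`; this choice
  -- makes `n * C / l ≤ 1 / 2`, the summand `1` ensuring `0 < l`.
  set l : ℝ := 2 * (n * C) + 1 with hl
  have hl0 : 0 < l := by positivity
  have hle : ∀ x ∈ Ioo (1 / n) n, ∀ y, ‖picardKernel v x y‖ * Real.exp (l * |y - 1|) ≤
      (uIoc 1 x).indicator (fun y => n * C * Real.exp (l * |y - 1|)) y := by
    intro x hx y
    have := hker x hx y
    by_cases hy : y ∈ uIoc 1 x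
    · simp only [hy, indicator_of_mem] at this ⊢
      gcongr
    · simp only [hy, not_false_eq_true, indicator_of_notMem] at this ⊢
      rw [le_antisymm this (norm_nonneg _), zero_mul]
  have hii : ∀ x, Integrable ((uIoc 1 x).indicator (fun y => n * C * Real.exp (l * |y - 1|))) := by
    intro x
    rw [integrable_indicator_iff measurableSet_uIoc]
    refine (Continuous.integrableOn_uIcc ?_).mono_set uIoc_subset_uIcc
    fun_prop
  refine ⟨l, hl0, measurableSet_Ioo, hE0, fun x _ => Real.exp_pos _, ?_, hkm, ?_, ?_, ?_⟩
  · intro x hx y _ hy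
    have := hker x hx y
    rw [indicator_of_notMem fun h => hy (hsub x hx h)] at this
    simpa using this
  · intro x hx
    refine (hii x).integrableOn.mono' ((hkm x hx).norm.mul ?_) ?_
    · exact Continuous.aestronglyMeasurable (by fun_prop)
    · refine Eventually.of_forall fun y => ?_
      rw [norm_mul, norm_norm, Real.norm_of_nonneg (Real.exp_pos _).le]
      exact hle x hx y
  · intro x hx
    calc _ ≤ ∫ y in Ioo (1 / n) n, (uIoc 1 x).indicator
          (fun y => n * C * Real.exp (l * |y - 1|)) y := by
          refine integral_mono_of_nonneg (Eventually.of_forall fun y => by positivity)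
            (hii x).integrableOn (Eventually.of_forall (hle x hx))
      _ = ∫ y in uIoc 1 x, n * C * Real.exp (l * |y - 1|) := by
          rw [setIntegral_indicator measurableSet_uIoc, inter_eq_right.2 (hsub x hx)]
      _ = n * C * ∫ y in uIoc 1 x, Real.exp (l * |y - 1|) := integral_const_mul _ _
      _ ≤ n * C * (Real.exp (l * |x - 1|) / l) := by gcongr; exact integral_uIoc_exp_le hl0
      _ ≤ Real.exp (l * |x - 1|) / 2 := by
          rw [← mul_div_assoc, div_le_div_iff₀ hl0 two_pos]
          nlinarith [Real.exp_pos (l * |x - 1|)]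
  · rintro u hu ⟨M, hM⟩
    have hM' : ∀ᵐ y ∂(volume.restrict (Ioo (1 / n) n)), ‖u y‖ ≤ |M| * Real.exp (l * n) := by
      filter_upwards [hM, ae_restrict_mem measurableSet_Ioo] with y hy hyE
      refine hy.trans ?_
      gcongr
      · exact le_abs_self M
      · rw [abs_le]; constructor <;> linarith [hyE.1, hyE.2]
    have hi := intervalIntegrable_Ioo_of_ae_bound hv hn2 (hn1.trans hn).le hu hM'
    have h1 : (1 : ℝ) ∈ uIcc (1 / n) n := by
      rw [uIcc_of_le (hn1.trans hn).le]; exact ⟨hn1.le, hn.le⟩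
    have hi2 : IntervalIntegrable (fun y : ℝ => (y : ℂ) * (v y * u y)) volume (1 / n) n :=
      hi.continuousOn_mul (by fun_prop)
    have c1 := intervalIntegral.continuousOn_primitive_interval' hi h1
    have c2 := intervalIntegral.continuousOn_primitive_interval' hi2 h1
    have hEu : Ioo (1 / n) n ⊆ uIcc (1 / n) n := by
      rw [uIcc_of_le (hn1.trans hn).le]; exact Ioo_subset_Icc_self
    have c3 : ContinuousOn (fun x : ℝ => -((x : ℂ) * (∫ y in (1 : ℝ)..x, v y * u y)
        - ∫ y in (1 : ℝ)..x, (y : ℂ) * (v y * u y))) (Ioo (1 / n) n) :=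
      ((ContinuousOn.mul (by fun_prop) (c1.mono hEu)).sub (c2.mono hEu)).neg
    refine (c3.congr fun x hx => ?_).aestronglyMeasurable measurableSet_Ioo
    rw [kernelOp_picardKernel v u (hE0 hx), integral_sub_mul]
    exact hi.mono_set (uIcc_subset_uIcc h1 (hEu hx))

/-- Global existence for `f'' = v f` with continuous `v` and initial data at `1`. -/
theorem exists_solvesODE {v : ℝ → ℂ} (hv : ContinuousOn v (Ioi 0)) (α β : ℂ) :
    ∃ f, SolvesODE v f ∧ f 1 = α ∧ deriv f 1 = β := by
  set f₀ : ℝ → ℂ := fun x => α + β * (x - 1) with hf₀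
  have hf₀c : Continuous f₀ := by fun_prop
  -- Neither the kernel nor the series depends on `n`, so a single function is defined on the whole
  -- half-line. The interval and its weight enter only in the proof of convergence, and no gluing of
  -- local solutions is needed.
  set f := neumannSum (picardKernel v) f₀ with hf
  have hloc : ∀ n : ℝ, 1 < n → IntervalIntegrable (fun y => v y * f y) volume (1 / n) n ∧
      ∀ x ∈ Ioo (1 / n) n, f x = f₀ x + ∫ y in (1 : ℝ)..x, (x - y : ℂ) * (v y * f y) := by
    intro n hn
    have hn0 : 0 < n := zero_lt_one.trans hn
    have hn1 : 1 / n < 1 := by rw [div_lt_one hn0]; exact hn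
    have hn2 : 0 < 1 / n := by positivity
    obtain ⟨l, hl, V⟩ := volterraWeight_picardKernel hv hn
    obtain ⟨M, hM⟩ := isCompact_Icc.exists_bound_of_continuousOn
      (hf₀c.continuousOn (s := Icc (1 / n) n))
    have hM0 : 0 ≤ M := (norm_nonneg _).trans (hM 1 ⟨hn1.le, hn.le⟩)
    have hfm : AEStronglyMeasurable f₀ (volume.restrict (Ioo (1 / n) n)) :=
      hf₀c.aestronglyMeasurable
    have hMΨ : ∀ x ∈ Ioo (1 / n) n, ‖f₀ x‖ ≤ M * Real.exp (l * |x - 1|) := fun x hx =>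
      (hM x ⟨hx.1.le, hx.2.le⟩).trans (le_mul_of_one_le_right hM0
        (Real.one_le_exp (by positivity)))
    refine ⟨intervalIntegrable_Ioo_of_ae_bound (M := 2 * M * Real.exp (l * n)) hv hn2
      (hn1.trans hn).le
      (V.aestronglyMeasurable_neumannSum hM0 hfm hMΨ) ?_, fun x hx => ?_⟩
    · refine (ae_restrict_iff' measurableSet_Ioo).2 (Eventually.of_forall fun y hy => ?_)
      refine (V.summable_neumannTerm hM0 hfm hMΨ hy).2.trans ?_
      gcongr
      rw [abs_le]; constructor <;> linarith [hy.1, hy.2]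
    · have := V.neumannSum_add_kernelOp hM0 hfm hMΨ hx
      rw [kernelOp_picardKernel v _ (hn2.trans hx.1)] at this
      linear_combination this
  have hn : ∀ x : ℝ, 0 < x → ∃ n : ℝ, 1 < n ∧ x ∈ Ioo (1 / n) n := by
    intro x hx
    have hx' : 0 < 1 / x := by positivity
    refine ⟨x + 1 / x + 1, by linarith, ?_, by linarith⟩
    rw [div_lt_iff₀ (by positivity)]
    have : x * (1 / x) = 1 := by field_simp
    nlinarith
  have hint : ∀ x : ℝ, 0 < x → IntervalIntegrable (fun y => v y * f y) volume 1 x := by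
    intro x hx
    obtain ⟨n, hn, hxn⟩ := hn x hx
    have hn0 : 0 < n := zero_lt_one.trans hn
    have hn1 : 1 / n < 1 := by rw [div_lt_one hn0]; exact hn
    refine (hloc n hn).1.mono_set ?_
    rw [uIcc_of_le (hn1.trans hn).le]
    exact uIcc_subset_Icc ⟨hn1.le, hn.le⟩ ⟨hxn.1.le, hxn.2.le⟩
  have hIint : ∀ w : ℝ → ℂ, (∀ x : ℝ, 0 < x → IntervalIntegrable w volume 1 x) →
      ContinuousOn (fun x => ∫ y in (1 : ℝ)..x, w y) (Ioi 0) := by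
    intro w hw x hx
    have hx : 0 < x := hx
    have h2 : IntervalIntegrable w volume (x / 2) (x + 1) :=
      (hw _ (by positivity)).symm.trans (hw _ (by positivity))
    have h1 := intervalIntegral.continuousOn_primitive_interval' h2 (a := x) (by
      rw [uIcc_of_le (by linarith)]; constructor <;> linarith)
    rw [uIcc_of_le (by linarith)] at h1
    have h3 := ((h1.continuousAt (x := x) (Icc_mem_nhds (by linarith) (by linarith))).const_add
      (∫ y in (1 : ℝ)..x, w y))
    refine (h3.congr ?_).continuousWithinAt
    filter_upwards [Ioi_mem_nhds hx] with z hz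
    exact intervalIntegral.integral_add_adjacent_intervals (hw x hx)
      ((hw x hx).symm.trans (hw z hz))
  have hint2 : ∀ x : ℝ, 0 < x → IntervalIntegrable (fun y : ℝ => (y : ℂ) * (v y * f y)) volume 1 x :=
    fun x hx => (hint x hx).continuousOn_mul (by fun_prop)
  have hform : ∀ x : ℝ, 0 < x → f x = f₀ x + (x * (∫ y in (1 : ℝ)..x, v y * f y)
      - ∫ y in (1 : ℝ)..x, (y : ℂ) * (v y * f y)) := by
    intro x hx
    obtain ⟨n, hn, hxn⟩ := hn x hx
    rw [(hloc n hn).2 x hxn, integral_sub_mul (hint x hx)]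
  -- Regularity is bootstrapped: so far `v f` is only locally integrable, the integral equation then
  -- makes `f` continuous, and with `v f` continuous the equation can be differentiated twice.
  have hfc : ContinuousOn f (Ioi 0) := by
    refine ContinuousOn.congr (f := fun x : ℝ => f₀ x + ((x : ℂ) * (∫ y in (1 : ℝ)..x, v y * f y)
      - ∫ y in (1 : ℝ)..x, (y : ℂ) * (v y * f y))) ?_ (fun x hx => hform x hx)
    exact hf₀c.continuousOn.add ((ContinuousOn.mul (by fun_prop) (hIint _ hint)).sub
      (hIint _ hint2))
  have hder : ∀ w : ℝ → ℂ, ContinuousOn w (Ioi 0) → ∀ x : ℝ, 0 < x →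
      HasDerivAt (fun x => ∫ y in (1 : ℝ)..x, w y) (w x) x := by
    intro w hw x hx
    exact intervalIntegral.integral_hasDerivAt_right
      ((hw.mono (uIcc_subset_Ioi_zero one_pos hx)).intervalIntegrable)
      (hw.stronglyMeasurableAtFilter isOpen_Ioi x hx) (hw.continuousAt (Ioi_mem_nhds hx))
  have hvf : ContinuousOn (fun y => v y * f y) (Ioi 0) := hv.mul hfc
  have hf' : ∀ x : ℝ, 0 < x → HasDerivAt f (β + ∫ y in (1 : ℝ)..x, v y * f y) x := by
    intro x hx
    have h0 : HasDerivAt f₀ β x := by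
      have := (((hasDerivAt_id x).ofReal_comp.sub_const 1).const_mul β).const_add α
      convert! this using 1
      simp
    have h1 := h0.add (((hasDerivAt_id x).ofReal_comp.mul (hder _ hvf x hx)).sub
      (hder (fun y : ℝ => (y : ℂ) * (v y * f y)) (ContinuousOn.mul (by fun_prop) hvf) x hx))
    have h2 : HasDerivAt f _ x := h1.congr_of_eventuallyEq (by
      filter_upwards [Ioi_mem_nhds hx] with z hz
      simp [hform z hz])
    convert! h2 using 1
    simp
  have hf'' : ∀ x : ℝ, 0 < x →
      HasDerivAt (fun x => β + ∫ y in (1 : ℝ)..x, v y * f y) (v x * f x) x :=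
    fun x hx => (hder _ hvf x hx).const_add β
  refine ⟨f, solvesODE_of_hasDerivAt hf' (isAC_of_hasDerivAt hf'' hvf)
    ((ae_restrict_iff' measurableSet_Ioi).2 (Eventually.of_forall hf'')), ?_, ?_⟩
  · rw [hform 1 one_pos]; simp [hf₀]
  · rw [(hf' 1 one_pos).deriv]; simp

/-! ### Pairs of solutions with a controlled Green's kernel -/

/-- Two positive continuous weights on `]0,∞[` whose product is bounded near `0`. -/
structure WeightPair (ω η : ℝ → ℝ) : Prop where
  continuousOn_left : ContinuousOn ω (Ioi 0)
  continuousOn_right : ContinuousOn η (Ioi 0)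
  pos_left : ∀ x, 0 < x → 0 < ω x
  pos_right : ∀ x, 0 < x → 0 < η x
  mul_le : ∀ a : ℝ, 0 < a → ∃ B : ℝ, 0 ≤ B ∧ ∀ x ∈ Ioo 0 a, η x * ω x ≤ B

/-- Two independent solutions of `f'' = v f`, of size `ω` near `0`, whose bisolution
`h₁(x) h₂(y) - h₂(x) h₁(y)` has, for `y ≤ x`, size `ω(y) η(x)`, its `x`-derivative having size
`ω(y) η(x) / x`. -/
structure TamePair (v : ℝ → ℂ) (ω η : ℝ → ℝ) (h : (ℝ → ℂ) × (ℝ → ℂ)) : Prop where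
  sol₁ : SolvesODE v h.1
  sol₂ : SolvesODE v h.2
  wronskian_ne_zero : wronskian h.1 h.2 1 ≠ 0
  bound : ∀ a : ℝ, 0 < a → ∃ C : ℝ, 0 ≤ C ∧
    (∀ x y : ℝ, 0 < y → y ≤ x → x < a →
      ‖h.1 x * h.2 y - h.2 x * h.1 y‖ ≤ C * (ω y * η x) ∧
      ‖deriv h.1 x * h.2 y - deriv h.2 x * h.1 y‖ ≤ C * (ω y * (η x / x))) ∧
    ∀ y ∈ Ioo 0 a, ‖h.1 y‖ ≤ C * ω y ∧ ‖h.2 y‖ ≤ C * ω y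

/-- The function `N` is compared with `exp (l (x - y))`, where `l = 2 L + 1`. At a maximum point of
the quotient the integral term is at most half of the left side and can be absorbed, which bounds
the maximum by `2 A`. -/
theorem backward_gronwall {N : ℝ → ℝ} {A L y₀ x : ℝ} (hL : 0 ≤ L) (hyx : y₀ ≤ x)
    (hN : ContinuousOn N (Icc y₀ x)) (hN0 : ∀ y ∈ Icc y₀ x, 0 ≤ N y)
    (h : ∀ y ∈ Icc y₀ x, N y ≤ A + L * ∫ z in y..x, N z) :
    N y₀ ≤ 2 * A * Real.exp ((2 * L + 1) * (x - y₀)) := by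
  set l := 2 * L + 1 with hl
  have hl0 : 0 < l := by positivity
  obtain ⟨s, hs, hmax⟩ := isCompact_Icc.exists_isMaxOn (nonempty_Icc.2 hyx)
    (hN.mul (Continuous.continuousOn (f := fun y => Real.exp (-(l * (x - y)))) (by fun_prop)))
  set M := N s * Real.exp (-(l * (x - s))) with hM
  have hM0 : 0 ≤ M := mul_nonneg (hN0 s hs) (Real.exp_pos _).le
  have hle : ∀ y ∈ Icc y₀ x, N y ≤ M * Real.exp (l * (x - y)) := by
    intro y hy
    have := hmax hy
    simp only [mem_ofPred_eq] at this
    calc N y = N y * Real.exp (-(l * (x - y))) * Real.exp (l * (x - y)) := by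
          rw [mul_assoc, ← Real.exp_add]; simp
      _ ≤ _ := by gcongr; exact this
  have hint : ∫ z in s..x, N z ≤ M * (Real.exp (l * (x - s)) / l) := by
    have e : ∫ z in s..x, Real.exp (l * (x - z)) ≤ Real.exp (l * (x - s)) / l := by
      rw [intervalIntegral.integral_eq_sub_of_hasDerivAt
        (f := fun y => -(Real.exp (l * (x - y)) / l)) (fun y _ => ?_) (by
          apply Continuous.intervalIntegrable; fun_prop)]
      · have : 0 < Real.exp (l * (x - x)) / l := by positivity
        linarith
      · have := (((((hasDerivAt_id y).const_sub x).const_mul l).exp).div_const l).neg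
        convert! this using 1
        simp; field_simp
    calc _ ≤ ∫ z in s..x, M * Real.exp (l * (x - z)) := by
          refine intervalIntegral.integral_mono_on hs.2 ?_ ?_ fun z hz => ?_
          · refine (hN.mono ?_).intervalIntegrable
            rw [uIcc_of_le hs.2]; exact Icc_subset_Icc_left hs.1
          · apply Continuous.intervalIntegrable; fun_prop
          · exact hle z ⟨hs.1.trans hz.1, hz.2⟩
      _ = M * ∫ z in s..x, Real.exp (l * (x - z)) := intervalIntegral.integral_const_mul _ _
      _ ≤ _ := by gcongr
  have hs2 := h s hs
  have hNs : N s = M * Real.exp (l * (x - s)) := by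
    rw [hM, mul_assoc, ← Real.exp_add]; simp
  have h3 : M * Real.exp (l * (x - s)) ≤ 2 * A := by
    have h4 : L * (M * (Real.exp (l * (x - s)) / l)) ≤ M * Real.exp (l * (x - s)) / 2 := by
      rw [show L * (M * (Real.exp (l * (x - s)) / l)) = L * (M * Real.exp (l * (x - s))) / l by ring,
        div_le_div_iff₀ hl0 two_pos]
      have : 0 ≤ M * Real.exp (l * (x - s)) := by positivity
      nlinarith
    have h5 : L * ∫ z in s..x, N z ≤ L * (M * (Real.exp (l * (x - s)) / l)) := by gcongr
    linarith
  have h6 : M ≤ 2 * A := le_trans (le_mul_of_one_le_right hM0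
    (Real.one_le_exp (mul_nonneg hl0.le (sub_nonneg.2 hs.2)))) h3
  exact (hle y₀ ⟨le_rfl, hyx⟩).trans (by gcongr)

/-- Solutions of `u'' = (v + κ) u` are controlled backwards from `x` to `y ≤ x` by the weights of a
tame pair for `v`. -/
theorem TamePair.backward_bound {v : ℝ → ℂ} {ω η : ℝ → ℝ} {p : (ℝ → ℂ) × (ℝ → ℂ)}
    (T : TamePair v ω η p) (hW : WeightPair ω η) (κ : ℂ) {a : ℝ} (ha : 0 < a) :
    ∃ C : ℝ, 0 ≤ C ∧ ∀ u : ℝ → ℂ, SolvesODE (fun x => v x + κ) u → ∀ x y : ℝ, 0 < y → y ≤ x →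
      x < a → ‖u y‖ ≤ C * (ω y * η x * (‖u x‖ / x + ‖deriv u x‖)) := by
  obtain ⟨C, hC0, hC, -⟩ := T.bound a ha
  obtain ⟨B, hB0, hB⟩ := hW.mul_le a ha
  set w := wronskian p.1 p.2 1 with hw
  have hw0 : 0 < ‖w‖ := norm_pos_iff.2 T.wronskian_ne_zero
  set L := C / ‖w‖ * ‖κ‖ * B with hL
  have hL0 : 0 ≤ L := by positivity
  refine ⟨2 * (C / ‖w‖) * Real.exp ((2 * L + 1) * a), by positivity, fun u hu x y₀ hy₀ hyx hxa => ?_⟩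
  have hx : 0 < x := hy₀.trans_le hyx
  set D := ‖u x‖ / x + ‖deriv u x‖ with hD
  have hD0 : 0 ≤ D := by positivity
  have hsub : Icc y₀ x ⊆ Ioi 0 := fun z hz => hy₀.trans_le hz.1
  have hic : ∀ g : ℝ → ℂ, ContinuousOn g (Ioi 0) → ∀ y ∈ Icc y₀ x,
      IntervalIntegrable (fun z => (v z - (v z + κ)) * (u z * g z)) volume y x := by
    intro g hg y hy
    simp only [sub_add_cancel_left]
    refine ContinuousOn.intervalIntegrable ?_
    exact (continuousOn_const.mul (hu.continuousOn.mul hg)).mono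
      (uIcc_subset_Ioi_zero (hsub hy) hx)
  have hmain : ∀ y ∈ Icc y₀ x, ‖u y‖ ≤
      C / ‖w‖ * ω y * (η x * D + ‖κ‖ * ∫ z in y..x, η z * ‖u z‖) := by
    intro y hy
    have hy0 : 0 < y := hsub hy
    have i1 := hic p.1 T.sol₁.continuousOn y hy
    have i2 := hic p.2 T.sol₂.continuousOn y hy
    have e1 := hu.wronskian_sub_eq_integral T.sol₁ hy0 hx i1
    have e2 := hu.wronskian_sub_eq_integral T.sol₂ hy0 hx i2
    have hwy : p.1 y * deriv p.2 y - deriv p.1 y * p.2 y = w := by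
      rw [hw, ← T.sol₁.wronskian_eq T.sol₂ one_pos hy0]; rfl
    -- Variation of constants based at `x`: the value `u y` is recovered from the Wronskians of `u`
    -- with `p.1` and `p.2` at `y`, and these differ from their values at `x` by integrals
    -- containing only `κ`.
    have hid : u y * w = (u x * (p.1 y * deriv p.2 x - p.2 y * deriv p.1 x)
        - deriv u x * (p.1 y * p.2 x - p.2 y * p.1 x))
        + κ * ∫ z in y..x, (p.1 y * p.2 z - p.2 y * p.1 z) * u z := by
      have e3 : κ * ∫ z in y..x, (p.1 y * p.2 z - p.2 y * p.1 z) * u z =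
          p.2 y * (∫ z in y..x, (v z - (v z + κ)) * (u z * p.1 z))
          - p.1 y * (∫ z in y..x, (v z - (v z + κ)) * (u z * p.2 z)) := by
        rw [← intervalIntegral.integral_const_mul, ← intervalIntegral.integral_const_mul,
          ← intervalIntegral.integral_const_mul, ← intervalIntegral.integral_sub
            (i1.const_mul _) (i2.const_mul _)]
        congr 1; ext z; ring
      rw [e3, ← e1, ← e2, ← hwy]
      simp only [wronskian]
      ring
    have b1 := hC x y hy0 hy.2 hxa
    have n1 : ‖u x * (p.1 y * deriv p.2 x - p.2 y * deriv p.1 x)‖ ≤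
        ‖u x‖ * (C * (ω y * (η x / x))) := by
      rw [norm_mul]
      gcongr
      rw [norm_sub_rev]
      simpa [mul_comm] using b1.2
    have n2 : ‖deriv u x * (p.1 y * p.2 x - p.2 y * p.1 x)‖ ≤ ‖deriv u x‖ * (C * (ω y * η x)) := by
      rw [norm_mul]
      gcongr
      rw [norm_sub_rev]
      simpa [mul_comm] using b1.1
    have hηu : ContinuousOn (fun z => η z * ‖u z‖) (Ioi 0) :=
      hW.continuousOn_right.mul hu.continuousOn.norm
    have n3 : ‖∫ z in y..x, (p.1 y * p.2 z - p.2 y * p.1 z) * u z‖ ≤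
        C * ω y * ∫ z in y..x, η z * ‖u z‖ := by
      rw [← intervalIntegral.integral_const_mul]
      refine intervalIntegral.norm_integral_le_of_norm_le hy.2 ?_ ?_
      · refine Eventually.of_forall fun z hz => ?_
        rw [norm_mul, norm_sub_rev]
        have := (hC z y hy0 hz.1.le (hz.2.trans_lt hxa)).1
        calc _ ≤ C * (ω y * η z) * ‖u z‖ := by
              gcongr
              simpa [mul_comm] using this
          _ = _ := by ring
      · exact ((hηu.mono (uIcc_subset_Ioi_zero hy0 hx)).intervalIntegrable).const_mul _
    have n4 : ‖u y‖ * ‖w‖ ≤ ‖u x‖ * (C * (ω y * (η x / x))) + ‖deriv u x‖ * (C * (ω y * η x))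
        + ‖κ‖ * (C * ω y * ∫ z in y..x, η z * ‖u z‖) := by
      rw [← norm_mul, hid]
      refine (norm_add_le _ _).trans (add_le_add ((norm_sub_le _ _).trans (add_le_add n1 n2)) ?_)
      rw [norm_mul]
      gcongr
    rw [← le_div_iff₀ hw0] at n4
    refine n4.trans (le_of_eq ?_)
    rw [hD]
    field_simp
  have hωpos : ∀ y ∈ Icc y₀ x, 0 < ω y := fun y hy => hW.pos_left y (hsub hy)
  have hNc : ContinuousOn (fun y => ‖u y‖ / ω y) (Ioi 0) :=
    hu.continuousOn.norm.div hW.continuousOn_left fun y hy => (hW.pos_left y hy).ne'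
  -- Dividing by `ω y` removes the `y`-dependence of the prefactor. The integrand `η ‖u‖` becomes `η
  -- ω` times the quotient, and `η ω` is bounded by `B`, so `L` is a genuine constant.
  have hG := backward_gronwall (N := fun y => ‖u y‖ / ω y) (A := C / ‖w‖ * (η x * D)) (L := L)
    (y₀ := y₀) (x := x) hL0 hyx
    (hNc.mono hsub)
    (fun y hy => div_nonneg (norm_nonneg _) (hωpos y hy).le) (by
      intro y hy
      have hy0 : 0 < y := hsub hy
      have h1 : ∫ z in y..x, η z * ‖u z‖ ≤ B * ∫ z in y..x, ‖u z‖ / ω z := by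
        rw [← intervalIntegral.integral_const_mul]
        refine intervalIntegral.integral_mono_on hy.2 ?_ ?_ fun z hz => ?_
        · exact ((hW.continuousOn_right.mul hu.continuousOn.norm).mono
            (uIcc_subset_Ioi_zero hy0 hx)).intervalIntegrable
        · exact ((hNc.mono (uIcc_subset_Ioi_zero hy0 hx)).intervalIntegrable).const_mul _
        · have hz0 : 0 < z := hy0.trans_le hz.1
          have hz1 := hW.pos_left z hz0
          calc η z * ‖u z‖ = η z * ω z * (‖u z‖ / ω z) := by field_simp
            _ ≤ _ := by gcongr; exact hB z ⟨hz0, hz.2.trans_lt hxa⟩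
      rw [div_le_iff₀ (hωpos y hy)]
      refine (hmain y hy).trans ?_
      have hω := (hωpos y hy).le
      calc _ ≤ C / ‖w‖ * ω y * (η x * D + ‖κ‖ * (B * ∫ z in y..x, ‖u z‖ / ω z)) := by gcongr
        _ = _ := by rw [hL]; ring)
  rw [div_le_iff₀ (hωpos y₀ ⟨le_rfl, hyx⟩)] at hG
  refine hG.trans ?_
  have := (hωpos y₀ ⟨le_rfl, hyx⟩).le
  have hη := (hW.pos_right x hx).le
  calc _ ≤ 2 * (C / ‖w‖ * (η x * D)) * Real.exp ((2 * L + 1) * a) * ω y₀ := by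
        gcongr; linarith
    _ = _ := by ring

/-- Adding a constant to the potential does not change the weights of a tame pair. -/
theorem TamePair.add_const {v : ℝ → ℂ} {ω η : ℝ → ℝ} {p h : (ℝ → ℂ) × (ℝ → ℂ)}
    (T : TamePair v ω η p) (hW : WeightPair ω η) (κ : ℂ)
    (h₁ : SolvesODE (fun x => v x + κ) h.1) (h₂ : SolvesODE (fun x => v x + κ) h.2)
    (hw : wronskian h.1 h.2 1 ≠ 0) : TamePair (fun x => v x + κ) ω η h := by
  refine ⟨h₁, h₂, hw, fun a ha => ?_⟩
  -- The enlarged interval admits `a` itself as a starting point, which is used below to bound `h.1`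
  -- and `h.2` on `]0, a[` by their data at `a`.
  obtain ⟨C, hC0, hC⟩ := T.backward_bound hW κ (a := a + 1) (by positivity)
  set w := wronskian h.1 h.2 1 with hwdef
  have hwx : ∀ x, 0 < x → h.1 x * deriv h.2 x - deriv h.1 x * h.2 x = w := fun x hx => by
    rw [hwdef, ← h₁.wronskian_eq h₂ one_pos hx]; rfl
  set D := fun u : ℝ → ℂ => η a * (‖u a‖ / a + ‖deriv u a‖) with hD
  have hηa := (hW.pos_right a ha).le
  have hD0 : ∀ u, 0 ≤ D u := fun u => by positivity
  refine ⟨C * (‖w‖ + D h.1 + D h.2), ?_, fun x y hy hyx hxa => ⟨?_, ?_⟩, fun y hy => ⟨?_, ?_⟩⟩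
  · have := hD0 h.1; have := hD0 h.2; positivity
  · have hx : 0 < x := hy.trans_le hyx
    -- For fixed `x` the bisolution is, as a function of `y`, the solution with value `0` and
    -- derivative `w` at `x`. The backward bound for it is exactly the kernel estimate.
    have hs := h₂.linear_combination h₁ (h.1 x) (-h.2 x)
    have := hC _ hs x y hy hyx (by linarith)
    have hd : deriv (fun z => h.1 x * h.2 z + -h.2 x * h.1 z) x = w := by
      rw [(((h₂.hasDerivAt hx).const_mul _).fun_add ((h₁.hasDerivAt hx).const_mul _)).deriv,
        ← hwx x hx]
      ring
    rw [hd, show h.1 x * h.2 x + -h.2 x * h.1 x = 0 by ring, norm_zero, zero_div, zero_add] at this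
    have hωy := (hW.pos_left y hy).le
    have hηx := (hW.pos_right x hx).le
    calc _ = ‖h.1 x * h.2 y + -h.2 x * h.1 y‖ := by congr 1; ring
      _ ≤ _ := this
      _ = C * ‖w‖ * (ω y * η x) := by ring
      _ ≤ _ := by gcongr; linarith [hD0 h.1, hD0 h.2]
  · have hx : 0 < x := hy.trans_le hyx
    -- The `x`-derivative of the bisolution is the solution in `y` with value `-w` and derivative
    -- `0` at `x`; the value enters the backward bound divided by `x`, whence the factor `η x / x`.
    have hs := h₂.linear_combination h₁ (deriv h.1 x) (-deriv h.2 x)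
    have := hC _ hs x y hy hyx (by linarith)
    have hd : deriv (fun z => deriv h.1 x * h.2 z + -deriv h.2 x * h.1 z) x = 0 := by
      rw [(((h₂.hasDerivAt hx).const_mul _).fun_add ((h₁.hasDerivAt hx).const_mul _)).deriv]
      ring
    rw [hd, show deriv h.1 x * h.2 x + -deriv h.2 x * h.1 x = -w by rw [← hwx x hx]; ring,
      norm_neg, norm_zero, add_zero] at this
    have hωy := (hW.pos_left y hy).le
    have hηx := (hW.pos_right x hx).le
    calc _ = ‖deriv h.1 x * h.2 y + -deriv h.2 x * h.1 y‖ := by congr 1; ring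
      _ ≤ _ := this
      _ = C * ‖w‖ * (ω y * (η x / x)) := by ring
      _ ≤ _ := by gcongr; linarith [hD0 h.1, hD0 h.2]
  · have := hC _ h₁ a y hy.1 hy.2.le (by linarith)
    have hωy := (hW.pos_left y hy.1).le
    calc _ ≤ _ := this
      _ = C * D h.1 * ω y := by rw [hD]; ring
      _ ≤ _ := by gcongr; linarith [hD0 h.2, norm_nonneg w]
  · have := hC _ h₂ a y hy.1 hy.2.le (by linarith)
    have hωy := (hW.pos_left y hy.1).le
    calc _ ≤ _ := this
      _ = C * D h.2 * ω y := by rw [hD]; ring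
      _ ≤ _ := by gcongr; linarith [hD0 h.1, norm_nonneg w]

/-! ### The forward Green's operator of a tame pair -/

/-- The forward Green's kernel built from a pair of solutions. -/
noncomputable def greenKernel (h : (ℝ → ℂ) × (ℝ → ℂ)) (x y : ℝ) : ℂ :=
  if y ≤ x then (h.1 x * h.2 y - h.2 x * h.1 y) / wronskian h.1 h.2 1 else 0

theorem forwardGreen_eq (m k : ℂ) : forwardGreen m k = greenKernel (fundamentalPair m k) := rfl

theorem greenQ_eq (m k : ℂ) (Q f : ℝ → ℂ) :
    greenQ m k Q f = kernelOp (fun x y => greenKernel (fundamentalPair m k) x y * Q y) f := by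
  ext x
  simp only [greenQ, kernelOp, forwardGreen_eq, mul_assoc]

/-- Splitting the integral over the two terms of the kernel requires each to converge separately at
`0`; this links the operator with variation of constants. -/
theorem kernelOp_greenKernel {h : (ℝ → ℂ) × (ℝ → ℂ)} {Q u : ℝ → ℂ}
    (i₁ : ∀ a : ℝ, 0 < a → IntegrableOn (fun y => h.1 y * (Q y * u y)) (Ioo 0 a))
    (i₂ : ∀ a : ℝ, 0 < a → IntegrableOn (fun y => h.2 y * (Q y * u y)) (Ioo 0 a))
    {x : ℝ} (hx : 0 < x) :
    kernelOp (fun x y => greenKernel h x y * Q y) u x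
      = particular h.1 h.2 (fun y => Q y * u y) x := by
  have e : ∀ y, greenKernel h x y * Q y * u y = (Iic x).indicator
      (fun y => (h.1 x * (h.2 y * (Q y * u y)) - h.2 x * (h.1 y * (Q y * u y)))
        / wronskian h.1 h.2 1) y := by
    intro y
    by_cases hy : y ≤ x
    · rw [indicator_of_mem (show y ∈ Iic x from hy), greenKernel, if_pos hy]; ring
    · rw [indicator_of_notMem (show y ∉ Iic x from hy), greenKernel, if_neg hy]; ring
  rw [kernelOp]
  simp_rw [e]
  rw [setIntegral_indicator measurableSet_Iic, Ioi_inter_Iic, particular, integral_div,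
    integral_sub, integral_const_mul, integral_const_mul,
    intervalIntegral.integral_of_le hx.le, intervalIntegral.integral_of_le hx.le]
  · exact ((intervalIntegrable_iff_integrableOn_Ioc_of_le hx.le).1
      (intervalIntegrable_zero_of_forall i₂ hx)).const_mul _
  · exact ((intervalIntegrable_iff_integrableOn_Ioc_of_le hx.le).1
      (intervalIntegrable_zero_of_forall i₁ hx)).const_mul _

/-- A potential `Q` and a weight `φ` for which the forward Green's operator of a tame pair with
weights `ω, η` acts on `L^∞(]0,a[, φ)`. -/
structure AdmissibleWeight (ω η : ℝ → ℝ) (Q : ℝ → ℂ) (φ : ℝ → ℝ) : Prop where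
  locallyIntegrable : LocallyIntegrableOn Q (Ioi 0)
  continuousOn : ContinuousOn φ (Ioi 0)
  pos : ∀ x, 0 < x → 0 < φ x
  le : ∀ a : ℝ, 0 < a → ∃ C : ℝ, 0 ≤ C ∧ ∀ x ∈ Ioo 0 a, η x ≤ C * φ x
  integrable : ∀ a : ℝ, 0 < a → IntegrableOn (fun y => ω y * φ y * ‖Q y‖) (Ioo 0 a)

section

variable {v : ℝ → ℂ} {ω η : ℝ → ℝ} {h : (ℝ → ℂ) × (ℝ → ℂ)} {Q : ℝ → ℂ} {φ : ℝ → ℝ}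

theorem AdmissibleWeight.aestronglyMeasurable (A : AdmissibleWeight ω η Q φ) (a : ℝ) :
    AEStronglyMeasurable Q (volume.restrict (Ioo 0 a)) :=
  A.locallyIntegrable.aestronglyMeasurable.mono_set Ioo_subset_Ioi_self

theorem AdmissibleWeight.integrableOn_mul (A : AdmissibleWeight ω η Q φ)
    {g u : ℝ → ℂ} {a C M : ℝ}
    (hg : ContinuousOn g (Ioi 0)) (hgC : ∀ y ∈ Ioo 0 a, ‖g y‖ ≤ C * ω y)
    (hu : AEStronglyMeasurable u (volume.restrict (Ioo 0 a)))
    (huM : ∀ᵐ y ∂(volume.restrict (Ioo 0 a)), ‖u y‖ ≤ M * φ y) (ha : 0 < a) :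
    IntegrableOn (fun y => g y * (Q y * u y)) (Ioo 0 a) := by
  refine ((A.integrable a ha).const_mul (C * M)).mono' ?_ ?_
  · exact ((hg.mono Ioo_subset_Ioi_self).aestronglyMeasurable measurableSet_Ioo).mul
      ((A.aestronglyMeasurable a).mul hu)
  · filter_upwards [huM, ae_restrict_mem measurableSet_Ioo] with y hy hyE
    have h1 := hgC y hyE
    have hφ := (A.pos y hyE.1).le
    rw [norm_mul, norm_mul]
    calc _ ≤ C * ω y * (‖Q y‖ * (M * φ y)) := by
          gcongr
          exact (norm_nonneg _).trans h1
      _ = _ := by ring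

/-- Since `η ≤ C' φ`, the kernel times `φ y` is at most `φ x * ρ y` with `ρ` integrable. With `R`
the primitive of `ρ`, the weight `φ exp (2 R)` turns this into a contraction, because `∫₀ˣ ρ exp (2
R) ≤ exp (2 R x) / 2`. As `R` is bounded on `]0, a[`, the new weight is equivalent to `φ`, with `Λ =
exp (2 R a)`. -/
theorem TamePair.volterraWeight (T : TamePair v ω η h) (hW : WeightPair ω η)
    (A : AdmissibleWeight ω η Q φ) {a : ℝ} (ha : 0 < a) :
    ∃ (Ψ : ℝ → ℝ) (Λ : ℝ), 1 ≤ Λ ∧ (∀ x ∈ Ioo 0 a, φ x ≤ Ψ x ∧ Ψ x ≤ Λ * φ x) ∧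
      VolterraWeight (fun x y => greenKernel h x y * Q y) (Ioo 0 a) Ψ := by
  obtain ⟨C, hC0, hC, hCb⟩ := T.bound a ha
  obtain ⟨C', hC'0, hC'⟩ := A.le a ha
  set w := wronskian h.1 h.2 1 with hw
  have hw0 : 0 < ‖w‖ := norm_pos_iff.2 T.wronskian_ne_zero
  -- The absolute value matters only outside `]0, ∞[`, where nothing is known about the weights; it
  -- makes `ρ` nonnegative everywhere.
  set ρ : ℝ → ℝ := fun y => C * C' / ‖w‖ * |ω y * φ y * ‖Q y‖| with hρ
  have hρ0 : ∀ y, 0 ≤ ρ y := fun y => by positivity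
  have hρi : IntegrableOn ρ (Ioo 0 a) := (A.integrable a ha).abs.const_mul _
  have hρi' : IntervalIntegrable ρ volume 0 a := by
    rw [intervalIntegrable_iff_integrableOn_Ioo_of_le ha.le]; exact hρi
  set R : ℝ → ℝ := fun x => ∫ t in (0 : ℝ)..x, ρ t with hR
  have hR0 : ∀ x ∈ Ioo 0 a, 0 ≤ R x := fun x hx =>
    intervalIntegral.integral_nonneg hx.1.le fun t _ => hρ0 t
  have hRa : ∀ x ∈ Ioo 0 a, R x ≤ R a := fun x hx =>
    intervalIntegral.integral_mono_interval le_rfl hx.1.le hx.2.le (Eventually.of_forall hρ0) hρi'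
  have hRa0 : 0 ≤ R a := intervalIntegral.integral_nonneg ha.le fun t _ => hρ0 t
  have hRc : ContinuousOn R (Ioo 0 a) := by
    have := intervalIntegral.continuousOn_primitive_interval' hρi' left_mem_uIcc
    rw [uIcc_of_le ha.le] at this
    exact this.mono Ioo_subset_Icc_self
  have hΨ : ∀ x ∈ Ioo 0 a, φ x ≤ φ x * Real.exp (2 * R x) ∧
      φ x * Real.exp (2 * R x) ≤ Real.exp (2 * R a) * φ x := by
    intro x hx
    have hφ := (A.pos x hx.1).le
    refine ⟨le_mul_of_one_le_right hφ (Real.one_le_exp (by linarith [hR0 x hx])), ?_⟩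
    rw [mul_comm]
    gcongr
    exact hRa x hx
  have hΨc : ContinuousOn (fun x => φ x * Real.exp (2 * R x)) (Ioo 0 a) :=
    (A.continuousOn.mono Ioo_subset_Ioi_self).mul
      (Real.continuous_exp.comp_continuousOn (continuousOn_const.mul hRc))
  have hmeas : ∀ x ∈ Ioo 0 a, AEStronglyMeasurable (fun y => greenKernel h x y * Q y)
      (volume.restrict (Ioo 0 a)) := by
    intro x hx
    refine AEStronglyMeasurable.mul ?_ (A.aestronglyMeasurable a)
    have hc : AEStronglyMeasurable (fun y => (h.1 x * h.2 y - h.2 x * h.1 y) / w)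
        (volume.restrict (Ioo 0 a)) := by
      refine ContinuousOn.aestronglyMeasurable ?_ measurableSet_Ioo
      exact (((continuousOn_const.mul T.sol₂.continuousOn).sub
        (continuousOn_const.mul T.sol₁.continuousOn)).div_const w).mono Ioo_subset_Ioi_self
    refine (hc.indicator measurableSet_Iic (s := Iic x)).congr (Eventually.of_forall fun y => ?_)
    simp only [greenKernel, indicator, mem_Iic, hw]
  have hker : ∀ x ∈ Ioo 0 a, ∀ y ∈ Ioo 0 a,
      ‖greenKernel h x y * Q y‖ * (φ y * Real.exp (2 * R y)) ≤
        (Iic x).indicator (fun y => φ x * (ρ y * Real.exp (2 * R y))) y := by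
    intro x hx y hy
    by_cases hyx : y ≤ x
    · rw [indicator_of_mem (show y ∈ Iic x from hyx), greenKernel, if_pos hyx, norm_mul, norm_div,
        ← hw]
      have h1 := (hC x y hy.1 hyx hx.2).1
      have h2 := hC' x hx
      have hωy := (hW.pos_left y hy.1).le
      have hφy := (A.pos y hy.1).le
      calc _ ≤ C * (ω y * (C' * φ x)) / ‖w‖ * ‖Q y‖ * (φ y * Real.exp (2 * R y)) := by
            gcongr
            exact h1.trans (by gcongr)
        _ = _ := by
            rw [hρ]
            simp only
            rw [abs_of_nonneg (by positivity)]
            ring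
    · rw [indicator_of_notMem (show y ∉ Iic x from hyx), greenKernel, if_neg hyx]
      simp
  have hint : ∀ x ∈ Ioo 0 a, IntegrableOn ((Iic x).indicator
      (fun y => φ x * (ρ y * Real.exp (2 * R y)))) (Ioo 0 a) := by
    intro x hx
    rw [IntegrableOn, integrable_indicator_iff measurableSet_Iic, IntegrableOn,
      Measure.restrict_restrict measurableSet_Iic]
    refine IntegrableOn.mono_set (t := Ioc 0 x)
      ((integral_mul_exp_primitive_le hρi hρ0 hx).1.const_mul (φ x)) ?_
    exact fun y hy => ⟨hy.2.1, hy.1⟩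
  refine ⟨fun x => φ x * Real.exp (2 * R x), Real.exp (2 * R a), Real.one_le_exp (by linarith), hΨ,
    measurableSet_Ioo, Ioo_subset_Ioi_self,
    fun x hx => mul_pos (A.pos x hx.1) (Real.exp_pos _), ?_, hmeas, ?_, ?_, ?_⟩
  · intro x hx y hy0 hy
    have : ¬ y ≤ x := fun hyx => hy ⟨hy0, hyx.trans_lt hx.2⟩
    simp [greenKernel, this]
  · intro x hx
    refine (hint x hx).mono' ((hmeas x hx).norm.mul
      (hΨc.aestronglyMeasurable measurableSet_Ioo)) ?_
    refine (ae_restrict_iff' measurableSet_Ioo).2 (Eventually.of_forall fun y hy => ?_)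
    rw [norm_mul, norm_norm, Real.norm_of_nonneg
      (mul_pos (A.pos y hy.1) (Real.exp_pos _)).le]
    exact hker x hx y hy
  · intro x hx
    have hsets : Ioo 0 a ∩ Iic x = Ioc 0 x := by
      ext y; exact ⟨fun hy => ⟨hy.1.1, hy.2⟩, fun hy => ⟨⟨hy.1, hy.2.trans_lt hx.2⟩, hy.2⟩⟩
    calc _ ≤ ∫ y in Ioo 0 a, (Iic x).indicator (fun y => φ x * (ρ y * Real.exp (2 * R y))) y := by
          refine integral_mono_of_nonneg ?_ (hint x hx) ?_
          · refine (ae_restrict_iff' measurableSet_Ioo).2 (Eventually.of_forall fun y hy => ?_)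
            exact mul_nonneg (norm_nonneg _) (mul_pos (A.pos y hy.1) (Real.exp_pos _)).le
          · exact (ae_restrict_iff' measurableSet_Ioo).2 (Eventually.of_forall (hker x hx))
      _ = φ x * ∫ y in Ioc 0 x, ρ y * Real.exp (2 * R y) := by
          rw [setIntegral_indicator measurableSet_Iic, hsets, integral_const_mul]
      _ ≤ φ x * (Real.exp (2 * R x) / 2) := by
          have hφ := (A.pos x hx.1).le
          gcongr
          exact (integral_mul_exp_primitive_le hρi hρ0 hx).2
      _ = _ := by ring
  · rintro u hu ⟨M, hM⟩
    -- For `x < a` the operator sees `u` only on `]0, x]`, so `u` may be cut off at `a`. The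
    -- variation-of-constants function of the cut-off is then defined and differentiable on the
    -- whole half-line, which gives measurability.
    set u' := (Ioo 0 a).indicator u with hu'
    have hu'm : AEStronglyMeasurable u' volume :=
      (aestronglyMeasurable_indicator_iff measurableSet_Ioo).2 hu
    have hbd : ∀ᵐ y, y ∈ Ioo 0 a → ‖u y‖ ≤ |M| * Real.exp (2 * R a) * φ y := by
      rw [← ae_restrict_iff' measurableSet_Ioo]
      filter_upwards [hM, ae_restrict_mem measurableSet_Ioo] with y hy hyE
      calc _ ≤ _ := hy
        _ ≤ |M| * (φ y * Real.exp (2 * R y)) := by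
            have := (mul_pos (A.pos y hyE.1) (Real.exp_pos (2 * R y))).le
            gcongr
            exact le_abs_self M
        _ ≤ |M| * (Real.exp (2 * R a) * φ y) :=
            mul_le_mul_of_nonneg_left (hΨ y hyE).2 (abs_nonneg M)
        _ = _ := by ring
    have hbd' : ∀ b : ℝ, ∀ᵐ y ∂(volume.restrict (Ioo 0 b)),
        ‖u' y‖ ≤ |M| * Real.exp (2 * R a) * φ y := by
      intro b
      filter_upwards [ae_restrict_of_ae hbd, ae_restrict_mem measurableSet_Ioo] with y hy hyb
      by_cases hyE : y ∈ Ioo 0 a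
      · rw [hu', indicator_of_mem hyE]; exact hy hyE
      · rw [hu', indicator_of_notMem hyE, norm_zero]
        have := (A.pos y hyb.1).le
        positivity
    have hi : ∀ g : ℝ → ℂ, ContinuousOn g (Ioi 0) →
        (∀ b : ℝ, 0 < b → ∃ C, ∀ y ∈ Ioo 0 b, ‖g y‖ ≤ C * ω y) →
        ∀ b : ℝ, 0 < b → IntegrableOn (fun y => g y * (Q y * u' y)) (Ioo 0 b) := by
      intro g hg hgb b hb
      obtain ⟨Cb, hCb⟩ := hgb b hb
      exact A.integrableOn_mul hg hCb hu'm.restrict (hbd' b) hb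
    have i₁ := hi h.1 T.sol₁.continuousOn fun b hb => by
      obtain ⟨Cb, -, -, hb'⟩ := T.bound b hb
      exact ⟨Cb, fun y hy => (hb' y hy).1⟩
    have i₂ := hi h.2 T.sol₂.continuousOn fun b hb => by
      obtain ⟨Cb, -, -, hb'⟩ := T.bound b hb
      exact ⟨Cb, fun y hy => (hb' y hy).2⟩
    have hcont : ContinuousOn (particular h.1 h.2 (fun y => Q y * u' y)) (Ioi 0) := fun x hx =>
      (hasDerivAt_particular T.sol₁ T.sol₂ i₁ i₂ hx).continuousAt.continuousWithinAt
    refine ((hcont.mono Ioo_subset_Ioi_self).congr fun x hx => ?_).aestronglyMeasurable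
      measurableSet_Ioo
    rw [← kernelOp_greenKernel i₁ i₂ hx.1, kernelOp, kernelOp]
    refine setIntegral_congr_fun measurableSet_Ioi fun y hy => ?_
    by_cases hyE : y ∈ Ioo 0 a
    · simp only [hu', indicator_of_mem hyE]
    · have : ¬ y ≤ x := fun hyx => hyE ⟨hy, hyx.trans_lt hx.2⟩
      simp [greenKernel, this]

end

/-! ### Inversion of `1 + G⁰_→ Q` in weighted spaces -/

section

variable {v : ℝ → ℂ} {ω η : ℝ → ℝ} {h : (ℝ → ℂ) × (ℝ → ℂ)} {Q : ℝ → ℂ} {φ : ℝ → ℝ}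

theorem ae_le_weightedNorm (hφ0 : ∀ x, 0 < x → 0 < φ x)
    {a : ℝ} {f : ℝ → ℂ} (hf : f ∈ weightedLinfty a φ) :
    ∀ᵐ x ∂(volume.restrict (Ioo 0 a)), ‖f x‖ ≤ (weightedNorm a φ f).toReal * φ x := by
  have := ae_le_eLpNormEssSup (f := fun x => f x / (φ x : ℂ))
    (μ := volume.restrict (Ioo 0 a))
  filter_upwards [this, ae_restrict_mem measurableSet_Ioo] with x hx hxa
  rw [← eLpNorm_exponent_top] at hx
  have h2 := ENNReal.toReal_mono hf.2.ne hx
  rw [toReal_enorm, norm_div, Complex.norm_real, Real.norm_of_nonneg (hφ0 x hxa.1).le,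
    div_le_iff₀ (hφ0 x hxa.1)] at h2
  exact h2

theorem mem_weightedLinfty_iff (hφ : ContinuousOn φ (Ioi 0)) (hφ0 : ∀ x, 0 < x → 0 < φ x)
    {a : ℝ} {f : ℝ → ℂ} :
    f ∈ weightedLinfty a φ ↔ AEStronglyMeasurable f (volume.restrict (Ioo 0 a)) ∧
      ∃ M : ℝ, 0 ≤ M ∧ ∀ᵐ x ∂(volume.restrict (Ioo 0 a)), ‖f x‖ ≤ M * φ x := by
  have hm : AEStronglyMeasurable (fun x => (φ x : ℂ)) (volume.restrict (Ioo 0 a)) :=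
    (Complex.continuous_ofReal.comp_continuousOn (hφ.mono Ioo_subset_Ioi_self)).aestronglyMeasurable
      measurableSet_Ioo
  constructor
  · intro hf
    refine ⟨?_, (weightedNorm a φ f).toReal, ENNReal.toReal_nonneg, ?_⟩
    · refine (hf.1.mul hm).congr ?_
      filter_upwards [ae_restrict_mem measurableSet_Ioo] with x hx
      have : (φ x : ℂ) ≠ 0 := Complex.ofReal_ne_zero.2 (hφ0 x hx.1).ne'
      simp [this]
    · exact ae_le_weightedNorm hφ0 hf
  · rintro ⟨h1, M, -, hM⟩
    refine memLp_top_of_bound (h1.div₀ hm) M ?_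
    filter_upwards [hM, ae_restrict_mem measurableSet_Ioo] with x hx hxa
    rw [norm_div, Complex.norm_real, Real.norm_of_nonneg (hφ0 x hxa.1).le,
      div_le_iff₀ (hφ0 x hxa.1)]
    exact hx

theorem weightedNorm_le_of_ae (hφ0 : ∀ x, 0 < x → 0 < φ x)
    {a M : ℝ} {f : ℝ → ℂ} (hf : ∀ᵐ x ∂(volume.restrict (Ioo 0 a)), ‖f x‖ ≤ M * φ x) :
    weightedNorm a φ f ≤ ENNReal.ofReal M := by
  rw [weightedNorm, eLpNorm_exponent_top]
  refine eLpNormEssSup_le_of_ae_bound ?_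
  filter_upwards [hf, ae_restrict_mem measurableSet_Ioo] with x hx hxa
  rw [norm_div, Complex.norm_real, Real.norm_of_nonneg (hφ0 x hxa.1).le,
    div_le_iff₀ (hφ0 x hxa.1)]
  exact hx

theorem weightedNorm_ne_top {a : ℝ} {f : ℝ → ℂ} (hf : f ∈ weightedLinfty a φ) :
    weightedNorm a φ f ≠ ∞ := hf.2.ne

/-- All estimates are made in the contracting weight `Ψ` and transferred to `φ` at the cost of the
equivalence constant `Λ`. -/
theorem oneAddGreenInvertible {m k : ℂ} (T : TamePair v ω η (fundamentalPair m k))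
    (hW : WeightPair ω η) (A : AdmissibleWeight ω η Q φ) {a : ℝ} (ha : 0 < a) :
    OneAddGreenInvertible m k Q a φ := by
  obtain ⟨Ψ, Λ, hΛ, hΨ, V⟩ := T.volterraWeight hW A ha
  have hΛ0 : 0 ≤ Λ := zero_le_one.trans hΛ
  have hiff := fun f => mem_weightedLinfty_iff (a := a) (f := f) A.continuousOn A.pos
  have toΨ : ∀ {f : ℝ → ℂ} {M : ℝ}, 0 ≤ M →
      (∀ᵐ x ∂(volume.restrict (Ioo 0 a)), ‖f x‖ ≤ M * φ x) →
      ∀ᵐ x ∂(volume.restrict (Ioo 0 a)), ‖f x‖ ≤ M * Ψ x := by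
    intro f M hM hf
    filter_upwards [hf, ae_restrict_mem measurableSet_Ioo] with x hx hxa
    exact hx.trans (mul_le_mul_of_nonneg_left (hΨ x hxa).1 hM)
  have hop : ∀ {f : ℝ → ℂ} {M : ℝ}, 0 ≤ M →
      (∀ᵐ x ∂(volume.restrict (Ioo 0 a)), ‖f x‖ ≤ M * φ x) →
      ∀ᵐ x ∂(volume.restrict (Ioo 0 a)), ‖greenQ m k Q f x‖ ≤ Λ * M * φ x := by
    intro f M hM hf
    filter_upwards [ae_restrict_mem measurableSet_Ioo] with x hxa
    rw [greenQ_eq]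
    refine (V.norm_kernelOp_le hM (toΨ hM hf) hxa).trans ?_
    calc M / 2 * Ψ x ≤ M * Ψ x := by
          have := V.pos x hxa
          gcongr
          linarith
      _ ≤ M * (Λ * φ x) := mul_le_mul_of_nonneg_left (hΨ x hxa).2 hM
      _ = _ := by ring
  have hmaps : ∀ f ∈ weightedLinfty a φ, greenQ m k Q f ∈ weightedLinfty a φ := by
    intro f hf
    obtain ⟨h1, M, hM, h2⟩ := (hiff f).1 hf
    refine (hiff _).2 ⟨?_, Λ * M, by positivity, hop hM h2⟩
    rw [greenQ_eq]
    exact V.op_measurable f h1 ⟨M, toΨ hM h2⟩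
  refine ⟨?_, hmaps, ?_, ?_, ?_⟩
  · intro f hf x hx
    obtain ⟨h1, M, hM, h2⟩ := (hiff f).1 hf
    have := V.integrableOn_Ioi h1 (toΨ hM h2) hx
    simpa only [forwardGreen_eq, mul_assoc] using this
  · refine ⟨ENNReal.ofReal Λ, ENNReal.ofReal_ne_top, fun f hf => ?_⟩
    refine (weightedNorm_le_of_ae A.pos (hop ENNReal.toReal_nonneg
      (ae_le_weightedNorm A.pos hf))).trans ?_
    rw [ENNReal.ofReal_mul hΛ0, ENNReal.ofReal_toReal (weightedNorm_ne_top hf)]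
  · intro f hf
    obtain ⟨h1, M, hM, h2⟩ := (hiff f).1 hf
    classical
    -- The Neumann series needs its bound at every point, whereas membership in the space gives it
    -- only almost everywhere; `f` is therefore replaced by another representative.
    set f' : ℝ → ℂ := fun x => if ‖f x‖ ≤ M * φ x then f x else 0 with hf'
    have hff : f =ᵐ[volume.restrict (Ioo 0 a)] f' := by
      filter_upwards [h2] with x hx
      simp [hf', hx]
    have hb : ∀ x ∈ Ioo 0 a, ‖f' x‖ ≤ M * Ψ x := by
      intro x hx
      have hφ := (A.pos x hx.1).le
      refine le_trans ?_ (mul_le_mul_of_nonneg_left (hΨ x hx).1 hM)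
      by_cases hfx : ‖f x‖ ≤ M * φ x
      · simp only [hf', if_pos hfx, hfx]
      · simp only [hf', if_neg hfx, norm_zero]
        positivity
    have hm := h1.congr hff
    refine ⟨neumannSum _ f', (hiff _).2 ⟨V.aestronglyMeasurable_neumannSum hM hm hb,
      2 * M * Λ, by positivity, ?_⟩, ?_⟩
    · filter_upwards [ae_restrict_mem measurableSet_Ioo] with x hx
      refine (V.summable_neumannTerm hM hm hb hx).2.trans ?_
      rw [mul_assoc (2 * M)]
      exact mul_le_mul_of_nonneg_left (hΨ x hx).2 (by positivity)
    · filter_upwards [hff, ae_restrict_mem measurableSet_Ioo] with x hfx hx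
      rw [hfx, greenQ_eq]
      exact V.neumannSum_add_kernelOp hM hm hb hx
  · refine ⟨ENNReal.ofReal (2 * Λ), ENNReal.ofReal_ne_top, fun u hu => ?_⟩
    obtain ⟨h1, M, hM, h2⟩ := (hiff u).1 hu
    obtain ⟨h3, N, hN, h4⟩ := (hiff _).1 (hmaps u hu)
    have hmem : (fun x => u x + greenQ m k Q u x) ∈ weightedLinfty a φ := by
      refine (hiff _).2 ⟨h1.add h3, M + N, by positivity, ?_⟩
      filter_upwards [h2, h4] with x hx hx'
      refine (norm_add_le _ _).trans ?_
      rw [add_mul]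
      exact add_le_add hx hx'
    have hB := toΨ ENNReal.toReal_nonneg (ae_le_weightedNorm A.pos hmem)
    rw [greenQ_eq] at hB
    have key := V.ae_bound_of_add_kernelOp hM ENNReal.toReal_nonneg (toΨ hM h2) hB
    rw [← greenQ_eq] at key
    refine (weightedNorm_le_of_ae A.pos (M := 2 * Λ *
      (weightedNorm a φ (fun x => u x + greenQ m k Q u x)).toReal) ?_).trans ?_
    · filter_upwards [key, ae_restrict_mem measurableSet_Ioo] with x hx hxa
      refine hx.trans ?_
      calc _ ≤ 2 * (weightedNorm a φ (fun x => u x + greenQ m k Q u x)).toReal * (Λ * φ x) :=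
            mul_le_mul_of_nonneg_left (hΨ x hxa).2 (by positivity)
        _ = _ := by ring
    · rw [ENNReal.ofReal_mul (by positivity), ENNReal.ofReal_toReal (weightedNorm_ne_top hmem)]

/-- Estimate of `∫₀ˣ (α h₂(y) - β h₁(y)) Q(y) u(y) dy / w`. -/
theorem norm_integral_combination_le {h₁ h₂ u : ℝ → ℂ} {α β w : ℂ} {c M x : ℝ} (hx : 0 < x)
    (i₁ : IntervalIntegrable (fun y => h₁ y * (Q y * u y)) volume 0 x)
    (i₂ : IntervalIntegrable (fun y => h₂ y * (Q y * u y)) volume 0 x)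
    (hc : ∀ y ∈ Ioc 0 x, ‖α * h₂ y - β * h₁ y‖ ≤ c * ω y)
    (hu : ∀ y ∈ Ioc 0 x, ‖u y‖ ≤ M * φ y)
    (hi : IntegrableOn (fun y => ω y * φ y * ‖Q y‖) (Ioc 0 x)) :
    ‖(α * (∫ y in (0 : ℝ)..x, h₂ y * (Q y * u y)) - β * (∫ y in (0 : ℝ)..x, h₁ y * (Q y * u y)))
      / w‖ ≤ c * M / ‖w‖ * ∫ y in Ioc 0 x, ω y * φ y * ‖Q y‖ := by
  rw [← intervalIntegral.integral_const_mul, ← intervalIntegral.integral_const_mul,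
    ← intervalIntegral.integral_sub (i₂.const_mul _) (i₁.const_mul _), norm_div,
    intervalIntegral.integral_of_le hx.le, div_mul_eq_mul_div, ← integral_const_mul]
  gcongr
  refine norm_integral_le_of_norm_le (hi.const_mul _) ?_
  filter_upwards [ae_restrict_mem measurableSet_Ioc] with y hy
  have e : α * (h₂ y * (Q y * u y)) - β * (h₁ y * (Q y * u y)) =
      (α * h₂ y - β * h₁ y) * (Q y * u y) := by ring
  rw [e, norm_mul, norm_mul]
  calc _ ≤ c * ω y * (‖Q y‖ * (M * φ y)) := by
        gcongr
        · exact (norm_nonneg _).trans (hc y hy)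
        · exact hc y hy
        · exact hu y hy
    _ = _ := by ring

/-- Existence of the solution `(1 + G Q)⁻¹ g₀` for the Green's operator `G` of a tame pair. -/
theorem TamePair.exists_solution (T : TamePair v ω η h) (hW : WeightPair ω η)
    (A : AdmissibleWeight ω η Q φ) {g₀ : ℝ → ℂ} (hg₀ : SolvesODE v g₀)
    (hb : ∀ a : ℝ, 0 < a → ∃ M : ℝ, 0 ≤ M ∧ ∀ x ∈ Ioo 0 a, ‖g₀ x‖ ≤ M * φ x) :
    ∃ g : ℝ → ℂ, SolvesODE (fun x => v x + Q x) g ∧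
      (∀ a : ℝ, 0 < a → ∃ M : ℝ, 0 ≤ M ∧ ∀ x ∈ Ioo 0 a, ‖g x‖ ≤ M * φ x) ∧
      (∀ x : ℝ, 0 < x → g x + kernelOp (fun x y => greenKernel h x y * Q y) g x = g₀ x) ∧
      ∃ C : ℝ, ∀ x ∈ Ioo (0 : ℝ) 1,
        ‖g x - g₀ x‖ ≤ C * (η x * ∫ y in Ioc 0 x, ω y * φ y * ‖Q y‖) ∧
        ‖deriv g x - deriv g₀ x‖ ≤ C * (η x / x * ∫ y in Ioc 0 x, ω y * φ y * ‖Q y‖) := by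
  set K : ℝ → ℝ → ℂ := fun x y => greenKernel h x y * Q y with hK
  set g := neumannSum K g₀ with hg
  have hloc : ∀ a : ℝ, 0 < a → AEStronglyMeasurable g (volume.restrict (Ioo 0 a)) ∧
      (∃ M : ℝ, 0 ≤ M ∧ ∀ x ∈ Ioo 0 a, ‖g x‖ ≤ M * φ x) ∧
      ∀ x ∈ Ioo 0 a, g x + kernelOp K g x = g₀ x := by
    intro a ha
    obtain ⟨Ψ, Λ, hΛ, hΨ, V⟩ := T.volterraWeight hW A ha
    obtain ⟨M, hM, hMb⟩ := hb a ha
    have hΛ0 : 0 ≤ Λ := zero_le_one.trans hΛ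
    have hm : AEStronglyMeasurable g₀ (volume.restrict (Ioo 0 a)) :=
      (hg₀.continuousOn.mono Ioo_subset_Ioi_self).aestronglyMeasurable measurableSet_Ioo
    have hMΨ : ∀ x ∈ Ioo 0 a, ‖g₀ x‖ ≤ M * Ψ x := fun x hx =>
      (hMb x hx).trans (mul_le_mul_of_nonneg_left (hΨ x hx).1 hM)
    refine ⟨V.aestronglyMeasurable_neumannSum hM hm hMΨ, ⟨2 * M * Λ, by positivity,
      fun x hx => ?_⟩, fun x hx => V.neumannSum_add_kernelOp hM hm hMΨ hx⟩
    refine (V.summable_neumannTerm hM hm hMΨ hx).2.trans ?_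
    rw [mul_assoc (2 * M)]
    exact mul_le_mul_of_nonneg_left (hΨ x hx).2 (by positivity)
  have i₁ : ∀ a : ℝ, 0 < a → IntegrableOn (fun y => h.1 y * (Q y * g y)) (Ioo 0 a) := by
    intro a ha
    obtain ⟨C, -, -, hC⟩ := T.bound a ha
    obtain ⟨h1, ⟨M, -, hM⟩, -⟩ := hloc a ha
    exact A.integrableOn_mul T.sol₁.continuousOn (fun y hy => (hC y hy).1) h1
      ((ae_restrict_iff' measurableSet_Ioo).2 (Eventually.of_forall hM)) ha
  have i₂ : ∀ a : ℝ, 0 < a → IntegrableOn (fun y => h.2 y * (Q y * g y)) (Ioo 0 a) := by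
    intro a ha
    obtain ⟨C, -, -, hC⟩ := T.bound a ha
    obtain ⟨h1, ⟨M, -, hM⟩, -⟩ := hloc a ha
    exact A.integrableOn_mul T.sol₂.continuousOn (fun y hy => (hC y hy).2) h1
      ((ae_restrict_iff' measurableSet_Ioo).2 (Eventually.of_forall hM)) ha
  have heq : ∀ x : ℝ, 0 < x → g x + kernelOp K g x = g₀ x := fun x hx =>
    (hloc (x + 1) (by positivity)).2.2 x ⟨hx, by linarith⟩
  -- From here on regularity, the differential equation and the asymptotics all follow from
  -- variation of constants with source `Q g`.
  have hform : ∀ x : ℝ, 0 < x → g x = g₀ x - particular h.1 h.2 (fun y => Q y * g y) x := by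
    intro x hx
    rw [← kernelOp_greenKernel i₁ i₂ hx, ← heq x hx]; ring
  have hder : ∀ x : ℝ, 0 < x →
      HasDerivAt g (deriv g₀ x - particularDeriv h.1 h.2 (fun y => Q y * g y) x) x := by
    intro x hx
    refine ((hg₀.hasDerivAt hx).sub (hasDerivAt_particular T.sol₁ T.sol₂ i₁ i₂
      hx)).congr_of_eventuallyEq ?_
    filter_upwards [Ioi_mem_nhds hx] with z hz using hform z hz
  refine ⟨g, solvesODE_of_hasDerivAt hder
    (hg₀.isAC_deriv.sub (isAC_particularDeriv T.sol₁ T.sol₂ i₁ i₂)) ?_,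
    fun a ha => (hloc a ha).2.1, heq, ?_⟩
  · filter_upwards [hg₀.eq, hasDerivAt_particularDeriv T.sol₁ T.sol₂ i₁ i₂ T.wronskian_ne_zero,
      ae_restrict_mem measurableSet_Ioi] with x h1 h2 hx
    convert! h1.sub h2 using 1
    linear_combination v x * hform x hx
  · obtain ⟨C, hC0, hC, -⟩ := T.bound 1 one_pos
    obtain ⟨-, ⟨M, hM0, hM⟩, -⟩ := hloc 1 one_pos
    refine ⟨C * M / ‖wronskian h.1 h.2 1‖, fun x hx => ?_⟩
    have hu : ∀ y ∈ Ioc 0 x, ‖g y‖ ≤ M * φ y := fun y hy => hM y ⟨hy.1, hy.2.trans_lt hx.2⟩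
    have hi : IntegrableOn (fun y => ω y * φ y * ‖Q y‖) (Ioc 0 x) :=
      (A.integrable 1 one_pos).mono_set fun y hy => ⟨hy.1, hy.2.trans_lt hx.2⟩
    have j₁ := intervalIntegrable_zero_of_forall i₁ hx.1
    have j₂ := intervalIntegrable_zero_of_forall i₂ hx.1
    constructor
    · rw [hform x hx.1, sub_sub_cancel_left, norm_neg, particular]
      refine (norm_integral_combination_le (c := C * η x) hx.1 j₁ j₂ (fun y hy => ?_)
        hu hi).trans (le_of_eq (by ring))
      exact (hC x y hy.1 hy.2 hx.2).1.trans (le_of_eq (by ring))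
    · rw [(hder x hx.1).deriv, sub_sub_cancel_left, norm_neg, particularDeriv]
      refine (norm_integral_combination_le (c := C * (η x / x)) hx.1 j₁ j₂ (fun y hy => ?_)
        hu hi).trans (le_of_eq (by ring))
      exact (hC x y hy.1 hy.2 hx.2).2.trans (le_of_eq (by ring))

end

section

variable {v : ℝ → ℂ} {ω η : ℝ → ℝ} {p : (ℝ → ℂ) × (ℝ → ℂ)} {Q : ℝ → ℂ} {φ : ℝ → ℝ}

/-! ### Uniqueness -/

/-- If the Wronskian of a solution `d` of the perturbed equation and a solution `g` of the
unperturbed one vanishes at `0`, it is given by an integral from `0`. -/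
theorem wronskian_eq_neg_integral {d g : ℝ → ℂ} (hd : SolvesODE (fun x => v x + Q x) d)
    (hg : SolvesODE v g)
    (hi : ∀ a : ℝ, 0 < a → IntegrableOn (fun y => g y * (Q y * d y)) (Ioo 0 a))
    (h0 : Tendsto (wronskian d g) (𝓝[>] 0) (𝓝 0)) {x : ℝ} (hx : 0 < x) :
    wronskian d g x = -∫ y in (0 : ℝ)..x, g y * (Q y * d y) := by
  have hix := intervalIntegrable_zero_of_forall hi hx
  have hc := intervalIntegral.continuousOn_primitive_interval' hix left_mem_uIcc
  have hc0 : Tendsto (fun y => ∫ z in (0 : ℝ)..y, g z * (Q z * d z)) (𝓝[>] 0) (𝓝 0) := by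
    have h1 := (hc 0 left_mem_uIcc).tendsto
    rw [intervalIntegral.integral_same] at h1
    refine h1.mono_left ?_
    rw [← nhdsWithin_Ioo_eq_nhdsGT hx, uIcc_of_le hx.le]
    exact nhdsWithin_mono _ Ioo_subset_Icc_self
  have he : ∀ᶠ y in 𝓝[>] (0 : ℝ), wronskian d g y = wronskian d g x
      + ((∫ z in (0 : ℝ)..x, g z * (Q z * d z)) - ∫ z in (0 : ℝ)..y, g z * (Q z * d z)) := by
    filter_upwards [self_mem_nhdsWithin] with y hy
    have hiy := intervalIntegrable_zero_of_forall hi hy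
    have e2 : ∀ z, (v z - (v z + Q z)) * (d z * g z) = -(g z * (Q z * d z)) := fun z => by ring
    have e1 := hd.wronskian_sub_eq_integral hg hy hx (by
      simp_rw [e2]; exact (hiy.symm.trans hix).neg)
    simp_rw [e2] at e1
    rw [intervalIntegral.integral_neg, ← intervalIntegral.integral_interval_sub_left hix hiy] at e1
    linear_combination -e1
  have h2 := (h0.congr' he)
  have h3 := ((hc0.const_sub (∫ z in (0 : ℝ)..x, g z * (Q z * d z))).const_add (wronskian d g x))
  have := tendsto_nhds_unique h2 h3
  rw [sub_zero] at this
  linear_combination -this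

/-- Vanishing of both Wronskians at `0` removes the boundary terms in variation of constants, so `d`
solves the homogeneous equation `d + G Q d = 0`; the contraction leaves only the zero solution. -/
theorem TamePair.eq_zero (T : TamePair v ω η p) (hW : WeightPair ω η)
    (A : AdmissibleWeight ω η Q φ) {d : ℝ → ℂ} (hd : SolvesODE (fun x => v x + Q x) d)
    (hb : ∀ a : ℝ, 0 < a → ∃ M : ℝ, 0 ≤ M ∧ ∀ x ∈ Ioo 0 a, ‖d x‖ ≤ M * φ x)
    (h₁ : Tendsto (wronskian d p.1) (𝓝[>] 0) (𝓝 0))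
    (h₂ : Tendsto (wronskian d p.2) (𝓝[>] 0) (𝓝 0)) {x : ℝ} (hx : 0 < x) : d x = 0 := by
  have hdm : ∀ a : ℝ, AEStronglyMeasurable d (volume.restrict (Ioo 0 a)) := fun a =>
    (hd.continuousOn.mono Ioo_subset_Ioi_self).aestronglyMeasurable measurableSet_Ioo
  have i₁ : ∀ a : ℝ, 0 < a → IntegrableOn (fun y => p.1 y * (Q y * d y)) (Ioo 0 a) := by
    intro a ha
    obtain ⟨C, -, -, hC⟩ := T.bound a ha
    obtain ⟨M, -, hM⟩ := hb a ha
    exact A.integrableOn_mul T.sol₁.continuousOn (fun y hy => (hC y hy).1) (hdm a)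
      ((ae_restrict_iff' measurableSet_Ioo).2 (Eventually.of_forall hM)) ha
  have i₂ : ∀ a : ℝ, 0 < a → IntegrableOn (fun y => p.2 y * (Q y * d y)) (Ioo 0 a) := by
    intro a ha
    obtain ⟨C, -, -, hC⟩ := T.bound a ha
    obtain ⟨M, -, hM⟩ := hb a ha
    exact A.integrableOn_mul T.sol₂.continuousOn (fun y hy => (hC y hy).2) (hdm a)
      ((ae_restrict_iff' measurableSet_Ioo).2 (Eventually.of_forall hM)) ha
  have hform : ∀ x : ℝ, 0 < x → d x + kernelOp (fun x y => greenKernel p x y * Q y) d x = 0 := by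
    intro x hx
    rw [kernelOp_greenKernel i₁ i₂ hx, particular]
    have e1 := wronskian_eq_neg_integral hd T.sol₁ i₁ h₁ hx
    have e2 := wronskian_eq_neg_integral hd T.sol₂ i₂ h₂ hx
    have hw := T.wronskian_ne_zero
    have hwx := T.sol₁.wronskian_eq T.sol₂ one_pos hx
    have e1' : ∫ y in (0 : ℝ)..x, p.1 y * (Q y * d y) = -wronskian d p.1 x := by rw [e1, neg_neg]
    have e2' : ∫ y in (0 : ℝ)..x, p.2 y * (Q y * d y) = -wronskian d p.2 x := by rw [e2, neg_neg]
    rw [e1', e2']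
    field_simp
    rw [← hwx]
    simp only [wronskian]
    ring
  obtain ⟨Ψ, Λ, hΛ, hΨ, V⟩ := T.volterraWeight hW A (a := x + 1) (by positivity)
  obtain ⟨M, hM0, hM⟩ := hb (x + 1) (by positivity)
  have hae := V.ae_bound_of_add_kernelOp (h := d) (B := 0) hM0 le_rfl
    ((ae_restrict_iff' measurableSet_Ioo).2 (Eventually.of_forall fun y hy =>
      (hM y hy).trans (mul_le_mul_of_nonneg_left (hΨ y hy).1 hM0)))
    ((ae_restrict_iff' measurableSet_Ioo).2 (Eventually.of_forall fun y hy => by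
      rw [hform y hy.1]; simp))
  have hxE : x ∈ Ioo 0 (x + 1) := ⟨hx, by linarith⟩
  -- The contraction gives `d = 0` almost everywhere; the integral operator then vanishes at `x`
  -- itself, and the integral equation upgrades this to `d x = 0`.
  have := V.norm_kernelOp_le (u := d) (M := 0) le_rfl (by simpa using hae) hxE
  have h0 : kernelOp (fun x y => greenKernel p x y * Q y) d x = 0 := by simpa using this
  simpa [h0] using hform x hx

/-- The order bound covers a neighbourhood of `0`, and compactness covers the remaining interval up
to `a`. -/
theorem exists_bound_of_isBigO {f : ℝ → ℂ} (hf : ContinuousOn f (Ioi 0))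
    (hφ : ContinuousOn φ (Ioi 0)) (hφ0 : ∀ x, 0 < x → 0 < φ x) (h : f =O[𝓝[>] (0 : ℝ)] φ)
    (a : ℝ) (ha : 0 < a) : ∃ M : ℝ, 0 ≤ M ∧ ∀ x ∈ Ioo 0 a, ‖f x‖ ≤ M * φ x := by
  obtain ⟨c, hc⟩ := h.bound
  obtain ⟨δ, hδ, hsub⟩ := mem_nhdsGT_iff_exists_Ioo_subset.1 hc
  have hδ : 0 < δ := hδ
  have hcont : ContinuousOn (fun x => ‖f x‖ / φ x) (Icc (min (δ / 2) a) a) :=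
    (hf.norm.div hφ fun x hx => (hφ0 x hx).ne').mono
      fun x hx => (lt_min (half_pos hδ) ha).trans_le hx.1
  obtain ⟨M, hM⟩ := isCompact_Icc.exists_bound_of_continuousOn hcont
  refine ⟨|c| + |M|, by positivity, fun x hx => ?_⟩
  have hφx := hφ0 x hx.1
  rcases lt_or_ge x (min (δ / 2) a) with h1 | h1
  · have h2 := hsub ⟨hx.1, by linarith [h1.trans_le (min_le_left _ _)]⟩
    simp only [mem_ofPred_eq] at h2
    rw [Real.norm_of_nonneg hφx.le] at h2
    refine h2.trans ?_
    gcongr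
    linarith [le_abs_self c, abs_nonneg M]
  · have h2 := hM x ⟨h1, hx.2.le⟩
    rw [Real.norm_of_nonneg (by positivity), div_le_iff₀ hφx] at h2
    refine h2.trans ?_
    gcongr
    linarith [le_abs_self M, abs_nonneg c]

/-- A potential that is integrable near `0` against `ω φ` is admissible. -/
theorem admissibleWeight_of_integrableOn (hω : ContinuousOn ω (Ioi 0))
    (hφ : ContinuousOn φ (Ioi 0))
    (hφ0 : ∀ x, 0 < x → 0 < φ x)
    (hle : ∀ a : ℝ, 0 < a → ∃ C : ℝ, 0 ≤ C ∧ ∀ x ∈ Ioo 0 a, η x ≤ C * φ x)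
    (hQ : LocallyIntegrableOn Q (Ioi 0))
    (hi : IntegrableOn (fun y => ω y * φ y * ‖Q y‖) (Ioo 0 1)) : AdmissibleWeight ω η Q φ := by
  refine ⟨hQ, hφ, hφ0, hle, fun a ha => ?_⟩
  have hsub : Icc 1 (max 1 a) ⊆ Ioi (0 : ℝ) := fun x hx => zero_lt_one.trans_le hx.1
  have h1 : IntegrableOn (fun y => ω y * φ y * ‖Q y‖) (Icc 1 (max 1 a)) :=
    IntegrableOn.continuousOn_mul ((hω.mul hφ).mono hsub)
      (hQ.integrableOn_compact_subset hsub isCompact_Icc).norm isCompact_Icc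
  refine (hi.union h1).mono_set fun x hx => ?_
  rcases lt_or_ge x 1 with h | h
  · exact Or.inl ⟨hx.1, h⟩
  · exact Or.inr ⟨h, hx.2.le.trans (le_max_right _ _)⟩

end

/-! ### The abstract theorem -/

theorem besselPotential_zero_add (m k : ℂ) :
    besselPotential m k 0 = fun x => besselPotential m 0 0 x + k ^ 2 := by
  ext x; simp [besselPotential]

theorem besselPotential_add (m k : ℂ) (Q : ℝ → ℂ) :
    besselPotential m k Q = fun x => besselPotential m k 0 x + Q x := by
  ext x; simp [besselPotential]

theorem besselPotential_absorb (m k : ℂ) (Q : ℝ → ℂ) :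
    besselPotential m k Q = fun x => besselPotential m 0 0 x + (Q x + k ^ 2) := by
  ext x; simp [besselPotential]; ring

theorem continuousOn_besselPotential (m k : ℂ) : ContinuousOn (besselPotential m k 0) (Ioi 0) := by
  refine ContinuousOn.add (ContinuousOn.add (ContinuousOn.mul continuousOn_const ?_)
    continuousOn_const) continuousOn_const
  refine continuousOn_const.div (by fun_prop) fun x hx => ?_
  have hx : (x : ℝ) ≠ 0 := ne_of_gt hx
  simpa using hx

/-- The solutions with initial data `(1, 0)` and `(0, 1)` at `1` have Wronskian `1`, so the choice
is made from a nonempty set. Later estimates hold for whichever pair was chosen. -/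
theorem isFundamentalPair_fundamentalPair (m k : ℂ) :
    IsFundamentalPair m k (fundamentalPair m k) := by
  obtain ⟨f, hf, f1, f2⟩ := exists_solvesODE (continuousOn_besselPotential m k) 1 0
  obtain ⟨g, hg, g1, g2⟩ := exists_solvesODE (continuousOn_besselPotential m k) 0 1
  refine Classical.epsilon_spec (p := IsFundamentalPair m k) ⟨(f, g), ?_, ?_, ?_⟩
  · exact isSolution_iff_solvesODE.2 hf
  · exact isSolution_iff_solvesODE.2 hg
  · simp [wronskian, f1, f2, g1, g2]

theorem tamePair_fundamentalPair {m : ℂ} {ω η : ℝ → ℝ} {p : (ℝ → ℂ) × (ℝ → ℂ)}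
    (T : TamePair (besselPotential m 0 0) ω η p) (hW : WeightPair ω η) (k : ℂ) :
    TamePair (besselPotential m k 0) ω η (fundamentalPair m k) := by
  obtain ⟨h1, h2, h3⟩ := isFundamentalPair_fundamentalPair m k
  rw [isSolution_iff_solvesODE, besselPotential_zero_add] at h1 h2
  rw [besselPotential_zero_add]
  exact T.add_const hW (k ^ 2) h1 h2 h3

/-- On `]0, x]` one has `F y ≤ x^ε y^(-ε) F y`, and the integral of `y^(-ε) F` over `]0, x]` tends
to `0`; this produces `o` instead of `O`. -/
theorem isLittleO_of_le_integral {F : ℝ → ℝ} {f : ℝ → ℂ} {C τ ε : ℝ} (hε : 0 ≤ ε)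
    (hF : ∀ y ∈ Ioo (0 : ℝ) 1, 0 ≤ F y)
    (hFi : IntegrableOn F (Ioo 0 1))
    (hi : IntegrableOn (fun y => y ^ (-ε) * F y) (Ioo 0 1))
    (hf : ∀ x ∈ Ioo (0 : ℝ) 1, ‖f x‖ ≤ C * (x ^ τ * ∫ y in Ioc 0 x, F y)) :
    f =o[𝓝[>] (0 : ℝ)] (fun x => x ^ (τ + ε)) := by
  have hii : IntervalIntegrable (fun y => y ^ (-ε) * F y) volume 0 1 := by
    rw [intervalIntegrable_iff_integrableOn_Ioo_of_le zero_le_one]; exact hi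
  have hc := intervalIntegral.continuousOn_primitive_interval' hii left_mem_uIcc
  have hc0 : Tendsto (fun x => |C| * ∫ y in (0 : ℝ)..x, y ^ (-ε) * F y) (𝓝[>] 0) (𝓝 0) := by
    have h1 := (hc 0 left_mem_uIcc).tendsto
    rw [intervalIntegral.integral_same] at h1
    have h2 : Tendsto (fun x => ∫ y in (0 : ℝ)..x, y ^ (-ε) * F y) (𝓝[>] 0) (𝓝 0) := by
      refine h1.mono_left ?_
      rw [← nhdsWithin_Ioo_eq_nhdsGT (zero_lt_one (α := ℝ)), uIcc_of_le zero_le_one]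
      exact nhdsWithin_mono _ Ioo_subset_Icc_self
    simpa using h2.const_mul |C|
  rw [isLittleO_iff]
  intro c hcpos
  have hev := hc0.eventually (gt_mem_nhds hcpos)
  filter_upwards [hev, Ioo_mem_nhdsGT (zero_lt_one (α := ℝ))] with x hx hx1
  have hx0 : 0 < x := hx1.1
  have hsub : Ioc 0 x ⊆ Ioo 0 1 := fun y hy => ⟨hy.1, hy.2.trans_lt hx1.2⟩
  have hle : ∫ y in Ioc 0 x, F y ≤ x ^ ε * ∫ y in Ioc 0 x, y ^ (-ε) * F y := by
    rw [← integral_const_mul]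
    refine setIntegral_mono_on (hFi.mono_set hsub) ((hi.mono_set hsub).const_mul _)
      measurableSet_Ioc fun y hy => ?_
    have h1 : y ^ ε ≤ x ^ ε := Real.rpow_le_rpow hy.1.le hy.2 hε
    have h2 : 1 = y ^ ε * y ^ (-ε) := by rw [← Real.rpow_add hy.1]; simp
    have hFy := hF y (hsub hy)
    calc F y = y ^ ε * (y ^ (-ε) * F y) := by rw [← mul_assoc, ← h2, one_mul]
      _ ≤ _ := by
        have := Real.rpow_nonneg hy.1.le (-ε)
        gcongr
  have hnn : 0 ≤ ∫ y in Ioc 0 x, F y :=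
    setIntegral_nonneg measurableSet_Ioc fun y hy => hF y (hsub hy)
  have hxτ := Real.rpow_nonneg hx0.le τ
  rw [Real.norm_of_nonneg (Real.rpow_nonneg hx0.le _)]
  calc ‖f x‖ ≤ C * (x ^ τ * ∫ y in Ioc 0 x, F y) := hf x hx1
    _ ≤ |C| * (x ^ τ * (x ^ ε * ∫ y in Ioc 0 x, y ^ (-ε) * F y)) := by
        gcongr
        exact le_abs_self C
    _ = (|C| * ∫ y in (0 : ℝ)..x, y ^ (-ε) * F y) * x ^ (τ + ε) := by
        rw [Real.rpow_add hx0, intervalIntegral.integral_of_le hx0.le]; ring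
    _ ≤ c * x ^ (τ + ε) := by gcongr

/-- The perturbation theorem for a model pair of the equation with `k = 0` and `Q = 0`, from the
uniqueness of solutions that are small at `0`. -/
theorem exists_isUniqueMatchingSolution {m k : ℂ} {Q : ℝ → ℂ} {ω φ : ℝ → ℝ} {ε : ℝ}
    {p : (ℝ → ℂ) × (ℝ → ℂ)} (hε : 0 ≤ ε)
    (T : TamePair (besselPotential m 0 0) ω (fun x => x ^ (1 / 2 + m.re)) p)
    (hW : WeightPair ω (fun x => x ^ (1 / 2 + m.re)))
    (hU : ∀ (Q' d : ℝ → ℂ), AdmissibleWeight ω (fun x => x ^ (1 / 2 + m.re)) Q'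
        (fun x => x ^ (1 / 2 + m.re)) →
      SolvesODE (fun x => besselPotential m 0 0 x + Q' x) d →
      d =o[𝓝[>] (0 : ℝ)] (fun x => x ^ (1 / 2 + m.re)) →
      deriv d =o[𝓝[>] (0 : ℝ)] (fun x => x ^ (1 / 2 + m.re - 1)) → ∀ x, 0 < x → d x = 0)
    (hφ : ContinuousOn φ (Ioi 0)) (hφ0 : ∀ x, 0 < x → 0 < φ x)
    (hle : ∀ a : ℝ, 0 < a → ∃ C : ℝ, 0 ≤ C ∧ ∀ x ∈ Ioo 0 a, x ^ (1 / 2 + m.re) ≤ C * φ x)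
    (hQ : LocallyIntegrableOn Q (Ioi 0))
    (hi : IntegrableOn (fun y => y ^ (-ε) * (ω y * φ y * ‖Q y‖)) (Ioo 0 1))
    {g₀ : ℝ → ℂ} (hg₀ : IsSolution m k 0 g₀)
    (hb : ∀ a : ℝ, 0 < a → ∃ M : ℝ, 0 ≤ M ∧ ∀ x ∈ Ioo 0 a, ‖g₀ x‖ ≤ M * φ x) :
    ∃ g : ℝ → ℂ, IsInverseImage m k Q φ g₀ g ∧
      IsUniqueMatchingSolution m k Q g₀ (1 / 2 + m.re + ε) g := by
  have hQm : AEStronglyMeasurable Q (volume.restrict (Ioo 0 1)) :=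
    hQ.aestronglyMeasurable.mono_set Ioo_subset_Ioi_self
  have hFm : AEStronglyMeasurable (fun y => ω y * φ y * ‖Q y‖) (volume.restrict (Ioo 0 1)) :=
    (((hW.continuousOn_left.mul hφ).mono Ioo_subset_Ioi_self).aestronglyMeasurable
      measurableSet_Ioo).mul hQm.norm
  have hF0 : ∀ y ∈ Ioo (0 : ℝ) 1, 0 ≤ ω y * φ y * ‖Q y‖ := fun y hy =>
    mul_nonneg (mul_pos (hW.pos_left y hy.1) (hφ0 y hy.1)).le (norm_nonneg _)
  have hFi : IntegrableOn (fun y => ω y * φ y * ‖Q y‖) (Ioo 0 1) := by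
    refine hi.mono' hFm ?_
    filter_upwards [ae_restrict_mem measurableSet_Ioo] with y hy
    rw [Real.norm_of_nonneg (hF0 y hy)]
    refine le_mul_of_one_le_left (hF0 y hy) ?_
    exact Real.one_le_rpow_of_pos_of_le_one_of_nonpos hy.1 hy.2.le (by linarith)
  have A := admissibleWeight_of_integrableOn (η := fun x => x ^ (1 / 2 + m.re))
    hW.continuousOn_left hφ hφ0 hle hQ hFi
  have Tk := tamePair_fundamentalPair T hW k
  have hg₀' := isSolution_iff_solvesODE.1 hg₀
  obtain ⟨g, hg, hgb, hgeq, C, hC⟩ := Tk.exists_solution hW A hg₀' hb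
  rw [← besselPotential_add] at hg
  have hmem : ∀ f : ℝ → ℂ, ContinuousOn f (Ioi 0) →
      (∀ a : ℝ, 0 < a → ∃ M : ℝ, 0 ≤ M ∧ ∀ x ∈ Ioo 0 a, ‖f x‖ ≤ M * φ x) →
      ∀ a : ℝ, 0 < a → f ∈ weightedLinfty a φ := by
    intro f hf hfb a ha
    obtain ⟨M, hM0, hM⟩ := hfb a ha
    exact (mem_weightedLinfty_iff hφ hφ0).2
      ⟨(hf.mono Ioo_subset_Ioi_self).aestronglyMeasurable measurableSet_Ioo, M, hM0,
        (ae_restrict_iff' measurableSet_Ioo).2 (Eventually.of_forall hM)⟩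
  have hmatch : MatchesNearZero g₀ (1 / 2 + m.re + ε) g := by
    refine ⟨isLittleO_of_le_integral hε hF0 hFi hi (fun x hx => (hC x hx).1), ?_⟩
    have := isLittleO_of_le_integral (C := C) (τ := 1 / 2 + m.re - 1)
      (f := fun x => deriv g x - deriv g₀ x) hε hF0 hFi hi
      (fun x hx => by
        rw [Real.rpow_sub_one hx.1.ne']
        exact (hC x hx).2)
    convert! this using 3
    ring
  refine ⟨g, ⟨fun a ha => oneAddGreenInvertible Tk hW A ha, hmem g₀ hg₀'.continuousOn hb,
    hmem g hg.continuousOn hgb, fun x hx => by rw [greenQ_eq]; exact hgeq x hx⟩,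
    isSolution_iff_solvesODE.2 hg, hmatch, ?_⟩
  intro f hf hfm x hx
  have hf' := isSolution_iff_solvesODE.1 hf
  have hd := hf'.sub hg
  rw [besselPotential_absorb] at hd
  -- Uniqueness is proved in the smaller weight `η`, whatever `φ` is, since the difference of two
  -- matching solutions is already `o(η)`. The potential stays admissible: `η ≤ C₁ φ` handles `Q`,
  -- and boundedness of `η ω` handles `k²`.
  have hA' : AdmissibleWeight ω (fun x => x ^ (1 / 2 + m.re)) (fun x => Q x + k ^ 2)
      (fun x => x ^ (1 / 2 + m.re)) := by
    refine admissibleWeight_of_integrableOn hW.continuousOn_left hW.continuousOn_right hW.pos_right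
      (fun a ha => ⟨1, zero_le_one, fun x _ => by rw [one_mul]⟩)
      (hQ.add (continuousOn_const.locallyIntegrableOn measurableSet_Ioi)) ?_
    obtain ⟨C₁, hC₁0, hC₁⟩ := hle 1 one_pos
    obtain ⟨B, hB0, hB⟩ := hW.mul_le 1 one_pos
    have hdom : IntegrableOn (fun y => C₁ * (ω y * φ y * ‖Q y‖) + B * ‖k ^ 2‖) (Ioo 0 1) :=
      (hFi.const_mul C₁).add (integrable_const _)
    refine hdom.mono' ?_ ?_
    · exact (((hW.continuousOn_left.mul hW.continuousOn_right).mono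
        Ioo_subset_Ioi_self).aestronglyMeasurable measurableSet_Ioo).mul
        (hQm.add aestronglyMeasurable_const).norm
    · filter_upwards [ae_restrict_mem measurableSet_Ioo] with y hy
      have hωy := (hW.pos_left y hy.1).le
      have hηy := (hW.pos_right y hy.1).le
      rw [Real.norm_of_nonneg (by positivity)]
      have h1 := hC₁ y hy
      have h2 := hB y hy
      calc ω y * y ^ (1 / 2 + m.re) * ‖Q y + k ^ 2‖
          ≤ ω y * y ^ (1 / 2 + m.re) * (‖Q y‖ + ‖k ^ 2‖) := by
            gcongr; exact norm_add_le _ _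
        _ = ω y * y ^ (1 / 2 + m.re) * ‖Q y‖ + y ^ (1 / 2 + m.re) * ω y * ‖k ^ 2‖ := by ring
        _ ≤ ω y * (C₁ * φ y) * ‖Q y‖ + B * ‖k ^ 2‖ := by gcongr
        _ = _ := by ring
  have hpow : ∀ τ : ℝ, (fun x : ℝ => x ^ (τ + ε)) =O[𝓝[>] (0 : ℝ)] (fun x => x ^ τ) := by
    intro τ
    refine IsBigO.of_bound 1 ?_
    filter_upwards [Ioo_mem_nhdsGT (zero_lt_one (α := ℝ))] with y hy
    rw [Real.norm_of_nonneg (Real.rpow_nonneg hy.1.le _),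
      Real.norm_of_nonneg (Real.rpow_nonneg hy.1.le _), one_mul]
    exact Real.rpow_le_rpow_of_exponent_ge hy.1 hy.2.le (by linarith)
  have hd1 : (fun x => f x - g x) =o[𝓝[>] (0 : ℝ)] (fun x => x ^ (1 / 2 + m.re)) := by
    have := (hfm.1.sub hmatch.1).trans_isBigO (hpow (1 / 2 + m.re))
    simpa using this
  have hd2 : deriv (fun x => f x - g x) =o[𝓝[>] (0 : ℝ)] (fun x => x ^ (1 / 2 + m.re - 1)) := by
    have h1 := hfm.2.sub hmatch.2
    rw [show 1 / 2 + m.re + ε - 1 = 1 / 2 + m.re - 1 + ε by ring] at h1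
    refine (h1.trans_isBigO (hpow (1 / 2 + m.re - 1))).congr' ?_ EventuallyEq.rfl
    filter_upwards [self_mem_nhdsWithin] with y hy
    rw [((hf'.hasDerivAt hy).fun_sub (hg.hasDerivAt hy)).deriv]
    ring
  exact sub_eq_zero.1 (hU _ _ hA' hd hd1 hd2 x hx)

/-! ### Model solutions for `m ≠ 0` -/

theorem hasDerivAt_ofReal_cpow (s : ℂ) {x : ℝ} (hx : 0 < x) :
    HasDerivAt (fun x : ℝ => (x : ℂ) ^ s) (s * (x : ℂ) ^ (s - 1)) x := by
  have h1 := ((hasDerivAt_id (x : ℂ)).cpow_const (c := s)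
    (Complex.ofReal_mem_slitPlane.2 hx)).comp_ofReal
  simpa using h1

theorem solvesODE_cpow {m s : ℂ} (hs : s * (s - 1) = m ^ 2 - 1 / 4) :
    SolvesODE (besselPotential m 0 0) (fun x : ℝ => (x : ℂ) ^ s) := by
  have h2 : ∀ x : ℝ, 0 < x → HasDerivAt (fun x : ℝ => s * (x : ℂ) ^ (s - 1))
      (s * ((s - 1) * (x : ℂ) ^ (s - 1 - 1))) x :=
    fun x hx => (hasDerivAt_ofReal_cpow (s - 1) hx).const_mul s
  refine solvesODE_of_hasDerivAt (fun x hx => hasDerivAt_ofReal_cpow s hx)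
    (isAC_of_hasDerivAt h2 ?_) ?_
  · intro x hx
    exact ((((hasDerivAt_ofReal_cpow (s - 1 - 1) hx).continuousAt).const_mul (s - 1)).const_mul
      s).continuousWithinAt
  · filter_upwards [ae_restrict_mem measurableSet_Ioi] with x hx
    convert! h2 x hx using 1
    have hx0 : (x : ℂ) ≠ 0 := Complex.ofReal_ne_zero.2 (ne_of_gt hx)
    rw [besselPotential, Complex.cpow_sub _ _ hx0, Complex.cpow_sub _ _ hx0, Complex.cpow_one, ← hs]
    simp only [Pi.zero_apply]
    field_simp
    ring

theorem norm_ofReal_cpow (s : ℂ) {x : ℝ} (hx : 0 < x) : ‖(x : ℂ) ^ s‖ = x ^ s.re :=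
  Complex.norm_cpow_eq_rpow_re_of_pos hx s

theorem norm_deriv_ofReal_cpow (s : ℂ) {x : ℝ} (hx : 0 < x) :
    ‖deriv (fun x : ℝ => (x : ℂ) ^ s) x‖ = ‖s‖ * (x ^ s.re / x) := by
  rw [(hasDerivAt_ofReal_cpow s hx).deriv, norm_mul, norm_ofReal_cpow _ hx, Complex.sub_re,
    Complex.one_re, Real.rpow_sub_one hx.ne']

theorem continuousOn_rpow_Ioi (s : ℝ) : ContinuousOn (fun x : ℝ => x ^ s) (Ioi 0) := fun x hx =>
  (Real.continuousAt_rpow_const x s (Or.inl (ne_of_gt hx))).continuousWithinAt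

/-- The solutions `x^{1/2+m}` and `x^{1/2-m}` of the equation with `k = 0`. -/
noncomputable def powerPair (m : ℂ) : (ℝ → ℂ) × (ℝ → ℂ) :=
  (fun x => (x : ℂ) ^ (1 / 2 + m), fun x => (x : ℂ) ^ (1 / 2 - m))

theorem weightPair_power (μ : ℝ) :
    WeightPair (fun x => x ^ (1 / 2 - μ)) (fun x => x ^ (1 / 2 + μ)) := by
  refine ⟨continuousOn_rpow_Ioi _, continuousOn_rpow_Ioi _, fun x hx => Real.rpow_pos_of_pos hx _,
    fun x hx => Real.rpow_pos_of_pos hx _, fun a ha => ⟨a, ha.le, fun x hx => ?_⟩⟩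
  rw [← Real.rpow_add hx.1, show 1 / 2 + μ + (1 / 2 - μ) = 1 by ring, Real.rpow_one]
  exact hx.2.le

theorem rpow_add_le_mul_rpow_sub {μ x a : ℝ} (hμ : 0 ≤ μ) (hx : 0 < x) (hxa : x ≤ a) :
    x ^ (1 / 2 + μ) ≤ a ^ (2 * μ) * x ^ (1 / 2 - μ) := by
  rw [show 1 / 2 + μ = 2 * μ + (1 / 2 - μ) by ring, Real.rpow_add hx]
  have := Real.rpow_nonneg hx.le (1 / 2 - μ)
  gcongr

/-- Of the two products in the bisolution, the one with `x^(1/2 - Re m) y^(1/2 + Re m)` is dominated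
by the other, because `(y/x)^(2 Re m) ≤ 1` for `y ≤ x`. The Wronskian is `-2 m`, which is where `m ≠
0` enters. -/
theorem tamePair_power {m : ℂ} (hm : 0 ≤ m.re) (hm0 : m ≠ 0) :
    TamePair (besselPotential m 0 0) (fun x => x ^ (1 / 2 - m.re)) (fun x => x ^ (1 / 2 + m.re))
      (powerPair m) := by
  have r1 : (1 / 2 + m).re = 1 / 2 + m.re := by simp
  have r2 : (1 / 2 - m).re = 1 / 2 - m.re := by simp
  have n1 : ∀ x : ℝ, 0 < x → ‖(powerPair m).1 x‖ = x ^ (1 / 2 + m.re) := fun x hx => by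
    rw [← r1]; exact norm_ofReal_cpow _ hx
  have n2 : ∀ x : ℝ, 0 < x → ‖(powerPair m).2 x‖ = x ^ (1 / 2 - m.re) := fun x hx => by
    rw [← r2]; exact norm_ofReal_cpow _ hx
  have d1 : ∀ x : ℝ, 0 < x → ‖deriv (powerPair m).1 x‖ = ‖1 / 2 + m‖ * (x ^ (1 / 2 + m.re) / x) :=
    fun x hx => by rw [← r1]; exact norm_deriv_ofReal_cpow _ hx
  have d2 : ∀ x : ℝ, 0 < x → ‖deriv (powerPair m).2 x‖ = ‖1 / 2 - m‖ * (x ^ (1 / 2 - m.re) / x) :=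
    fun x hx => by rw [← r2]; exact norm_deriv_ofReal_cpow _ hx
  refine ⟨solvesODE_cpow (by ring), solvesODE_cpow (by ring), ?_, fun a ha => ?_⟩
  · have e1 : deriv (powerPair m).1 1 = 1 / 2 + m := by
      rw [powerPair, (hasDerivAt_ofReal_cpow _ one_pos).deriv]; simp
    have e2 : deriv (powerPair m).2 1 = 1 / 2 - m := by
      rw [powerPair, (hasDerivAt_ofReal_cpow _ one_pos).deriv]; simp
    have : wronskian (powerPair m).1 (powerPair m).2 1 = -2 * m := by
      rw [wronskian, e1, e2]
      simp only [powerPair, Complex.ofReal_one, Complex.one_cpow]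
      ring
    rw [this]
    simpa using hm0
  · have ha2 : 0 ≤ a ^ (2 * m.re) := Real.rpow_nonneg ha.le _
    have key : ∀ x y : ℝ, 0 < y → y ≤ x →
        x ^ (1 / 2 - m.re) * y ^ (1 / 2 + m.re) ≤ y ^ (1 / 2 - m.re) * x ^ (1 / 2 + m.re) := by
      intro x y hy hyx
      have hx : 0 < x := hy.trans_le hyx
      have h1 := rpow_add_le_mul_rpow_sub hm hy hyx
      have h2 : x ^ (1 / 2 + m.re) = x ^ (2 * m.re) * x ^ (1 / 2 - m.re) := by
        rw [← Real.rpow_add hx]; congr 1; ring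
      have h3 := Real.rpow_nonneg hx.le (1 / 2 - m.re)
      calc _ ≤ x ^ (1 / 2 - m.re) * (x ^ (2 * m.re) * y ^ (1 / 2 - m.re)) := by gcongr
        _ = _ := by rw [h2]; ring
    refine ⟨2 + ‖1 / 2 + m‖ + ‖1 / 2 - m‖ + a ^ (2 * m.re), by positivity,
      fun x y hy hyx hxa => ?_, fun y hy => ?_⟩
    · have hx : 0 < x := hy.trans_le hyx
      have k1 := key x y hy hyx
      have hnn : 0 ≤ y ^ (1 / 2 - m.re) * x ^ (1 / 2 + m.re) :=
        mul_nonneg (Real.rpow_nonneg hy.le _) (Real.rpow_nonneg hx.le _)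
      constructor
      · refine (norm_sub_le _ _).trans ?_
        rw [norm_mul, norm_mul, n1 x hx, n1 y hy, n2 x hx, n2 y hy]
        calc _ ≤ 2 * (y ^ (1 / 2 - m.re) * x ^ (1 / 2 + m.re)) := by linarith
          _ ≤ _ := by
            gcongr
            linarith [norm_nonneg (1 / 2 + m), norm_nonneg (1 / 2 - m)]
      · refine (norm_sub_le _ _).trans ?_
        rw [norm_mul, norm_mul, d1 x hx, n1 y hy, d2 x hx, n2 y hy]
        calc _ = (‖1 / 2 + m‖ * (y ^ (1 / 2 - m.re) * x ^ (1 / 2 + m.re))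
              + ‖1 / 2 - m‖ * (x ^ (1 / 2 - m.re) * y ^ (1 / 2 + m.re))) / x := by ring
          _ ≤ (‖1 / 2 + m‖ * (y ^ (1 / 2 - m.re) * x ^ (1 / 2 + m.re))
              + ‖1 / 2 - m‖ * (y ^ (1 / 2 - m.re) * x ^ (1 / 2 + m.re))) / x := by gcongr
          _ = (‖1 / 2 + m‖ + ‖1 / 2 - m‖) * (y ^ (1 / 2 - m.re) * x ^ (1 / 2 + m.re)) / x := by
              ring
          _ ≤ (2 + ‖1 / 2 + m‖ + ‖1 / 2 - m‖ + a ^ (2 * m.re)) *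
              (y ^ (1 / 2 - m.re) * x ^ (1 / 2 + m.re)) / x :=
              div_le_div_of_nonneg_right (mul_le_mul_of_nonneg_right (by linarith) hnn) hx.le
          _ = _ := by ring
    · have h3 := Real.rpow_nonneg hy.1.le (1 / 2 - m.re)
      rw [n1 y hy.1, n2 y hy.1]
      constructor
      · refine (rpow_add_le_mul_rpow_sub hm hy.1 hy.2.le).trans ?_
        gcongr
        linarith [norm_nonneg (1 / 2 + m), norm_nonneg (1 / 2 - m)]
      · refine le_mul_of_one_le_left h3 ?_
        linarith [norm_nonneg (1 / 2 + m), norm_nonneg (1 / 2 - m)]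

/-- The Wronskian of two functions vanishes at `0` when the orders of growth cancel. -/
theorem tendsto_wronskian_zero {d g : ℝ → ℂ} {s t : ℝ} (hst : s + t - 1 = 0)
    (hd : d =o[𝓝[>] (0 : ℝ)] (fun x => x ^ s))
    (hd' : deriv d =o[𝓝[>] (0 : ℝ)] (fun x => x ^ (s - 1)))
    (hg : g =O[𝓝[>] (0 : ℝ)] (fun x => x ^ t))
    (hg' : deriv g =O[𝓝[>] (0 : ℝ)] (fun x => x ^ (t - 1))) :
    Tendsto (wronskian d g) (𝓝[>] 0) (𝓝 0) := by
  have e1 : (fun x : ℝ => x ^ s * x ^ (t - 1)) =ᶠ[𝓝[>] (0 : ℝ)] fun _ => (1 : ℝ) := by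
    filter_upwards [self_mem_nhdsWithin] with x hx
    rw [← Real.rpow_add hx, show s + (t - 1) = 0 by linarith, Real.rpow_zero]
  have e2 : (fun x : ℝ => x ^ (s - 1) * x ^ t) =ᶠ[𝓝[>] (0 : ℝ)] fun _ => (1 : ℝ) := by
    filter_upwards [self_mem_nhdsWithin] with x hx
    rw [← Real.rpow_add hx, show s - 1 + t = 0 by linarith, Real.rpow_zero]
  have h1 := (hd.mul_isBigO hg').congr' EventuallyEq.rfl e1
  have h2 := (hd'.mul_isBigO hg).congr' EventuallyEq.rfl e2
  exact (isLittleO_one_iff ℝ).1 (h1.sub h2)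

theorem isBigO_ofReal_cpow (s : ℂ) {t : ℝ} (ht : t ≤ s.re) :
    (fun x : ℝ => (x : ℂ) ^ s) =O[𝓝[>] (0 : ℝ)] (fun x => x ^ t) ∧
    deriv (fun x : ℝ => (x : ℂ) ^ s) =O[𝓝[>] (0 : ℝ)] (fun x => x ^ (t - 1)) := by
  constructor
  · refine IsBigO.of_bound 1 ?_
    filter_upwards [Ioo_mem_nhdsGT (zero_lt_one (α := ℝ))] with x hx
    rw [norm_ofReal_cpow s hx.1, Real.norm_of_nonneg (Real.rpow_nonneg hx.1.le _), one_mul]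
    exact Real.rpow_le_rpow_of_exponent_ge hx.1 hx.2.le ht
  · refine IsBigO.of_bound ‖s‖ ?_
    filter_upwards [Ioo_mem_nhdsGT (zero_lt_one (α := ℝ))] with x hx
    rw [norm_deriv_ofReal_cpow s hx.1, Real.norm_of_nonneg (Real.rpow_nonneg hx.1.le _),
      ← Real.rpow_sub_one hx.1.ne']
    refine mul_le_mul_of_nonneg_left ?_ (norm_nonneg s)
    exact Real.rpow_le_rpow_of_exponent_ge hx.1 hx.2.le (by linarith)

/-- Both model solutions are `O(x^(1/2 - Re m))`, exactly the order that cancels the decay of `d` in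
the Wronskian. -/
theorem eq_zero_of_isLittleO_power {m : ℂ} (hm : 0 ≤ m.re) (hm0 : m ≠ 0) (Q d : ℝ → ℂ)
    (A : AdmissibleWeight (fun x => x ^ (1 / 2 - m.re)) (fun x => x ^ (1 / 2 + m.re)) Q
      (fun x => x ^ (1 / 2 + m.re)))
    (hs : SolvesODE (fun x => besselPotential m 0 0 x + Q x) d)
    (hd : d =o[𝓝[>] (0 : ℝ)] (fun x => x ^ (1 / 2 + m.re)))
    (hd' : deriv d =o[𝓝[>] (0 : ℝ)] (fun x => x ^ (1 / 2 + m.re - 1))) (x : ℝ) (hx : 0 < x) :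
    d x = 0 := by
  have b1 := isBigO_ofReal_cpow (1 / 2 + m) (t := 1 / 2 - m.re) (by simp; linarith)
  have b2 := isBigO_ofReal_cpow (1 / 2 - m) (t := 1 / 2 - m.re) (by simp)
  exact (tamePair_power hm hm0).eq_zero (weightPair_power m.re) A hs
    (exists_bound_of_isBigO hs.continuousOn A.continuousOn A.pos hd.isBigO)
    (tendsto_wronskian_zero (by ring) hd hd' b1.1 b1.2)
    (tendsto_wronskian_zero (by ring) hd hd' b2.1 b2.2) hx

/-! ### Model solutions for `m = 0` -/

/-- The solutions `x^{1/2}` and `x^{1/2} log x` of the equation with `k = 0` and `m = 0`. -/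
noncomputable def logPair : (ℝ → ℂ) × (ℝ → ℂ) :=
  (fun x => (x : ℂ) ^ (1 / 2 : ℂ), fun x => (x : ℂ) ^ (1 / 2 : ℂ) * (Real.log x : ℂ))

theorem norm_logPair_fst {x : ℝ} (hx : 0 < x) : ‖logPair.1 x‖ = x ^ (1 / 2 : ℝ) := by
  rw [logPair, norm_ofReal_cpow _ hx]; norm_num

theorem deriv_logPair_fst {x : ℝ} (hx : 0 < x) :
    deriv logPair.1 x = 1 / 2 * (logPair.1 x / x) := by
  have hx0 : (x : ℂ) ≠ 0 := Complex.ofReal_ne_zero.2 hx.ne'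
  rw [logPair, (hasDerivAt_ofReal_cpow _ hx).deriv, Complex.cpow_sub _ _ hx0, Complex.cpow_one]

theorem solvesODE_logPair_fst : SolvesODE (besselPotential 0 0 0) logPair.1 :=
  solvesODE_cpow (by norm_num)

theorem hasDerivAt_log_ofReal {x : ℝ} (hx : 0 < x) :
    HasDerivAt (fun x : ℝ => (Real.log x : ℂ)) (1 / (x : ℂ)) x := by
  simpa using (Real.hasDerivAt_log hx.ne').ofReal_comp

theorem hasDerivAt_logPair_snd {x : ℝ} (hx : 0 < x) :
    HasDerivAt logPair.2 (deriv logPair.1 x * (Real.log x : ℂ) + logPair.1 x / x) x := by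
  convert! (solvesODE_logPair_fst.hasDerivAt hx).mul (hasDerivAt_log_ofReal hx) using 1
  ring

theorem solvesODE_logPair_snd : SolvesODE (besselPotential 0 0 0) logPair.2 := by
  have hs := solvesODE_logPair_fst
  have hlog : IsAC (fun x : ℝ => (Real.log x : ℂ)) := by
    refine isAC_of_hasDerivAt (fun x hx => hasDerivAt_log_ofReal hx) ?_
    exact continuousOn_const.div (by fun_prop)
      fun x hx => Complex.ofReal_ne_zero.2 (ne_of_gt hx)
  have hinv : IsAC (fun x : ℝ => ((x : ℂ))⁻¹) := by
    refine isAC_of_hasDerivAt (f' := fun x : ℝ => -((x : ℂ) ^ 2)⁻¹) (fun x hx => ?_) ?_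
    · have h1 : HasDerivAt (fun x : ℝ => (x : ℂ)) 1 x := (hasDerivAt_id x).ofReal_comp
      convert! h1.inv (Complex.ofReal_ne_zero.2 (ne_of_gt hx)) using 1
      ring
    · refine (ContinuousOn.inv₀ (by fun_prop) fun x hx => ?_).neg
      exact pow_ne_zero 2 (Complex.ofReal_ne_zero.2 (ne_of_gt hx))
  refine solvesODE_of_hasDerivAt (fun x hx => hasDerivAt_logPair_snd hx)
    (by simpa only [div_eq_mul_inv] using (hs.isAC_deriv.mul hlog).add (hs.isAC.mul hinv)) ?_
  filter_upwards [hs.eq, ae_restrict_mem measurableSet_Ioi] with x h1 hx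
  have hx : 0 < x := hx
  have hx0 : (x : ℂ) ≠ 0 := Complex.ofReal_ne_zero.2 hx.ne'
  have h2 : HasDerivAt (fun x : ℝ => (x : ℂ)) 1 x := (hasDerivAt_id x).ofReal_comp
  convert! (h1.mul (hasDerivAt_log_ofReal hx)).add ((hs.hasDerivAt hx).div h2 hx0) using 1
  rw [deriv_logPair_fst hx]
  have : logPair.2 x = logPair.1 x * (Real.log x : ℂ) := rfl
  rw [this]
  field_simp
  ring

theorem abs_log_le_add {x y a : ℝ} (hy : 0 < y) (hyx : y ≤ x) (hxa : x ≤ a) :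
    |Real.log x| ≤ |Real.log y| + |Real.log a| := by
  have hx : 0 < x := hy.trans_le hyx
  have h1 := Real.log_le_log hy hyx
  have h2 := Real.log_le_log hx hxa
  rw [abs_le]
  constructor
  · linarith [neg_abs_le (Real.log y), abs_nonneg (Real.log a)]
  · linarith [le_abs_self (Real.log a), abs_nonneg (Real.log y)]

theorem continuousOn_logWeight :
    ContinuousOn (fun x : ℝ => x ^ (1 / 2 : ℝ) * (1 + |Real.log x|)) (Ioi 0) :=
  (continuousOn_rpow_Ioi _).mul (continuousOn_const.add
    (Real.continuousOn_log.mono fun _ hx => ne_of_gt hx).abs)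

theorem logWeight_pos (x : ℝ) (hx : 0 < x) : 0 < x ^ (1 / 2 : ℝ) * (1 + |Real.log x|) := by
  positivity

theorem rpow_half_mul_self {x : ℝ} (hx : 0 < x) : x ^ (1 / 2 : ℝ) * x ^ (1 / 2 : ℝ) = x := by
  rw [← Real.rpow_add hx]; norm_num

theorem weightPair_log :
    WeightPair (fun x => x ^ (1 / 2 : ℝ) * (1 + |Real.log x|)) (fun x => x ^ (1 / 2 : ℝ)) := by
  refine ⟨continuousOn_logWeight, continuousOn_rpow_Ioi _, logWeight_pos,
    fun x hx => Real.rpow_pos_of_pos hx _,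
    fun a ha => ⟨a + 1 + a * |Real.log a|, by positivity, fun x hx => ?_⟩⟩
  rw [← mul_assoc, rpow_half_mul_self hx.1, mul_add, mul_one]
  have h0 := hx.1
  -- The product of the weights is `x + x |log x|`; its second term is less than `1` for `x ≤ 1` and
  -- at most `a |log a|` for `1 ≤ x < a`.
  rcases le_total x 1 with h | h
  · have h1 := (Real.abs_log_mul_self_lt x hx.1 h).le
    rw [abs_mul, abs_of_pos hx.1] at h1
    have : 0 ≤ a * |Real.log a| := by positivity
    linarith [hx.2]
  · have h1 := abs_log_le_add one_pos h hx.2.le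
    rw [Real.log_one, abs_zero, zero_add] at h1
    have : x * |Real.log x| ≤ a * |Real.log a| := by
      have := hx.2.le
      gcongr
    linarith [hx.2]

/-- The bisolution factors as `x^(1/2) y^(1/2) (log y - log x)`. For `y ≤ x < a` the logarithm of
`x` is controlled by that of `y` and a constant, so the logarithm can be charged to `ω(y)` alone and
`η` stays free of it. -/
theorem tamePair_log :
    TamePair (besselPotential 0 0 0) (fun x => x ^ (1 / 2 : ℝ) * (1 + |Real.log x|))
      (fun x => x ^ (1 / 2 : ℝ)) logPair := by
  have hsnd : ∀ x, logPair.2 x = logPair.1 x * (Real.log x : ℂ) := fun x => rfl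
  refine ⟨solvesODE_logPair_fst, solvesODE_logPair_snd, ?_, fun a ha => ?_⟩
  · rw [wronskian, (hasDerivAt_logPair_snd one_pos).deriv, hsnd]
    simp [logPair]
  · have hl : ∀ x y : ℝ, 0 < y → y ≤ x → x < a → ‖((Real.log y : ℂ) - (Real.log x : ℂ))‖ ≤
        (2 + |Real.log a|) * (1 + |Real.log y|) := by
      intro x y hy hyx hxa
      rw [← Complex.ofReal_sub, Complex.norm_real, Real.norm_eq_abs]
      refine (abs_sub _ _).trans ?_
      have := abs_log_le_add hy hyx hxa.le
      nlinarith [abs_nonneg (Real.log a), abs_nonneg (Real.log y)]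
    refine ⟨3 + |Real.log a|, by positivity, fun x y hy hyx hxa => ?_, fun y hy => ?_⟩
    · have hx : 0 < x := hy.trans_le hyx
      have hx0 : (x : ℂ) ≠ 0 := Complex.ofReal_ne_zero.2 hx.ne'
      have hl' := hl x y hy hyx hxa
      have hX := Real.rpow_nonneg hx.le (1 / 2 : ℝ)
      have hY := Real.rpow_nonneg hy.le (1 / 2 : ℝ)
      constructor
      · have e : logPair.1 x * logPair.2 y - logPair.2 x * logPair.1 y =
            logPair.1 x * logPair.1 y * ((Real.log y : ℂ) - (Real.log x : ℂ)) := by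
          rw [hsnd, hsnd]; ring
        rw [e, norm_mul, norm_mul, norm_logPair_fst hx, norm_logPair_fst hy]
        calc _ ≤ x ^ (1 / 2 : ℝ) * y ^ (1 / 2 : ℝ) * ((2 + |Real.log a|) * (1 + |Real.log y|)) := by
              gcongr
          _ ≤ x ^ (1 / 2 : ℝ) * y ^ (1 / 2 : ℝ) * ((3 + |Real.log a|) * (1 + |Real.log y|)) := by
              gcongr; norm_num
          _ = _ := by ring
      · have e : deriv logPair.1 x * logPair.2 y - deriv logPair.2 x * logPair.1 y =
            logPair.1 x * logPair.1 y * (1 / 2 * ((Real.log y : ℂ) - (Real.log x : ℂ)) - 1) / x := by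
          rw [(hasDerivAt_logPair_snd hx).deriv, deriv_logPair_fst hx, hsnd]; ring
        have h2 : ‖(1 / 2 * ((Real.log y : ℂ) - (Real.log x : ℂ)) - 1)‖ ≤
            (3 + |Real.log a|) * (1 + |Real.log y|) := by
          refine (norm_sub_le _ _).trans ?_
          rw [norm_mul, norm_one]
          have : ‖(1 / 2 : ℂ)‖ = 1 / 2 := by norm_num
          rw [this]
          have h3 := norm_nonneg ((Real.log y : ℂ) - (Real.log x : ℂ))
          nlinarith [abs_nonneg (Real.log a), abs_nonneg (Real.log y)]
        rw [e, norm_div, norm_mul, norm_mul, norm_logPair_fst hx, norm_logPair_fst hy,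
          Complex.norm_real, Real.norm_of_nonneg hx.le]
        calc _ ≤ x ^ (1 / 2 : ℝ) * y ^ (1 / 2 : ℝ) * ((3 + |Real.log a|) * (1 + |Real.log y|)) / x := by
              gcongr
          _ = _ := by ring
    · have hY := Real.rpow_nonneg hy.1.le (1 / 2 : ℝ)
      rw [hsnd, norm_mul, norm_logPair_fst hy.1, Complex.norm_real, Real.norm_eq_abs]
      have h1 := abs_nonneg (Real.log y)
      have h2 := abs_nonneg (Real.log a)
      constructor
      · calc y ^ (1 / 2 : ℝ) = 1 * (y ^ (1 / 2 : ℝ) * 1) := by ring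
          _ ≤ _ := by gcongr <;> linarith
      · calc y ^ (1 / 2 : ℝ) * |Real.log y| = 1 * (y ^ (1 / 2 : ℝ) * |Real.log y|) := by ring
          _ ≤ _ := by gcongr <;> linarith

/-- The hypotheses alone bound the Wronskian of `d` with `x^(1/2) log x` only by `o(log x)`. It
equals the Wronskian with `x^(1/2)` times `log x`, plus `d` times `x^(-1/2)`. The second term tends
to `0` directly; for the first, the vanishing of the simpler Wronskian is made quantitative through
its integral formula. -/
theorem eq_zero_of_isLittleO_log (Q d : ℝ → ℂ)
    (A : AdmissibleWeight (fun x => x ^ (1 / 2 : ℝ) * (1 + |Real.log x|)) (fun x => x ^ (1 / 2 : ℝ))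
      Q (fun x => x ^ (1 / 2 : ℝ)))
    (hs : SolvesODE (fun x => besselPotential 0 0 0 x + Q x) d)
    (hd : d =o[𝓝[>] (0 : ℝ)] (fun x => x ^ (1 / 2 : ℝ)))
    (hd' : deriv d =o[𝓝[>] (0 : ℝ)] (fun x => x ^ (1 / 2 - 1 : ℝ))) (x : ℝ) (hx : 0 < x) :
    d x = 0 := by
  have hb := exists_bound_of_isBigO hs.continuousOn A.continuousOn A.pos hd.isBigO
  have b1 := isBigO_ofReal_cpow (1 / 2) (t := 1 / 2) (by norm_num)
  have w1 : Tendsto (wronskian d logPair.1) (𝓝[>] 0) (𝓝 0) :=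
    tendsto_wronskian_zero (by ring) hd hd' b1.1 b1.2
  refine tamePair_log.eq_zero weightPair_log A hs hb w1 ?_ hx
  have i₁ : ∀ a : ℝ, 0 < a → IntegrableOn (fun y => logPair.1 y * (Q y * d y)) (Ioo 0 a) := by
    intro a ha
    obtain ⟨C, -, -, hC⟩ := tamePair_log.bound a ha
    obtain ⟨M, -, hM⟩ := hb a ha
    exact A.integrableOn_mul solvesODE_logPair_fst.continuousOn (fun y hy => (hC y hy).1)
      ((hs.continuousOn.mono Ioo_subset_Ioi_self).aestronglyMeasurable measurableSet_Ioo)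
      ((ae_restrict_iff' measurableSet_Ioo).2 (Eventually.of_forall hM)) ha
  obtain ⟨M, hM0, hM⟩ := hb 1 one_pos
  have hlog : Tendsto (fun x : ℝ => wronskian d logPair.1 x * (Real.log x : ℂ)) (𝓝[>] 0) (𝓝 0) := by
    have hii : IntervalIntegrable (fun y => y ^ (1 / 2 : ℝ) * (1 + |Real.log y|) * y ^ (1 / 2 : ℝ)
        * ‖Q y‖) volume 0 1 := by
      rw [intervalIntegrable_iff_integrableOn_Ioo_of_le zero_le_one]; exact A.integrable 1 one_pos
    have hc := intervalIntegral.continuousOn_primitive_interval' hii left_mem_uIcc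
    have hc0 : Tendsto (fun x => M * ∫ y in (0 : ℝ)..x, y ^ (1 / 2 : ℝ) * (1 + |Real.log y|) *
        y ^ (1 / 2 : ℝ) * ‖Q y‖) (𝓝[>] 0) (𝓝 0) := by
      have h1 := (hc 0 left_mem_uIcc).tendsto
      rw [intervalIntegral.integral_same] at h1
      have h2 := h1.mono_left (show 𝓝[>] (0 : ℝ) ≤ 𝓝[uIcc 0 1] 0 by
        rw [← nhdsWithin_Ioo_eq_nhdsGT (zero_lt_one (α := ℝ)), uIcc_of_le zero_le_one]
        exact nhdsWithin_mono _ Ioo_subset_Icc_self)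
      simpa using h2.const_mul M
    refine squeeze_zero_norm' ?_ hc0
    filter_upwards [Ioo_mem_nhdsGT (zero_lt_one (α := ℝ))] with x hx1
    have hx0 : 0 < x := hx1.1
    rw [wronskian_eq_neg_integral hs solvesODE_logPair_fst i₁ w1 hx0, neg_mul, norm_neg,
      ← intervalIntegral.integral_mul_const, intervalIntegral.integral_of_le hx0.le,
      intervalIntegral.integral_of_le hx0.le, ← integral_const_mul]
    refine norm_integral_le_of_norm_le (((A.integrable 1 one_pos).mono_set
      fun y hy => ⟨hy.1, hy.2.trans_lt hx1.2⟩).const_mul M) ?_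
    filter_upwards [ae_restrict_mem measurableSet_Ioc] with y hy
    -- For `y ≤ x < 1` the factor `log x` may be moved under the integral as `log y`, where the
    -- logarithm in the admissibility condition pays for it.
    have hlg : |Real.log x| ≤ |Real.log y| := by
      simpa using abs_log_le_add hy.1 hy.2 hx1.2.le
    have hY := Real.rpow_nonneg hy.1.le (1 / 2 : ℝ)
    rw [norm_mul, norm_mul, norm_mul, norm_logPair_fst hy.1, Complex.norm_real, Real.norm_eq_abs]
    calc _ ≤ y ^ (1 / 2 : ℝ) * (‖Q y‖ * (M * y ^ (1 / 2 : ℝ))) * (1 + |Real.log y|) := by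
          gcongr
          · exact hM y ⟨hy.1, hy.2.trans_lt hx1.2⟩
          · linarith
      _ = _ := by ring
  have hrest : Tendsto (fun x : ℝ => d x * (logPair.1 x / x)) (𝓝[>] 0) (𝓝 0) := by
    have h1 : (fun x : ℝ => d x * (2 * deriv logPair.1 x)) =o[𝓝[>] (0 : ℝ)]
        (fun x : ℝ => x ^ (1 / 2 : ℝ) * x ^ (1 / 2 - 1 : ℝ)) :=
      hd.mul_isBigO (b1.2.const_mul_left 2)
    have h2 : (fun x : ℝ => d x * (logPair.1 x / x)) =o[𝓝[>] (0 : ℝ)] (fun _ => (1 : ℝ)) := by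
      refine h1.congr' ?_ ?_
      · filter_upwards [self_mem_nhdsWithin] with x hx
        rw [deriv_logPair_fst hx]; ring
      · filter_upwards [self_mem_nhdsWithin] with x hx
        rw [← Real.rpow_add hx]; norm_num
    exact (isLittleO_one_iff ℝ).1 h2
  have hsum := hlog.add hrest
  rw [add_zero] at hsum
  refine hsum.congr' ?_
  filter_upwards [self_mem_nhdsWithin] with x hx
  rw [wronskian, wronskian, (hasDerivAt_logPair_snd hx).deriv,
    show logPair.2 x = logPair.1 x * (Real.log x : ℂ) from rfl]
  ring

/-- Solutions of the unperturbed equation are bounded near `0` by the first weight of a model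
pair. -/
theorem exists_bound_of_isSolution {m k : ℂ} {ω η : ℝ → ℝ} {p : (ℝ → ℂ) × (ℝ → ℂ)}
    (T : TamePair (besselPotential m 0 0) ω η p) (hW : WeightPair ω η) {g₀ : ℝ → ℂ}
    (hg₀ : IsSolution m k 0 g₀) (a : ℝ) (ha : 0 < a) :
    ∃ M : ℝ, 0 ≤ M ∧ ∀ x ∈ Ioo 0 a, ‖g₀ x‖ ≤ M * ω x := by
  obtain ⟨C, hC0, hC⟩ := T.backward_bound hW (k ^ 2) (a := a + 1) (by positivity)
  rw [isSolution_iff_solvesODE, besselPotential_zero_add] at hg₀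
  have hη := (hW.pos_right a ha).le
  refine ⟨C * (η a * (‖g₀ a‖ / a + ‖deriv g₀ a‖)), by positivity, fun x hx => ?_⟩
  refine (hC g₀ hg₀ a x hx.1 hx.2.le (by linarith)).trans (le_of_eq (by ring))

end PerturbedBessel

/-! ### The four cases of the theorem -/

theorem mainTheorem1 (k : ℂ) (hk : 0 ≤ k.re) (Q : ℝ → ℂ) (ε : ℝ) :
    -- principal `g₀`, `m ≠ 0`
    (∀ m : ℂ, 0 ≤ m.re → m ≠ 0 → 0 ≤ ε → Q ∈ PerturbedBessel.potentialClass ε →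
      ∀ g₀ : ℝ → ℂ, PerturbedBessel.IsSolution m k 0 g₀ →
        g₀ =O[𝓝[>] (0 : ℝ)] (fun x : ℝ => x ^ (1 / 2 + m.re)) →
        ∃ g : ℝ → ℂ,
          PerturbedBessel.IsInverseImage m k Q (fun x => x ^ (1 / 2 + m.re)) g₀ g ∧
          PerturbedBessel.IsUniqueMatchingSolution m k Q g₀ (1 / 2 + m.re + ε) g) ∧
    -- principal `g₀`, `m = 0`
    (0 ≤ ε → Q ∈ PerturbedBessel.logPotentialClass ε 1 →
      ∀ g₀ : ℝ → ℂ, PerturbedBessel.IsSolution 0 k 0 g₀ →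
        g₀ =O[𝓝[>] (0 : ℝ)] (fun x : ℝ => x ^ (1 / 2 : ℝ)) →
        ∃ g : ℝ → ℂ,
          PerturbedBessel.IsInverseImage 0 k Q (fun x => x ^ (1 / 2 : ℝ)) g₀ g ∧
          PerturbedBessel.IsUniqueMatchingSolution 0 k Q g₀ (1 / 2 + ε) g) ∧
    -- arbitrary `g₀`, `m ≠ 0`
    (∀ m : ℂ, 0 ≤ m.re → m ≠ 0 → 2 * m.re ≤ ε → Q ∈ PerturbedBessel.potentialClass ε →
      ∀ g₀ : ℝ → ℂ, PerturbedBessel.IsSolution m k 0 g₀ →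
        ∃ g : ℝ → ℂ,
          PerturbedBessel.IsInverseImage m k Q (fun x => x ^ (1 / 2 - m.re)) g₀ g ∧
          PerturbedBessel.IsUniqueMatchingSolution m k Q g₀ (1 / 2 - m.re + ε) g) ∧
    -- arbitrary `g₀`, `m = 0`
    (0 ≤ ε → Q ∈ PerturbedBessel.logPotentialClass ε 2 →
      ∀ g₀ : ℝ → ℂ, PerturbedBessel.IsSolution 0 k 0 g₀ →
        ∃ g : ℝ → ℂ,
          PerturbedBessel.IsInverseImage 0 k Q
            (fun x => x ^ (1 / 2 : ℝ) * (1 + |Real.log x|)) g₀ g ∧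
          PerturbedBessel.IsUniqueMatchingSolution 0 k Q g₀ (1 / 2 + ε) g) := by
  open PerturbedBessel in
  have T0 : TamePair (besselPotential 0 0 0) (fun x => x ^ (1 / 2 : ℝ) * (1 + |Real.log x|))
      (fun x => x ^ (1 / 2 + (0 : ℂ).re)) logPair := by simpa using tamePair_log
  have W0 : WeightPair (fun x => x ^ (1 / 2 : ℝ) * (1 + |Real.log x|))
      (fun x => x ^ (1 / 2 + (0 : ℂ).re)) := by simpa using weightPair_log
  have U0 : ∀ (Q' d : ℝ → ℂ), AdmissibleWeight (fun x => x ^ (1 / 2 : ℝ) * (1 + |Real.log x|))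
        (fun x => x ^ (1 / 2 + (0 : ℂ).re)) Q' (fun x => x ^ (1 / 2 + (0 : ℂ).re)) →
      SolvesODE (fun x => besselPotential 0 0 0 x + Q' x) d →
      d =o[𝓝[>] (0 : ℝ)] (fun x => x ^ (1 / 2 + (0 : ℂ).re)) →
      deriv d =o[𝓝[>] (0 : ℝ)] (fun x => x ^ (1 / 2 + (0 : ℂ).re - 1)) →
      ∀ x, 0 < x → d x = 0 := by
    simpa only [Complex.zero_re, add_zero] using eq_zero_of_isLittleO_log
  refine ⟨?_, ?_, ?_, ?_⟩
  · intro m hm hm0 hε hQ g₀ hg₀ hO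
    have hW := weightPair_power m.re
    refine exists_isUniqueMatchingSolution hε (tamePair_power hm hm0) hW
      (eq_zero_of_isLittleO_power hm hm0) hW.continuousOn_right hW.pos_right
      (fun a _ => ⟨1, zero_le_one, fun x _ => by rw [one_mul]⟩) hQ.1 ?_ hg₀
      (exists_bound_of_isBigO (isSolution_iff_solvesODE.1 hg₀).continuousOn
        hW.continuousOn_right hW.pos_right hO)
    -- With `φ = η` the product `ω φ` is `y`, so the condition of the abstract theorem is literally
    -- the class of `Q`.
    refine hQ.2.congr_fun (fun y hy => ?_) measurableSet_Ioo
    simp only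
    rw [← mul_assoc, ← Real.rpow_add hy.1, ← Real.rpow_add hy.1]
    congr 2; ring
  · intro hε hQ g₀ hg₀ hO
    have hW := weightPair_log
    have := exists_isUniqueMatchingSolution (k := k) (Q := Q) (g₀ := g₀)
      (φ := fun x => x ^ (1 / 2 : ℝ)) hε T0 W0 U0
      hW.continuousOn_right hW.pos_right
      (fun a _ => ⟨1, zero_le_one, fun x _ => by simp⟩) hQ.1 ?_ hg₀
      (exists_bound_of_isBigO (isSolution_iff_solvesODE.1 hg₀).continuousOn
        hW.continuousOn_right hW.pos_right hO)
    · simpa using this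
    · refine hQ.2.congr_fun (fun y hy => ?_) measurableSet_Ioo
      simp only [Real.rpow_one]
      rw [sub_eq_neg_add, Real.rpow_add_one hy.1.ne']
      linear_combination -(y ^ (-ε)) * (1 + |Real.log y|) * ‖Q y‖ * rpow_half_mul_self hy.1
  · intro m hm hm0 hε hQ g₀ hg₀
    have hW := weightPair_power m.re
    -- With `φ = ω` one has `ω φ = y^(1 - 2 Re m)`. The abstract theorem is applied with `ε - 2 Re
    -- m` in place of `ε`, which restores the weight `y^(1 - ε)` and gives the exponent `1/2 - Re m
    -- + ε`; nonnegativity of the new parameter is the hypothesis `2 Re m ≤ ε`.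
    have := exists_isUniqueMatchingSolution (k := k) (Q := Q) (g₀ := g₀) (sub_nonneg.2 hε)
      (tamePair_power hm hm0) hW
      (eq_zero_of_isLittleO_power hm hm0) hW.continuousOn_left hW.pos_left
      (fun a ha => ⟨a ^ (2 * m.re), Real.rpow_nonneg ha.le _, fun x hx =>
        rpow_add_le_mul_rpow_sub hm hx.1 hx.2.le⟩) hQ.1 ?_ hg₀
      (exists_bound_of_isSolution (tamePair_power hm hm0) hW hg₀)
    · rwa [show 1 / 2 + m.re + (ε - 2 * m.re) = 1 / 2 - m.re + ε by ring] at this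
    · refine hQ.2.congr_fun (fun y hy => ?_) measurableSet_Ioo
      simp only
      rw [← mul_assoc, ← Real.rpow_add hy.1, ← Real.rpow_add hy.1]
      congr 2; ring
  · intro hε hQ g₀ hg₀
    have hW := weightPair_log
    have := exists_isUniqueMatchingSolution (k := k) (Q := Q) (g₀ := g₀) hε T0 W0 U0
      hW.continuousOn_left hW.pos_left
      (fun a _ => ⟨1, zero_le_one, fun x hx => by
        simp only [Complex.zero_re, add_zero, one_mul]
        refine le_mul_of_one_le_right (Real.rpow_nonneg hx.1.le _) ?_
        linarith [abs_nonneg (Real.log x)]⟩) hQ.1 ?_ hg₀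
      (exists_bound_of_isSolution tamePair_log hW hg₀)
    · simpa using this
    · have hQm : AEStronglyMeasurable Q (volume.restrict (Ioo 0 1)) :=
        hQ.1.aestronglyMeasurable.mono_set Ioo_subset_Ioi_self
      -- Now `ω φ = y (1 + |log y|)²`, and the square is at most `2 (1 + |log y|²)`; this is why the
      -- squared logarithm appears in the condition on `Q`.
      refine (hQ.2.const_mul 2).mono' ?_ ?_
      · exact (((continuousOn_rpow_Ioi _).mono Ioo_subset_Ioi_self).aestronglyMeasurable
          measurableSet_Ioo).mul ((((continuousOn_logWeight.mul continuousOn_logWeight).mono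
          Ioo_subset_Ioi_self).aestronglyMeasurable measurableSet_Ioo).mul hQm.norm)
      · filter_upwards [ae_restrict_mem measurableSet_Ioo] with y hy
        have hy0 := hy.1
        rw [Real.norm_of_nonneg (by positivity)]
        rw [sub_eq_neg_add, Real.rpow_add_one hy.1.ne']
        have e : y ^ (1 / 2 : ℝ) * (1 + |Real.log y|) * (y ^ (1 / 2 : ℝ) * (1 + |Real.log y|)) =
            y * (1 + |Real.log y|) ^ 2 := by
          linear_combination (1 + |Real.log y|) ^ 2 * rpow_half_mul_self hy.1
        rw [e]
        have h2 : (1 + |Real.log y|) ^ 2 ≤ 2 * (1 + |Real.log y| ^ (2 : ℝ)) := by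
          rw [Real.rpow_two]; nlinarith [sq_nonneg (1 - |Real.log y|)]
        calc _ ≤ y ^ (-ε) * (y * (2 * (1 + |Real.log y| ^ (2 : ℝ))) * ‖Q y‖) := by gcongr
          _ = _ := by ring
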